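/- All matrices are complex. Let $1\le n_1<n_2<\dots<n_r=n$. A quiver with these dimensions is a family of linear maps $\alpha_i:\mathbb C^{n_i}\to\mathbb C^{n_{i+1}}$, $\beta_i:\mathbb C^{n_{i+1}}\to\mathbb C^{n_i}$ $(1\le i\le r-1)$; put $\alpha_0\beta_0=0$ and $Y=1+\alpha_{r-1}\beta_{r-1}$. Let $\mathcal S$ be the set of quivers such that all $1+\alpha_i\beta_i$, $1+\beta_i\alpha_i$ are invertible, all $\beta_i$ are surjective, and $$1+\beta_{i+1}\alpha_{i+1}=q_{i+1}(1+\alpha_i\beta_i)\qquad(0\le i\le r-2)$$ for some scalars $q_1,\dots,q_{r-1}\in\mathbb C$. The group $\prod_{i=1}^{r}SL(n_i,\mathbb C)$ acts by $\alpha_i\mapsto g_{i+1}\alpha_ig_i^{-1}$, $\beta_i\mapsto g_i\beta_ig_{i+1}^{-1}$, and $H_{\mathbb C}=\prod_{i=1}^{r-1}SL(n_i,\mathbb C)$. A quiver is in standard form if $\beta_i=(0\;\,I_{n_i})$ for all $i$. For a subgroup $S\subseteq SL(n,\mathbb C)$ acting by conjugation on a variety $F$ of $n\times n$ matrices, $SL(n,\mathbb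 C)\times_SF$ denotes the geometric quotient of $SL(n,\mathbb C)\times F$ by the action $p\cdot(u,v)=(up^{-1},pvp^{-1})$. (1) Full flag case, $r=n$ and $n_i=i$. Let $N$ be the group of upper unitriangular matrices, $B$ the group of upper triangular matrices in $SL(n,\mathbb C)$, and $B_1$ the group of upper triangular matrices in $GL(n,\mathbb C)$ with leading diagonal entry $1$. The map sending a quiver to $Y$ is a bijection from the quivers in $\mathcal S$ in standard form onto $B_1$. The geometric quotients $\mathcal S/H_{\mathbb C}$ and $SL(n,\mathbb C)\times_NB_1$ exist as quasi-affine varieties and are isomorphic, the class of $(g,Y)$ corresponding to the class of $g\cdot x$, where $x\in\mathcal S$ is the quiver in standard form with matrix $Y$. (2) Modified equations, full flag case. Let $\tilde{\mathcal S}$ be the set of pairs of a quiver and scalars $(\tilde q_0,\dots,\tilde q_{n-1})$ with $\tilde q_0\cdots\tilde q_{n-1}=1$, such that all $1+\alpha_i\beta_i$, $1+\beta_i\alpha_i$ are invertible, all $\beta_i$ are surjective and $\tilde q_i(1+\beta_{i+1}\alpha_{i+1})=\tilde q_{i+1}(1+\alpha_i\beta_i)$ for $0\le i\le n-2$; $H_{\mathbb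 C}$ acts trivially on the scalars. The map $(x,\tilde q)\mapsto\tilde q_{n-1}^{-1}Y$ is a bijection from the elements of $\tilde{\mathcal S}$ in standard form onto $B$. The geometric quotients $\tilde{\mathcal S}/H_{\mathbb C}$ and $SL(n,\mathbb C)\times_NB$ exist as quasi-affine varieties and are isomorphic, the class of $(g,\tilde q_{n-1}^{-1}Y)$ corresponding to the class of $(g\cdot x,\tilde q)$ for $(x,\tilde q)\in\tilde{\mathcal S}$ in standard form. Division by the leading diagonal entry defines an $n$-fold covering $\rho:B\to B_1$. Forgetting $\tilde q$ maps $\tilde{\mathcal S}$ to $\mathcal S$ and induces a morphism $\tilde{\mathcal S}/H_{\mathbb C}\to\mathcal S/H_{\mathbb C}$ all of whose fibres have exactly $n$ points and which corresponds to $[g,b]\mapsto[g,\rho(b)]$. (3) General dimensions. Let $P\subseteq SL(n,\mathbb C)$ be the parabolic subgroup of block upper triangular matrices with diagonal blocks of sizes $n_r-n_{r-1},\dots,n_2-n_1,n_1$, and let $\mathcal P\subseteq GL(n,\mathbb C)$ be the variety of block upper triangular matrices, for the same blocks, whose diagonal blocks are scalar, with scalars $1,\,q_{r-1},\,q_{r-1}q_{r-2},\dots,q_{r-1}\cdots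 q_1$ for arbitrary nonzero $q_1,\dots,q_{r-1}$. The map sending a quiver to $Y$ is a bijection from the quivers in $\mathcal S$ in standard form onto $\mathcal P$. The geometric quotients $\mathcal S/H_{\mathbb C}$ and $SL(n,\mathbb C)\times_{[P,P]}\mathcal P$ exist as quasi-affine varieties and are isomorphic, the class of $(g,Y)$ corresponding to the class of $g\cdot x$, where $x\in\mathcal S$ is the quiver in standard form with matrix $Y$. -/

import Mathlib

namespace MultQuiver

noncomputable section

open Matrix

/-- Complex `n × n` matrices. -/
abbrev Mat (n : ℕ) : Type := Matrix (Fin n) (Fin n) ℂ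

/-- The group `SL(n, ℂ)`. -/
abbrev SLC (n : ℕ) : Type := Matrix.SpecialLinearGroup (Fin n) ℂ

/-! ## Quasi-affine complex varieties and geometric quotients

Varieties are subsets of a finite-dimensional complex vector space which are locally closed in the
Zariski topology; maps between them are given by total functions on the ambient spaces, of which
only the restriction to the variety matters. -/

section Varieties

variable {V W : Type*} [AddCommGroup V] [Module ℂ V] [AddCommGroup W] [Module ℂ W]

/-- The algebra of polynomial functions on `V`, generated by the linear functionals. -/
def polyFun (V : Type*) [AddCommGroup V] [Module ℂ V] : Subalgebra ℂ (V → ℂ) :=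
  Algebra.adjoin ℂ (Set.range fun φ : Module.Dual ℂ V => (φ : V → ℂ))

/-- Zariski closed: the common zero set of a family of polynomial functions. -/
def IsZariskiClosed (C : Set V) : Prop :=
  ∃ F : Set (V → ℂ), F ⊆ (polyFun V : Set (V → ℂ)) ∧ C = {v | ∀ f ∈ F, f v = 0}

/-- Zariski open: the complement is Zariski closed. -/
def IsZariskiOpen (O : Set V) : Prop := IsZariskiClosed Oᶜ

/-- `U` is a relatively Zariski open subset of `X`. -/
def IsOpenIn (X U : Set V) : Prop := ∃ O : Set V, IsZariskiOpen O ∧ U = X ∩ O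

/-- `X` is a quasi-affine variety: Zariski locally closed in the ambient space. -/
def IsQuasiAffine (X : Set V) : Prop :=
  ∃ O C : Set V, IsZariskiOpen O ∧ IsZariskiClosed C ∧ X = O ∩ C

/-- `f` is a regular function on `U`: near each point of `U` it is a quotient of polynomials. -/
def IsRegularOn (f : V → ℂ) (U : Set V) : Prop :=
  ∀ p ∈ U, ∃ a ∈ polyFun V, ∃ b ∈ polyFun V, b p ≠ 0 ∧ ∀ z ∈ U, b z ≠ 0 → f z = a z / b z

/-- `φ` restricts to a morphism of varieties `X → Z`. -/
def IsMorphism (φ : V → W) (X : Set V) (Z : Set W) : Prop :=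
  Set.MapsTo φ X Z ∧ ∀ l : Module.Dual ℂ W, IsRegularOn (fun v => l (φ v)) X

/-- `π : X → Z` is a geometric quotient of the variety `X` by the group `G`, with quotient
variety `Z`. -/
structure IsGeometricQuotient {G : Type*} [Group G] (act : G → V → V) (X : Set V)
    (Z : Set W) (π : V → W) : Prop where
  source : IsQuasiAffine X
  target : IsQuasiAffine Z
  stable : ∀ g : G, ∀ x ∈ X, act g x ∈ X
  morphism : IsMorphism π X Z
  surj : Set.SurjOn π X Z
  /-- the fibres are exactly the orbits -/
  orbits : ∀ x ∈ X, ∀ y ∈ X, π x = π y ↔ ∃ g : G, act g x = y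
  /-- the quotient carries the quotient topology -/
  submersive : ∀ U ⊆ Z, IsOpenIn X (X ∩ π ⁻¹' U) → IsOpenIn Z U
  /-- the regular functions on the quotient are the invariant regular functions -/
  functions : ∀ U, IsOpenIn Z U → ∀ h : V → ℂ, IsRegularOn h (X ∩ π ⁻¹' U) →
    (∀ g : G, ∀ x ∈ X ∩ π ⁻¹' U, h (act g x) = h x) →
    ∃ f : W → ℂ, IsRegularOn f U ∧ ∀ x ∈ X ∩ π ⁻¹' U, h x = f (π x)

end Varieties

/-! ## Multiplicative quiver equations

The vertices are `0, …, m`, with dimensions `d 0 < … < d m`; there is a pair of arrows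
`α i : ℂ^(d i) → ℂ^(d (i+1))`, `β i : ℂ^(d (i+1)) → ℂ^(d i)` for each `i < m`. -/

section Quivers

variable {m : ℕ} (d : Fin (m + 1) → ℕ)

/-- Pairs `x = (α, β)` of families of linear maps. -/
abbrev QuiverRep : Type :=
  (∀ i : Fin m, Matrix (Fin (d i.succ)) (Fin (d i.castSucc)) ℂ) ×
    (∀ i : Fin m, Matrix (Fin (d i.castSucc)) (Fin (d i.succ)) ℂ)

variable {d}

/-- The endomorphism `α (j-1) * β (j-1)` at the vertex `j`, which is `0` at the first vertex. -/
def incoming (x : QuiverRep d) : ∀ j : Fin (m + 1), Mat (d j) :=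
  Fin.cases 0 fun i => x.1 i * x.2 i

/-- `Y = 1 + αβ` at the last vertex. -/
def lastY (x : QuiverRep d) : Mat (d (Fin.last m)) :=
  1 + incoming x (Fin.last m)

/-- All `1 + αβ` and `1 + βα` are invertible. -/
def IsMult (x : QuiverRep d) : Prop :=
  ∀ i : Fin m, IsUnit (1 + x.1 i * x.2 i) ∧ IsUnit (1 + x.2 i * x.1 i)

/-- The multiplicative quiver equations with scalars `q`. -/
def MultEq (x : QuiverRep d) (q : Fin m → ℂ) : Prop :=
  ∀ i : Fin m, 1 + x.2 i * x.1 i = q i • (1 + incoming x i.castSucc)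

/-- The modified equations with scalars `t` of product one (one scalar for each vertex). -/
def ModMultEq (x : QuiverRep d) (t : Fin (m + 1) → ℂ) : Prop :=
  ∏ j, t j = 1 ∧
    ∀ i : Fin m, t i.castSucc • (1 + x.2 i * x.1 i) = t i.succ • (1 + incoming x i.castSucc)

/-- All `β i` are surjective. -/
def AllSurj (x : QuiverRep d) : Prop :=
  ∀ i : Fin m, Function.Surjective (x.2 i).mulVec

/-- All `β i` are in the standard form `(0 I)`. -/
def IsStandard (x : QuiverRep d) : Prop :=
  ∀ i : Fin m, ∀ (a : Fin (d i.castSucc)) (b : Fin (d i.succ)), x.2 i a b =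
    if (b : ℕ) + d i.castSucc = (a : ℕ) + d i.succ then 1 else 0

variable (d)

/-- Solutions of the multiplicative quiver equations with all `β i` surjective. -/
def surjSol : Set (QuiverRep d) :=
  {x | IsMult x ∧ (∃ q : Fin m → ℂ, MultEq x q) ∧ AllSurj x}

/-- Solutions `(x, t)` of the modified equations with all `β i` surjective. -/
def modSurjSol : Set (QuiverRep d × (Fin (m + 1) → ℂ)) :=
  {s | IsMult s.1 ∧ ModMultEq s.1 s.2 ∧ AllSurj s.1}

variable {d}

/-- The action `α i ↦ g (i+1) * α i * (g i)⁻¹`, `β i ↦ g i * β i * (g (i+1))⁻¹`. -/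
def act (g : ∀ j : Fin (m + 1), SLC (d j)) (x : QuiverRep d) :
    QuiverRep d :=
  (fun i => (g i.succ : Mat (d i.succ)) * x.1 i *
    (((g i.castSucc)⁻¹ : SLC (d i.castSucc)) : Mat (d i.castSucc)),
    fun i => (g i.castSucc : Mat (d i.castSucc)) * x.2 i *
      (((g i.succ)⁻¹ : SLC (d i.succ)) : Mat (d i.succ)))

/-- `H_ℂ`: the product of the groups `SL(d j)` over all vertices except the last one, realised as
the tuples whose last entry is `1`. -/
def hGroup (d : Fin (m + 1) → ℕ) :
    Subgroup (∀ j : Fin (m + 1), SLC (d j)) where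
  carrier := {g | g (Fin.last m) = 1}
  mul_mem' {a b} ha hb := by
    simp only [Set.mem_ofPred_eq] at ha hb ⊢
    simp [ha, hb]
  one_mem' := rfl
  inv_mem' {a} ha := by
    simp only [Set.mem_ofPred_eq] at ha ⊢
    simp [ha]

/-- The action of `H_ℂ` on quivers. -/
def hAct (h : hGroup d) (x : QuiverRep d) : QuiverRep d := act h.1 x

/-- The action of `H_ℂ` on pairs `(x, t)`, trivial on the scalars. -/
def hActMod (h : hGroup d) (s : QuiverRep d × (Fin (m + 1) → ℂ)) :
    QuiverRep d × (Fin (m + 1) → ℂ) := (act h.1 s.1, s.2)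

/-- The residual action of `SL` at the last vertex. -/
def slAct (g : SLC (d (Fin.last m))) (x : QuiverRep d) : QuiverRep d :=
  act (Pi.mulSingle (Fin.last m) g) x

/-! ## Parabolics -/

variable (d)

/-- The index (from `0` at the top to `m` at the bottom) of the diagonal block containing the
row `a`, that is, the number of `i < m` such that `a` is among the last `d i` rows. The blocks have,
from top to bottom, the sizes `d m - d (m-1), …, d 1 - d 0, d 0`. -/
def blockIdx (a : Fin (d (Fin.last m))) : ℕ :=
  (Finset.univ.filter fun i : Fin m => (a.rev : ℕ) < d i.castSucc).card

/-- The parabolic subgroup of block upper triangular matrices in `SL`. -/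
def parabolic : Subgroup (SLC (d (Fin.last m))) where
  carrier := {g | (g : Mat (d (Fin.last m))).BlockTriangular (blockIdx d)}
  mul_mem' {a b} ha hb := by
    simpa using BlockTriangular.mul ha hb
  one_mem' := by
    simpa using blockTriangular_one
  inv_mem' {a} ha := by
    have : Invertible (a : Mat (d (Fin.last m))) := Matrix.invertibleOfIsUnitDet _ (by simp)
    have h := blockTriangular_inv_of_blockTriangular (M := (a : Mat (d (Fin.last m)))) ha
    have e : ((a⁻¹ : SLC (d (Fin.last m))) : Mat (d (Fin.last m))) = (a : Mat (d (Fin.last m)))⁻¹ := by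
      rw [Matrix.inv_def, Matrix.SpecialLinearGroup.coe_inv]; simp
    rw [← e] at h
    exact h

/-- Block upper triangular matrices with scalar diagonal blocks, the scalars being, from top to
bottom, `1, q (m-1), q (m-1) * q (m-2), …, q (m-1) * ⋯ * q 0` for nonzero scalars `q i`. -/
def scalarBlock : Set (Mat (d (Fin.last m))) :=
  {Y | Y.BlockTriangular (blockIdx d) ∧ ∃ q : Fin m → ℂ, (∀ i, q i ≠ 0) ∧
    ∀ a b, blockIdx d a = blockIdx d b →
      Y a b = if a = b then ∏ i ∈ Finset.univ.filter fun i : Fin m => m ≤ (i : ℕ) + blockIdx d a, q i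
        else 0}

/-- The full flag dimension vector `(1, 2, …, m+1)`. -/
abbrev fullFlag (m : ℕ) : Fin (m + 1) → ℕ := fun i => (i : ℕ) + 1

end Quivers

/-! ## Borel subgroups -/

/-- The Borel subgroup `B` of upper triangular matrices in `SL(n, ℂ)`. -/
def borelSL (n : ℕ) : Subgroup (SLC n) where
  carrier := {g | (g : Mat n).BlockTriangular id}
  mul_mem' {a b} ha hb := by
    simpa using BlockTriangular.mul ha hb
  one_mem' := by
    simpa using blockTriangular_one
  inv_mem' {a} ha := by
    have : Invertible (a : Mat n) := Matrix.invertibleOfIsUnitDet _ (by simp)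
    have h := blockTriangular_inv_of_blockTriangular (M := (a : Mat n)) ha
    have e : ((a⁻¹ : SLC n) : Mat n) = (a : Mat n)⁻¹ := by
      rw [Matrix.inv_def, Matrix.SpecialLinearGroup.coe_inv]; simp
    rw [← e] at h
    exact h

theorem upper_mul_diag {n : ℕ} {M M' : Mat n} (h : M.BlockTriangular id)
    (h' : M'.BlockTriangular id) (a : Fin n) : (M * M') a a = M a a * M' a a := by
  rw [Matrix.mul_apply]
  refine Finset.sum_eq_single a (fun b _ hb => ?_) (by simp)
  rcases lt_or_gt_of_ne hb with hlt | hgt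
  · rw [h (by simpa using hlt), zero_mul]
  · rw [h' (by simpa using hgt), mul_zero]

/-- The maximal unipotent subgroup `N` of upper triangular matrices with unit diagonal. -/
def unip (n : ℕ) : Subgroup (SLC n) where
  carrier := {g | g ∈ borelSL n ∧ ∀ a, (g : Mat n) a a = 1}
  mul_mem' {a b} ha hb := by
    refine ⟨mul_mem ha.1 hb.1, fun i => ?_⟩
    rw [Matrix.SpecialLinearGroup.coe_mul, upper_mul_diag ha.1 hb.1 i, ha.2 i, hb.2 i, one_mul]
  one_mem' := ⟨one_mem _, fun a => by simp⟩
  inv_mem' {a} ha := by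
    have hi := inv_mem ha.1
    refine ⟨hi, fun i => ?_⟩
    have := upper_mul_diag ha.1 hi i
    rw [ha.2 i, one_mul, ← Matrix.SpecialLinearGroup.coe_mul, mul_inv_cancel] at this
    rw [← this]
    simp

/-- The group `B_1` of invertible upper triangular matrices of size `n + 1` with leading diagonal
entry `1`. -/
def borelOne (n : ℕ) : Subgroup (GL (Fin (n + 1)) ℂ) where
  carrier := {g | (g : Mat (n + 1)).BlockTriangular id ∧ (g : Mat (n + 1)) 0 0 = 1}
  mul_mem' {a b} ha hb := by
    refine ⟨by simpa using BlockTriangular.mul ha.1 hb.1, ?_⟩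
    have := upper_mul_diag ha.1 hb.1 0
    simpa [ha.2, hb.2] using this
  one_mem' := ⟨by simpa using blockTriangular_one, by simp⟩
  inv_mem' {a} ha := by
    have : Invertible (a : Mat (n + 1)) := a.invertible
    have h := blockTriangular_inv_of_blockTriangular (M := (a : Mat (n + 1))) ha.1
    rw [← Matrix.coe_units_inv] at h
    refine ⟨h, ?_⟩
    have := upper_mul_diag ha.1 h 0
    rw [ha.2, one_mul] at this
    rw [← this]
    simp

theorem borelSL_diag_ne_zero {n : ℕ} (b : borelSL n) (a : Fin n) :
    (b.1 : Mat n) a a ≠ 0 := by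
  have h : (b.1 : Mat n).det = 1 := b.1.det_coe
  have hb : (b.1 : Mat n).BlockTriangular id := b.2
  rw [Matrix.det_of_isUpperTriangular hb] at h
  intro h0
  have h1 : ∏ i, (b.1 : Mat n) i i = 0 := Finset.prod_eq_zero (Finset.mem_univ a) h0
  exact zero_ne_one (h1.symm.trans h)

/-- The map `ρ : B → B_1` dividing a matrix by its leading diagonal entry. -/
def rho (n : ℕ) (b : borelSL (n + 1)) : borelOne n :=
  ⟨GeneralLinearGroup.mkOfDetNeZero (((b.1 : Mat (n + 1)) 0 0)⁻¹ • (b.1 : Mat (n + 1)))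
      (by
        rw [Matrix.det_smul, b.1.det_coe, mul_one]
        exact pow_ne_zero _ (inv_ne_zero (borelSL_diag_ne_zero b 0))),
    by
      have hb : (b.1 : Mat (n + 1)).BlockTriangular id := b.2
      refine ⟨fun i j hij => ?_, ?_⟩
      · change ((b.1 : Mat (n + 1)) 0 0)⁻¹ * (b.1 : Mat (n + 1)) i j = 0
        rw [hb hij, mul_zero]
      · change ((b.1 : Mat (n + 1)) 0 0)⁻¹ * (b.1 : Mat (n + 1)) 0 0 = 1
        exact inv_mul_cancel₀ (borelSL_diag_ne_zero b 0)⟩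

/-- The matrices belonging to `B`. -/
def borelSet (n : ℕ) : Set (Mat n) :=
  Set.range fun b : borelSL n => (b.1 : Mat n)

/-- The matrices belonging to `B_1`. -/
def borelOneSet (n : ℕ) : Set (Mat (n + 1)) :=
  Set.range fun b : borelOne n => (b.1 : Mat (n + 1))

/-- `SL(n, ℂ) × F` as a set of pairs of matrices. -/
def slProd {n : ℕ} (F : Set (Mat n)) :
    Set (Mat n × Mat n) :=
  {z | z.1.det = 1 ∧ z.2 ∈ F}

/-- The action `(u, v) ↦ (u p⁻¹, p v p⁻¹)` of a subgroup `S` of `SL(n, ℂ)`. The quotient of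
`SL(n, ℂ) × F` by this action is `SL(n, ℂ) ×_S F`. -/
def twist {n : ℕ} (S : Subgroup (SLC n)) (p : S)
    (z : Mat n × Mat n) :
    Mat n × Mat n :=
  (z.1 * ((p.1⁻¹ : SLC n) : Mat n),
    (p.1 : Mat n) * z.2 * ((p.1⁻¹ : SLC n) : Mat n))

end

end MultQuiver

open MultQuiver

/-! A quiver with surjective `β` can be moved into standard form by `∏ SL(d j)`, one vertex at a
time (`exists_stdMat_mul_eq`, `exists_isStandard_act`). After division by `H_ℂ` only the last
component of the group element matters, so every class is represented by some `g` in `SL(n)` and a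
standard quiver. For standard `β` the lower right corner of `1 + αβ` is `1 + βα`. The quiver
equations therefore descend through the corners of `Y` (`corner_lastY`) and say exactly that `Y` is
block triangular with scalar diagonal blocks, while `α` is recovered from the corners divided by
those scalars (`bijOn_lastY`).

The ambiguity in `g` is the group of block triangular `p` whose lower right corners all have
determinant one: the corners of such a `p` form an element of `∏ SL(d j)` preserving standard form.
Elimination with transvections that are themselves commutators identifies this group with `[P, P]`
(`commutator_parabolic`); for the full flag it is `N`.

The quotients are built from explicit invariants: `Y`, and the maximal minors of the composite maps
from the last vertex to each vertex `j`, viewed as alternating forms. On a pair `(g, v)` they become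
`g v g⁻¹` and the minors of the last `d j` rows of `g⁻¹` (`twistInv`, `quiverInv_slAct`). Where the
leading minors relative to a frame do not vanish, Cramer's rule expresses a block lower triangular
representative rationally in the minors (`exists_normalMat_eq`). This normal form shows that fibres
are orbits (`exists_of_twistInv_eq`) and yields regular local sections (`isLocalSection_chart`).
Local sections make the image quasi-affine and the map a geometric quotient (`isQuasiAffine_image`,
`isGeometricQuotient_of_sections`). The map from pairs to quivers transports them, so both quotients
are the same set (`isGeometricQuotient_transfer`).

For the modified equations the extra scalars are the inverse diagonal entries of `t⁻¹ Y`, with `t`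
the last scalar, and product one means determinant one; hence `B` replaces `B_1`. Conjugation by `N`
preserves diagonal entries, so division by the leading entry descends to the quotients. Its fibres,
like those of `ρ`, correspond to the solutions `c` of `cⁿ det y = 1`, and `ρ` is a covering as an
open surjective homomorphism with finite kernel. -/

namespace MultQuiver

noncomputable section

open Matrix

/-! ## Regular functions -/

section Regular

variable {V W : Type*} [AddCommGroup V] [Module ℂ V] [AddCommGroup W] [Module ℂ W]

theorem dual_mem_polyFun (l : Module.Dual ℂ V) : (fun v => l v) ∈ polyFun V :=
  Algebra.subset_adjoin ⟨l, rfl⟩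

theorem const_mem_polyFun (c : ℂ) : (fun _ : V => c) ∈ polyFun V :=
  (polyFun V).algebraMap_mem c

theorem polyFun_mul {a b : V → ℂ} (ha : a ∈ polyFun V) (hb : b ∈ polyFun V) :
    (fun v => a v * b v) ∈ polyFun V := mul_mem ha hb

theorem polyFun_add {a b : V → ℂ} (ha : a ∈ polyFun V) (hb : b ∈ polyFun V) :
    (fun v => a v + b v) ∈ polyFun V := add_mem ha hb

theorem polyFun_prod {ι : Type*} (s : Finset ι) {a : ι → V → ℂ} (ha : ∀ i ∈ s, a i ∈ polyFun V) :
    (fun v => ∏ i ∈ s, a i v) ∈ polyFun V := by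
  have := prod_mem ha
  convert this using 1
  ext v; simp

theorem polyFun_induction {p : (V → ℂ) → Prop} (hconst : ∀ c : ℂ, p fun _ => c)
    (hdual : ∀ l : Module.Dual ℂ V, p fun v => l v)
    (hadd : ∀ f g, p f → p g → p fun v => f v + g v)
    (hmul : ∀ f g, p f → p g → p fun v => f v * g v) {f : V → ℂ} (hf : f ∈ polyFun V) : p f := by
  induction hf using Algebra.adjoin_induction with
  | mem x hx => obtain ⟨l, rfl⟩ := hx; exact hdual l
  | algebraMap r => exact hconst r
  | add x y _ _ hx hy => exact hadd x y hx hy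
  | mul x y _ _ hx hy => exact hmul x y hx hy

namespace IsRegularOn

variable {f g : V → ℂ} {U : Set V}

theorem of_poly (hf : f ∈ polyFun V) (U : Set V) : IsRegularOn f U := fun _ _ =>
  ⟨f, hf, _, const_mem_polyFun 1, one_ne_zero, fun z _ _ => (div_one (f z)).symm⟩

theorem const (c : ℂ) (U : Set V) : IsRegularOn (fun _ => c) U := of_poly (const_mem_polyFun c) U

theorem dual (l : Module.Dual ℂ V) (U : Set V) : IsRegularOn (fun v => l v) U :=
  of_poly (dual_mem_polyFun l) U

theorem mono {U' : Set V} (hf : IsRegularOn f U) (h : U' ⊆ U) : IsRegularOn f U' := fun p hp =>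
  let ⟨a, ha, b, hb, hbp, hab⟩ := hf p (h hp)
  ⟨a, ha, b, hb, hbp, fun z hz => hab z (h hz)⟩

theorem congr (hf : IsRegularOn f U) (h : ∀ z ∈ U, g z = f z) : IsRegularOn g U := fun p hp =>
  let ⟨a, ha, b, hb, hbp, hab⟩ := hf p hp
  ⟨a, ha, b, hb, hbp, fun z hz hbz => (h z hz).trans (hab z hz hbz)⟩

theorem mul (hf : IsRegularOn f U) (hg : IsRegularOn g U) :
    IsRegularOn (fun v => f v * g v) U := fun p hp => by
  obtain ⟨a, ha, b, hb, hbp, hab⟩ := hf p hp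
  obtain ⟨a', ha', b', hb', hbp', hab'⟩ := hg p hp
  refine ⟨_, polyFun_mul ha ha', _, polyFun_mul hb hb', mul_ne_zero hbp hbp', fun z hz h => ?_⟩
  simp only [hab z hz (left_ne_zero_of_mul h), hab' z hz (right_ne_zero_of_mul h),
    div_mul_div_comm]

theorem add (hf : IsRegularOn f U) (hg : IsRegularOn g U) :
    IsRegularOn (fun v => f v + g v) U := fun p hp => by
  obtain ⟨a, ha, b, hb, hbp, hab⟩ := hf p hp
  obtain ⟨a', ha', b', hb', hbp', hab'⟩ := hg p hp
  refine ⟨_, polyFun_add (polyFun_mul ha hb') (polyFun_mul hb ha'), _, polyFun_mul hb hb',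
    mul_ne_zero hbp hbp', fun z hz h => ?_⟩
  have h1 := left_ne_zero_of_mul h
  have h2 := right_ne_zero_of_mul h
  simp only [hab z hz h1, hab' z hz h2, div_add_div _ _ h1 h2]

theorem neg (hf : IsRegularOn f U) : IsRegularOn (fun v => -f v) U :=
  ((const (-1) U).mul hf).congr fun z _ => by simp

theorem sub (hf : IsRegularOn f U) (hg : IsRegularOn g U) :
    IsRegularOn (fun v => f v - g v) U :=
  (hf.add hg.neg).congr fun _ _ => sub_eq_add_neg _ _

theorem inv (hf : IsRegularOn f U) (h0 : ∀ z ∈ U, f z ≠ 0) :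
    IsRegularOn (fun v => (f v)⁻¹) U := fun p hp => by
  obtain ⟨a, ha, b, hb, hbp, hab⟩ := hf p hp
  have hap : a p ≠ 0 := fun h => h0 p hp (by rw [hab p hp hbp, h, zero_div])
  -- The expected fraction `b / a` is expanded by `b`, because `f = a / b` is only known where `b ≠
  -- 0`.
  refine ⟨_, polyFun_mul hb hb, _, polyFun_mul ha hb, mul_ne_zero hap hbp, fun z hz h => ?_⟩
  have h2 := right_ne_zero_of_mul h
  simp only [hab z hz h2, inv_div, mul_div_mul_right _ _ h2]

theorem div (hf : IsRegularOn f U) (hg : IsRegularOn g U) (h0 : ∀ z ∈ U, g z ≠ 0) :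
    IsRegularOn (fun v => f v / g v) U :=
  (hf.mul (hg.inv h0)).congr fun _ _ => div_eq_mul_inv _ _

theorem sum {ι : Type*} (s : Finset ι) {F : ι → V → ℂ} (h : ∀ i ∈ s, IsRegularOn (F i) U) :
    IsRegularOn (fun v => ∑ i ∈ s, F i v) U := by
  classical
  induction s using Finset.induction_on with
  | empty => simpa using const 0 U
  | insert a s ha ih =>
    exact ((h a (by simp)).add (ih fun i hi => h i (by simp [hi]))).congr fun z _ => by
      rw [Finset.sum_insert ha]

theorem prod {ι : Type*} (s : Finset ι) {F : ι → V → ℂ} (h : ∀ i ∈ s, IsRegularOn (F i) U) :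
    IsRegularOn (fun v => ∏ i ∈ s, F i v) U := by
  classical
  induction s using Finset.induction_on with
  | empty => simpa using const 1 U
  | insert a s ha ih =>
    exact ((h a (by simp)).mul (ih fun i hi => h i (by simp [hi]))).congr fun z _ => by
      rw [Finset.prod_insert ha]

theorem det {N : Type*} [Fintype N] [DecidableEq N] {M : V → Matrix N N ℂ}
    (h : ∀ i j, IsRegularOn (fun v => M v i j) U) : IsRegularOn (fun v => (M v).det) U :=
  (sum (F := fun (σ : Equiv.Perm N) v => ((Equiv.Perm.sign σ : ℤ) : ℂ) * ∏ i, M v (σ i) i)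
    Finset.univ fun _ _ => (const _ U).mul (prod _ fun _ _ => h _ _)).congr
      fun _ _ => Matrix.det_apply' _

/-- Regularity is a local property. -/
theorem of_local (h : ∀ p ∈ U, ∃ c ∈ polyFun V, c p ≠ 0 ∧ IsRegularOn f (U ∩ {z | c z ≠ 0})) :
    IsRegularOn f U := fun p hp => by
  obtain ⟨c, hc, hcp, hf⟩ := h p hp
  obtain ⟨a, ha, b, hb, hbp, hab⟩ := hf p ⟨hp, hcp⟩
  refine ⟨_, polyFun_mul ha hc, _, polyFun_mul hb hc, mul_ne_zero hbp hcp, fun z hz hz0 => ?_⟩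
  have h2 := right_ne_zero_of_mul hz0
  rw [hab z ⟨hz, h2⟩ (left_ne_zero_of_mul hz0), mul_div_mul_right _ _ h2]

end IsRegularOn

/-- `φ` is given by regular functions on `U`. -/
def IsRegularMap (φ : V → W) (U : Set V) : Prop :=
  ∀ l : Module.Dual ℂ W, IsRegularOn (fun v => l (φ v)) U

namespace IsRegularMap

variable {φ : V → W} {U : Set V}

theorem mono {U' : Set V} (hφ : IsRegularMap φ U) (h : U' ⊆ U) : IsRegularMap φ U' :=
  fun l => (hφ l).mono h

theorem congr {ψ : V → W} (hφ : IsRegularMap φ U) (h : ∀ z ∈ U, ψ z = φ z) : IsRegularMap ψ U :=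
  fun l => (hφ l).congr fun z hz => by rw [h z hz]

theorem poly_comp (hφ : IsRegularMap φ U) {f : W → ℂ} (hf : f ∈ polyFun W) :
    IsRegularOn (fun v => f (φ v)) U :=
  polyFun_induction (p := fun f => IsRegularOn (fun v => f (φ v)) U)
    (fun c => .const c U) hφ (fun _ _ h h' => h.add h') (fun _ _ h h' => h.mul h') hf

theorem regular_comp (hφ : IsRegularMap φ U) {f : W → ℂ} {U' : Set W} (hf : IsRegularOn f U')
    (hU : Set.MapsTo φ U U') : IsRegularOn (fun v => f (φ v)) U := fun p hp => by
  obtain ⟨a, ha, b, hb, hbp, hab⟩ := hf (φ p) (hU hp)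
  obtain ⟨a1, ha1, b1, hb1, hbp1, hab1⟩ := hφ.poly_comp ha p hp
  obtain ⟨a2, ha2, b2, hb2, hbp2, hab2⟩ := hφ.poly_comp hb p hp
  beta_reduce at hab1 hab2 ⊢
  have hap2 : a2 p ≠ 0 := fun h => hbp (by rw [hab2 p hp hbp2, h, zero_div])
  -- With `a ∘ φ = a1 / b1` and `b ∘ φ = a2 / b2` the quotient is `a1 b2 / (b1 a2)`. The additional
  -- factor `b2` confines the identity to the set where the second fraction is valid.
  refine ⟨_, polyFun_mul ha1 (polyFun_mul hb2 hb2), _, polyFun_mul hb1 (polyFun_mul ha2 hb2),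
    mul_ne_zero hbp1 (mul_ne_zero hap2 hbp2), fun z hz h => ?_⟩
  have h1 := left_ne_zero_of_mul h
  have h2 := left_ne_zero_of_mul (right_ne_zero_of_mul h)
  have h3 := right_ne_zero_of_mul (right_ne_zero_of_mul h)
  have hb0 : b (φ z) ≠ 0 := by rw [hab2 z hz h3]; exact div_ne_zero h2 h3
  rw [hab _ (hU hz) hb0, hab1 z hz h1, hab2 z hz h3]
  field_simp

theorem comp {W' : Type*} [AddCommGroup W'] [Module ℂ W'] {ψ : W → W'} {U' : Set W}
    (hψ : IsRegularMap ψ U') (hφ : IsRegularMap φ U) (hU : Set.MapsTo φ U U') :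
    IsRegularMap (fun v => ψ (φ v)) U := fun l => hφ.regular_comp (hψ l) hU

theorem linear (T : V →ₗ[ℂ] W) (U : Set V) : IsRegularMap (fun v => T v) U :=
  fun l => .dual (l ∘ₗ T) U

theorem linear_comp {W' : Type*} [AddCommGroup W'] [Module ℂ W'] (hφ : IsRegularMap φ U)
    (T : W →ₗ[ℂ] W') : IsRegularMap (fun v => T (φ v)) U := fun l => hφ (l ∘ₗ T)

theorem prodMk {W' : Type*} [AddCommGroup W'] [Module ℂ W'] {ψ : V → W'}
    (hφ : IsRegularMap φ U) (hψ : IsRegularMap ψ U) : IsRegularMap (fun v => (φ v, ψ v)) U :=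
  fun l => ((hφ (l ∘ₗ LinearMap.inl ℂ W W')).add (hψ (l ∘ₗ LinearMap.inr ℂ W W'))).congr
    fun z _ => by simp [← map_add]

theorem pi {ι : Type*} [Finite ι] {E : ι → Type*} [∀ i, AddCommGroup (E i)]
    [∀ i, Module ℂ (E i)] {ψ : V → ∀ i, E i} (h : ∀ i, IsRegularMap (fun v => ψ v i) U) :
    IsRegularMap ψ U := by
  classical
  have := Fintype.ofFinite ι
  refine fun l => (IsRegularOn.sum Finset.univ fun i _ =>
    h i (l ∘ₗ LinearMap.single ℂ E i)).congr fun z _ => ?_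
  simp only [LinearMap.comp_apply, LinearMap.coe_single]
  rw [← map_sum, Finset.univ_sum_single]

theorem apply_pi {ι : Type*} {E : ι → Type*} [∀ i, AddCommGroup (E i)]
    [∀ i, Module ℂ (E i)] {ψ : V → ∀ i, E i} (h : IsRegularMap ψ U) (i : ι) :
    IsRegularMap (fun v => ψ v i) U := h.linear_comp (LinearMap.proj i)

theorem of_regularOn {f : V → ℂ} (h : IsRegularOn f U) : IsRegularMap f U := fun l =>
  ((IsRegularOn.const (l 1) U).mul h).congr fun z _ => by
    have := l.map_smul (f z) 1
    rw [smul_eq_mul, mul_one, smul_eq_mul, mul_comm] at this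
    exact this

theorem regularOn {f : V → ℂ} (h : IsRegularMap f U) : IsRegularOn f U := h LinearMap.id

theorem fst {W' : Type*} [AddCommGroup W'] [Module ℂ W'] {ψ : V → W × W'}
    (h : IsRegularMap ψ U) : IsRegularMap (fun v => (ψ v).1) U := h.linear_comp
      (LinearMap.fst ℂ W W')

theorem snd {W' : Type*} [AddCommGroup W'] [Module ℂ W'] {ψ : V → W × W'}
    (h : IsRegularMap ψ U) : IsRegularMap (fun v => (ψ v).2) U := h.linear_comp
      (LinearMap.snd ℂ W W')

theorem id (U : Set V) : IsRegularMap (fun v => v) U := linear LinearMap.id U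

theorem const (w : W) (U : Set V) : IsRegularMap (fun _ => w) U := fun l => .const (l w) U

section Matrices

variable {I J K : Type*}

theorem matrix [Finite I] [Finite J] {A : V → Matrix I J ℂ}
    (h : ∀ i j, IsRegularOn (fun v => A v i j) U) :
    IsRegularMap A U := pi (ψ := A) fun i => pi fun j => of_regularOn (h i j)

theorem entry {A : V → Matrix I J ℂ} (h : IsRegularMap A U) (i : I) (j : J) :
    IsRegularOn (fun v => A v i j) U :=
  regularOn (apply_pi (apply_pi (ψ := A) h i) j)

theorem add {ψ : V → W} (hφ : IsRegularMap φ U) (hψ : IsRegularMap ψ U) :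
    IsRegularMap (fun v => φ v + ψ v) U := fun l =>
  ((hφ l).add (hψ l)).congr fun _ _ => map_add l _ _

theorem sub {ψ : V → W} (hφ : IsRegularMap φ U) (hψ : IsRegularMap ψ U) :
    IsRegularMap (fun v => φ v - ψ v) U := fun l =>
  ((hφ l).sub (hψ l)).congr fun _ _ => map_sub l _ _

theorem smul {f : V → ℂ} (hf : IsRegularOn f U) (hφ : IsRegularMap φ U) :
    IsRegularMap (fun v => f v • φ v) U := fun l =>
  (hf.mul (hφ l)).congr fun _ _ => map_smul l _ _

theorem matMul [Finite I] [Finite J] [Fintype K] {A : V → Matrix I K ℂ} {B : V → Matrix K J ℂ}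
    (hA : IsRegularMap A U) (hB : IsRegularMap B U) : IsRegularMap (fun v => A v * B v) U :=
  matrix fun i j => (IsRegularOn.sum Finset.univ fun k _ => (hA.entry i k).mul (hB.entry k j)).congr
    fun _ _ => Matrix.mul_apply

theorem adjugate {N : Type*} [Fintype N] [DecidableEq N] {A : V → Matrix N N ℂ}
    (hA : IsRegularMap A U) : IsRegularMap (fun v => (A v).adjugate) U :=
  matrix fun i j => (IsRegularOn.det (M := fun v => (A v).updateRow j (Pi.single i 1))
    fun a b => by
      by_cases h : a = j
      · subst h; simpa using IsRegularOn.const _ U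
      · simpa [updateRow_ne h] using hA.entry a b).congr fun _ _ => adjugate_apply _ _ _

end Matrices

end IsRegularMap

end Regular

/-! ## Locally closed sets and geometric quotients with local sections -/

section Quotients

variable {V W : Type*} [AddCommGroup V] [Module ℂ V] [AddCommGroup W] [Module ℂ W]

/-- Being locally closed is a local condition: around each point there is a basic open set in which
`Z` coincides with its Zariski closure. In the converse, the open set is the union of these basic
open sets and the closed set is the closure of `Z`. -/
theorem isQuasiAffine_iff {Z : Set V} : IsQuasiAffine Z ↔ ∀ z ∈ Z, ∃ c ∈ polyFun V, c z ≠ 0 ∧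
    ∀ w ∉ Z, c w ≠ 0 → ∃ e ∈ polyFun V, e w ≠ 0 ∧ ∀ z' ∈ Z, e z' = 0 := by
  constructor
  · rintro ⟨O, C, ⟨F, hF, hO⟩, ⟨F', hF', hC⟩, rfl⟩ z ⟨hzO, hzC⟩
    have hz : z ∉ {v | ∀ f ∈ F, f v = 0} := by rw [← hO]; simpa using hzO
    simp only [Set.mem_ofPred_eq, not_forall] at hz
    obtain ⟨c, hcF, hc⟩ := hz
    refine ⟨c, hF hcF, hc, fun w hw hcw => ?_⟩
    have hwO : w ∈ O := by
      by_contra h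
      have : w ∈ {v | ∀ f ∈ F, f v = 0} := by rw [← hO]; exact h
      exact hcw (this c hcF)
    have hwC : w ∉ {v | ∀ f ∈ F', f v = 0} := fun h => hw ⟨hwO, by rw [hC]; exact h⟩
    simp only [Set.mem_ofPred_eq, not_forall] at hwC
    obtain ⟨e, heF, he⟩ := hwC
    refine ⟨e, hF' heF, he, fun z' hz' => ?_⟩
    have h2 := hz'.2
    rw [hC] at h2
    exact h2 e heF
  · intro h
    choose! c hc hcz hs using h
    refine ⟨{v | ∀ f ∈ c '' Z, f v = 0}ᶜ, {v | ∀ f ∈ {e | e ∈ polyFun V ∧ ∀ z' ∈ Z, e z' = 0},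
      f v = 0},
      ⟨c '' Z, ?_, compl_compl _⟩, ⟨_, fun e he => he.1, rfl⟩, ?_⟩
    · rintro _ ⟨z, hz, rfl⟩
      exact hc z hz
    · ext w
      constructor
      · intro hw
        exact ⟨fun h => hcz w hw (h _ ⟨w, hw, rfl⟩), fun e he => he.2 w hw⟩
      · rintro ⟨h1, h2⟩
        by_contra hw
        simp only [Set.mem_compl_iff, Set.mem_ofPred_eq, not_forall] at h1
        obtain ⟨_, ⟨z, hz, rfl⟩, hcw⟩ := h1
        obtain ⟨e, he, hew, he0⟩ := hs z hz w hw hcw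
        exact hew (h2 e ⟨he, he0⟩)

theorem isOpenIn_iff {X U : Set V} : IsOpenIn X U ↔ U ⊆ X ∧ ∀ p ∈ U, ∃ c ∈ polyFun V, c p ≠ 0 ∧
    ∀ z ∈ X, c z ≠ 0 → z ∈ U := by
  constructor
  · rintro ⟨O, ⟨F, hF, hO⟩, rfl⟩
    refine ⟨Set.inter_subset_left, fun p hp => ?_⟩
    have hz : p ∉ {v | ∀ f ∈ F, f v = 0} := by rw [← hO]; simpa using hp.2
    simp only [Set.mem_ofPred_eq, not_forall] at hz
    obtain ⟨c, hcF, hc⟩ := hz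
    refine ⟨c, hF hcF, hc, fun w hw hcw => ⟨hw, ?_⟩⟩
    by_contra h
    have : w ∈ {v | ∀ f ∈ F, f v = 0} := by rw [← hO]; exact h
    exact hcw (this c hcF)
  · rintro ⟨hUX, h⟩
    choose! c hc hcz hs using h
    refine ⟨{v | ∀ f ∈ c '' U, f v = 0}ᶜ, ⟨c '' U, ?_, compl_compl _⟩, ?_⟩
    · rintro _ ⟨z, hz, rfl⟩
      exact hc z hz
    · ext w
      constructor
      · intro hw
        exact ⟨hUX hw, fun h => hcz w hw (h _ ⟨w, hw, rfl⟩)⟩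
      · rintro ⟨h1, h2⟩
        simp only [Set.mem_compl_iff, Set.mem_ofPred_eq, not_forall] at h2
        obtain ⟨_, ⟨z, hz, rfl⟩, hcw⟩ := h2
        exact hs z hz w h1 hcw

/-- The conditions `f v ≠ 0` for some `f ∈ F i`, for finitely many families of polynomials `F i`,
together with polynomial equations, define a quasi-affine variety. -/
theorem isQuasiAffine_of_conditions {ι : Type*} [Fintype ι] {Z : Set V} (F : ι → Set (V → ℂ))
    (E : Set (V → ℂ)) (hF : ∀ i, F i ⊆ polyFun V) (hE : E ⊆ polyFun V)
    (hZ : ∀ v, v ∈ Z ↔ (∀ i, ∃ f ∈ F i, f v ≠ 0) ∧ ∀ e ∈ E, e v = 0) : IsQuasiAffine Z := by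
  rw [isQuasiAffine_iff]
  intro z hz
  choose f hfF hf using ((hZ z).1 hz).1
  refine ⟨_, polyFun_prod Finset.univ fun i _ => hF i (hfF i),
    Finset.prod_ne_zero_iff.2 fun i _ => hf i, fun w hw hfw => ?_⟩
  rw [Finset.prod_ne_zero_iff] at hfw
  by_contra! hcon
  refine hw ((hZ w).2 ⟨fun i => ⟨f i, hfF i, hfw i (Finset.mem_univ i)⟩, fun e he => ?_⟩)
  by_contra h0
  obtain ⟨z', hz', h'⟩ := hcon e (hE he) h0
  exact h' (((hZ z').1 hz').2 e he)

/-- A regular section of `π` over the part of `π '' X` on which the polynomial `c` does not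
vanish. -/
structure IsLocalSection (X : Set V) (π : V → W) (c : W → ℂ) (σ : W → V) : Prop where
  poly : c ∈ polyFun W
  regular : IsRegularMap σ (π '' X ∩ {w | c w ≠ 0})
  mem : ∀ w ∈ π '' X, c w ≠ 0 → σ w ∈ X
  right_inv : ∀ w ∈ π '' X, c w ≠ 0 → π (σ w) = w

/-- Clearing denominators: if `R = a / b` near `w`, then `a * b * c` works. It is zero where the
fraction or `R` itself is not under control, and elsewhere on `Z` the vanishing of `R` gives `a =
0`. -/
theorem IsRegularOn.exists_poly_vanishing {R : W → ℂ} {c : W → ℂ} (hc : c ∈ polyFun W)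
    (hR : IsRegularOn R {w | c w ≠ 0}) {Z : Set W} (hRZ : ∀ z ∈ Z, c z ≠ 0 → R z = 0) {w : W}
    (hcw : c w ≠ 0) (hw : R w ≠ 0) : ∃ e ∈ polyFun W, e w ≠ 0 ∧ ∀ z ∈ Z, e z = 0 := by
  obtain ⟨a, ha, b, hb, hbw, hab⟩ := hR w hcw
  refine ⟨_, polyFun_mul ha (polyFun_mul hb hc), mul_ne_zero (fun h => hw ?_)
    (mul_ne_zero hbw hcw), fun z hz => ?_⟩
  · rw [hab w hcw hbw, h, zero_div]
  · by_cases hcz : c z = 0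
    · simp [hcz]
    by_cases hbz : b z = 0
    · simp [hbz]
    have := hab z hcz hbz
    rw [hRZ z hz hcz, eq_comm, div_eq_zero_iff] at this
    simp [this.resolve_right hbz]

theorem IsRegularOn.exists_poly_ne_zero {R : W → ℂ} {c : W → ℂ} (hc : c ∈ polyFun W)
    {Z : Set W} (hR : IsRegularOn R (Z ∩ {w | c w ≠ 0})) {z : W} (hzZ : z ∈ Z) (hcz : c z ≠ 0)
    (hz : R z ≠ 0) :
    ∃ c' ∈ polyFun W, c' z ≠ 0 ∧ ∀ w ∈ Z, c' w ≠ 0 → c w ≠ 0 ∧ R w ≠ 0 := by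
  obtain ⟨a, ha, b, hb, hbw, hab⟩ := hR z ⟨hzZ, hcz⟩
  refine ⟨_, polyFun_mul ha (polyFun_mul hb hc), mul_ne_zero (fun h => hz ?_)
    (mul_ne_zero hbw hcz), fun w hwZ hw => ?_⟩
  · rw [hab z ⟨hzZ, hcz⟩ hbw, h, zero_div]
  · have h1 := left_ne_zero_of_mul hw
    have h2 := left_ne_zero_of_mul (right_ne_zero_of_mul hw)
    have h3 := right_ne_zero_of_mul (right_ne_zero_of_mul hw)
    exact ⟨h3, by rw [hab w ⟨hwZ, h3⟩ h2]; exact div_ne_zero h1 h2⟩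

/-- On a chart, `w` lies in the image exactly when `σ w ∈ X` and `π (σ w) = w`. These conditions
must be tested at points outside the image too, which is why `σ` is required to be regular on a
whole basic open set of the ambient space. -/
theorem isQuasiAffine_image {X : Set V} {π : V → W} (hX : IsQuasiAffine X)
    (hπ : IsRegularMap π X)
    (hσ : ∀ z ∈ π '' X, ∃ c σ, c z ≠ 0 ∧ IsLocalSection X π c σ ∧
      IsRegularMap σ {w | c w ≠ 0}) : IsQuasiAffine (π '' X) := by
  rw [isQuasiAffine_iff] at hX ⊢
  intro z hz
  obtain ⟨c, σ, hcz, h, hreg⟩ := hσ z hz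
  obtain ⟨cX, hcX, hcXz, hs⟩ := hX (σ z) (h.mem z hz hcz)
  obtain ⟨c', hc', hc'z, hc'0⟩ :=
    IsRegularOn.exists_poly_ne_zero h.poly (Z := Set.univ)
      ((hreg.poly_comp hcX).mono Set.inter_subset_right) trivial hcz hcXz
  refine ⟨c', hc', hc'z, fun w hw hc'w => ?_⟩
  obtain ⟨hcw, hcXw⟩ := hc'0 w trivial hc'w
  by_cases hwX : σ w ∈ X
  · have hne : π (σ w) - w ≠ 0 := fun h0 => hw ⟨σ w, hwX, sub_eq_zero.1 h0⟩
    -- Some coordinate separates `π (σ w)` from `w`. Writing `l ∘ π = a / b` near `σ w`, the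
    -- function `(a ∘ σ - l * (b ∘ σ)) * (b ∘ σ)` vanishes on the image but not at `w`.
    obtain ⟨l, hl⟩ : ∃ l : Module.Dual ℂ W, l (π (σ w) - w) ≠ 0 := by
      by_contra! h0
      exact hne ((Module.forall_dual_apply_eq_zero_iff ℂ _).1 h0)
    rw [map_sub] at hl
    obtain ⟨a, ha, b, hb, hbp, hab⟩ := hπ l (σ w) hwX
    beta_reduce at hab
    refine (((hreg.poly_comp ha).sub ((IsRegularOn.dual l _).mul
      (hreg.poly_comp hb))).mul (hreg.poly_comp hb)).exists_poly_vanishing h.poly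
      (Z := π '' X) (fun z' hz' hcz' => ?_) hcw (mul_ne_zero (fun h0 => hl ?_) hbp)
    · by_cases hb0 : b (σ z') = 0
      · simp [hb0]
      have := hab (σ z') (h.mem z' hz' hcz') hb0
      rw [h.right_inv z' hz' hcz'] at this
      rw [this, div_mul_cancel₀ _ hb0, sub_self, zero_mul]
    · rw [hab (σ w) hwX hbp, sub_eq_zero, div_eq_iff hbp]
      exact sub_eq_zero.1 h0
  · obtain ⟨e, he, hew, he0⟩ := hs _ hwX hcXw
    exact (hreg.poly_comp he).exists_poly_vanishing h.poly
      (fun z' hz' hcz' => he0 _ (h.mem z' hz' hcz')) hcw hew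

/-- An invariant map whose fibres are orbits and which has local regular sections is a geometric
quotient onto its image. -/
theorem isGeometricQuotient_of_sections {G : Type*} [Group G] {act : G → V → V} {X : Set V}
    {π : V → W} (hX : IsQuasiAffine X) (hstable : ∀ g : G, ∀ x ∈ X, act g x ∈ X)
    (hπ : IsRegularMap π X) (horb : ∀ x ∈ X, ∀ y ∈ X, π x = π y ↔ ∃ g : G, act g x = y)
    (hZ : IsQuasiAffine (π '' X)) (hσ : ∀ z ∈ π '' X, ∃ c σ, c z ≠ 0 ∧ IsLocalSection X π c σ) :
    IsGeometricQuotient act X (π '' X) π where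
  source := hX
  target := hZ
  stable := hstable
  morphism := ⟨Set.mapsTo_image π X, hπ⟩
  surj := Set.surjOn_image π X
  orbits := horb
  submersive U hU hopen := by
    rw [isOpenIn_iff] at hopen ⊢
    refine ⟨hU, fun z hz => ?_⟩
    obtain ⟨c, σ, hcz, h⟩ := hσ z (hU hz)
    have hπz := h.right_inv z (hU hz) hcz
    obtain ⟨c1, hc1, hc1z, hs⟩ := hopen.2 (σ z) ⟨h.mem z (hU hz) hcz, by
      rw [Set.mem_preimage, hπz]; exact hz⟩
    obtain ⟨c', hc', hc'z, hc'0⟩ :=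
      IsRegularOn.exists_poly_ne_zero h.poly (h.regular.poly_comp hc1) (hU hz) hcz hc1z
    refine ⟨c', hc', hc'z, fun w hw hc'w => ?_⟩
    obtain ⟨hcw, hc1w⟩ := hc'0 w hw hc'w
    have := (hs (σ w) (h.mem w hw hcw) hc1w).2
    rwa [Set.mem_preimage, h.right_inv w hw hcw] at this
  functions U hU f hf hinv := by
    obtain ⟨hUZ, -⟩ := isOpenIn_iff.1 hU
    have hpre : ∀ w ∈ U, ∃ x ∈ X, π x = w := fun w hw => hUZ hw
    -- Any set-theoretic choice of preimages will do: by invariance `f ∘ s` agrees on each chart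
    -- with `f ∘ σ`, which is regular.
    choose! s hsX hsπ using hpre
    have key : ∀ x ∈ X ∩ π ⁻¹' U, f x = f (s (π x)) := by
      rintro x ⟨hx, hxU⟩
      obtain ⟨g, hg⟩ := (horb x hx (s (π x)) (hsX _ hxU)).1 (hsπ _ hxU).symm
      rw [← hg, hinv g x ⟨hx, hxU⟩]
    refine ⟨fun w => f (s w), IsRegularOn.of_local fun z hz => ?_, key⟩
    obtain ⟨c, σ, hcz, h⟩ := hσ z (hUZ hz)
    refine ⟨c, h.poly, hcz, ?_⟩
    have hmaps : Set.MapsTo σ (U ∩ {w | c w ≠ 0}) (X ∩ π ⁻¹' U) := fun w hw =>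
      ⟨h.mem w (hUZ hw.1) hw.2, by
        rw [Set.mem_preimage, h.right_inv w (hUZ hw.1) hw.2]; exact hw.1⟩
    refine ((h.regular.mono (Set.inter_subset_inter_left _ hUZ)).regular_comp hf hmaps).congr fun w
      hw => ?_
    rw [key _ (hmaps hw), h.right_inv w (hUZ hw.1) hw.2]

theorem polyFun_comp_linear {f : W → ℂ} (hf : f ∈ polyFun W) (L : V →ₗ[ℂ] W) :
    (fun v => f (L v)) ∈ polyFun V :=
  polyFun_induction (p := fun f => (fun v => f (L v)) ∈ polyFun V)
    const_mem_polyFun (fun l => dual_mem_polyFun (l ∘ₗ L))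
    (fun _ _ h h' => polyFun_add h h') (fun _ _ h h' => polyFun_mul h h') hf

/-- Needed because the invariants live in a space of matrices and alternating forms, whereas the
quotients are to be subsets of a coordinate space `Fin k → ℂ`. -/
theorem IsLocalSection.linearEquiv_comp {W' : Type*} [AddCommGroup W'] [Module ℂ W'] {X : Set V}
    {π : V → W} {c : W → ℂ} {σ : W → V} (h : IsLocalSection X π c σ) (e : W ≃ₗ[ℂ] W') :
    IsLocalSection X (fun v => e (π v)) (fun w => c (e.symm w)) (fun w => σ (e.symm w)) where
  poly := polyFun_comp_linear h.poly e.symm.toLinearMap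
  regular := h.regular.comp (IsRegularMap.linear e.symm.toLinearMap _) (by
    rintro _ ⟨⟨x, hx, rfl⟩, hw⟩
    exact ⟨⟨x, hx, by simp⟩, hw⟩)
  mem := by
    rintro _ ⟨x, hx, rfl⟩ hc
    simp only [LinearEquiv.symm_apply_apply] at hc ⊢
    exact h.mem _ ⟨x, hx, rfl⟩ hc
  right_inv := by
    rintro _ ⟨x, hx, rfl⟩ hc
    simp only [LinearEquiv.symm_apply_apply] at hc ⊢
    rw [h.right_inv _ ⟨x, hx, rfl⟩ hc]

/-- A regular map `φ : X → X'` compatible with `π` and `π'` turns local sections of `π` into local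
sections of `π'`. -/
theorem IsLocalSection.comp_map {V' : Type*} [AddCommGroup V'] [Module ℂ V'] {X : Set V}
    {X' : Set V'} {π : V → W} {π' : V' → W} {φ : V → V'} {c : W → ℂ} {σ : W → V}
    (h : IsLocalSection X π c σ) (hφ : IsRegularMap φ X)
    (hmaps : Set.MapsTo φ X X') (hcomp : ∀ x ∈ X, π' (φ x) = π x) (himg : π' '' X' = π '' X) :
    IsLocalSection X' π' c (fun w => φ (σ w)) where
  poly := h.poly
  regular := by
    rw [himg]
    exact hφ.comp h.regular fun w hw => h.mem w hw.1 hw.2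
  mem w hw hc := by
    rw [himg] at hw
    exact hmaps (h.mem w hw hc)
  right_inv w hw hc := by
    rw [himg] at hw
    rw [hcomp _ (h.mem w hw hc), h.right_inv w hw hc]

/-- Invariant morphisms descend to a geometric quotient. -/
theorem IsGeometricQuotient.exists_descent {G : Type*} [Group G] {act : G → V → V} {X : Set V}
    {Z : Set W} {π : V → W} (h : IsGeometricQuotient act X Z π) {k : ℕ} {Z₂ : Set (Fin k → ℂ)}
    {ψ : V → Fin k → ℂ} (hψ : IsMorphism ψ X Z₂)
    (hinv : ∀ g : G, ∀ x ∈ X, ψ (act g x) = ψ x) :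
    ∃ κ : W → Fin k → ℂ, IsMorphism κ Z Z₂ ∧ ∀ x ∈ X, κ (π x) = ψ x := by
  have hX : X ∩ π ⁻¹' Z = X := Set.inter_eq_left.2 h.morphism.1
  have hZ : IsOpenIn Z Z := isOpenIn_iff.2 ⟨subset_rfl, fun p _ =>
    ⟨_, const_mem_polyFun 1, one_ne_zero, fun z hz _ => hz⟩⟩
  have := fun i : Fin k => h.functions Z hZ (fun v => ψ v i)
    (by rw [hX]; exact hψ.2 (LinearMap.proj i))
    (by rw [hX]; exact fun g x hx => by rw [hinv g x hx])
  rw [hX] at this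
  choose f hf hfe using this
  have hκ : ∀ x ∈ X, (fun i => f i (π x)) = ψ x := fun x hx => funext fun i => (hfe i x hx).symm
  refine ⟨fun w i => f i w, ⟨fun z hz => ?_, IsRegularMap.pi fun i => .of_regularOn (hf i)⟩, hκ⟩
  obtain ⟨x, hx, rfl⟩ := h.surj hz
  simp only [hκ x hx]
  exact hψ.1 hx

end Quotients

/-! ## The matrices `(0 I)` and lower right corners -/

section Corners

/-- The matrix `(0 I)` of size `a × b`. -/
def stdMat (a b : ℕ) : Matrix (Fin a) (Fin b) ℂ :=
  of fun i j => if (j : ℕ) + a = (i : ℕ) + b then 1 else 0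

/-- The inclusion of the last `a` indices among `b` indices. -/
def emb {a b : ℕ} (h : a ≤ b) (i : Fin a) : Fin b := ⟨i + (b - a), by omega⟩

theorem emb_rev {a b : ℕ} (h : a ≤ b) (i : Fin a) : ((emb h i).rev : ℕ) = i.rev := by
  simp only [Fin.val_rev, emb]; omega

theorem emb_injective {a b : ℕ} (h : a ≤ b) : Function.Injective (emb h) := fun i j hij => by
  simp only [emb, Fin.mk.injEq] at hij
  exact Fin.ext (by omega)

theorem emb_emb {a b c : ℕ} (h : a ≤ b) (h' : b ≤ c) (i : Fin a) :
    emb h' (emb h i) = emb (h.trans h') i := Fin.ext (by simp only [emb]; omega)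

theorem emb_self {a : ℕ} (h : a ≤ a) (i : Fin a) : emb h i = i := Fin.ext (by simp [emb])

theorem exists_emb_eq {a b : ℕ} (h : a ≤ b) {j : Fin b} (hj : (j.rev : ℕ) < a) :
    ∃ i : Fin a, emb h i = j := by
  simp only [Fin.val_rev] at hj
  exact ⟨⟨j - (b - a), by omega⟩, Fin.ext (by simp only [emb]; omega)⟩

theorem stdMat_apply_emb {a b : ℕ} (h : a ≤ b) (i : Fin a) (j : Fin b) :
    stdMat a b i j = (1 : Mat b) (emb h i) j := by
  simp only [stdMat, of_apply, one_apply, Fin.ext_iff, emb]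
  congr 1
  simp only [eq_iff_iff]
  omega

theorem stdMat_eq_submatrix {a b : ℕ} (h : a ≤ b) :
    stdMat a b = (1 : Mat b).submatrix (emb h) id := by
  ext i j; exact stdMat_apply_emb h i j

theorem stdMat_mul {a b : ℕ} (h : a ≤ b) {γ : Type*} (M : Matrix (Fin b) γ ℂ) :
    stdMat a b * M = M.submatrix (emb h) id := by
  rw [stdMat_eq_submatrix h]
  ext i j
  rw [mul_apply]
  simp [one_apply]

theorem mul_stdMat_transpose {a b : ℕ} (h : a ≤ b) {γ : Type*} (M : Matrix γ (Fin b) ℂ) :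
    M * (stdMat a b)ᵀ = M.submatrix id (emb h) := by
  rw [← transpose_inj, transpose_mul, transpose_transpose, stdMat_mul h]
  rfl

theorem stdMat_self (a : ℕ) : stdMat a a = 1 := by
  ext i j
  rw [stdMat_apply_emb le_rfl, emb_self]

theorem stdMat_mul_stdMat {a b c : ℕ} (h : a ≤ b) (h' : b ≤ c) :
    stdMat a b * stdMat b c = stdMat a c := by
  rw [stdMat_mul h]
  ext i j
  rw [submatrix_apply, stdMat_apply_emb h', emb_emb, stdMat_apply_emb (h.trans h')]
  rfl

theorem stdMat_mul_transpose {a b : ℕ} (h : a ≤ b) : stdMat a b * (stdMat a b)ᵀ = 1 := by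
  rw [mul_stdMat_transpose h, stdMat_eq_submatrix h]
  ext i j
  simp [one_apply, (emb_injective h).eq_iff]

theorem mul_stdMat_apply_emb {a b : ℕ} (h : a ≤ b) {γ : Type*} (M : Matrix γ (Fin a) ℂ) (i : γ)
    (j : Fin a) : (M * stdMat a b) i (emb h j) = M i j := by
  rw [mul_apply]
  simp [stdMat_apply_emb h, one_apply, (emb_injective h).eq_iff]

theorem mul_stdMat_apply_of_le {a b : ℕ} (h : a ≤ b) {γ : Type*} (M : Matrix γ (Fin a) ℂ) (i : γ)
    {j : Fin b} (hj : a ≤ j.rev) : (M * stdMat a b) i j = 0 := by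
  rw [mul_apply]
  refine Finset.sum_eq_zero fun k _ => ?_
  rw [stdMat_apply_emb h, one_apply_ne, mul_zero]
  rintro rfl
  rw [emb_rev] at hj
  exact absurd k.rev.2 (by omega)

theorem stdMat_surjective {a b : ℕ} (h : a ≤ b) : Function.Surjective (stdMat a b).mulVec :=
  fun v => ⟨(stdMat a b)ᵀ *ᵥ v, by rw [mulVec_mulVec, stdMat_mul_transpose h, one_mulVec]⟩

variable {m : ℕ} (d : Fin (m + 1) → ℕ)

/-- The lower right corner of size `d j`. -/
def corner (j : Fin (m + 1)) (M : Mat (d (Fin.last m))) : Mat (d j) :=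
  stdMat (d j) (d (Fin.last m)) * M * (stdMat (d j) (d (Fin.last m)))ᵀ

variable {d}

theorem isStandard_iff {x : QuiverRep d} :
    IsStandard x ↔ ∀ i : Fin m, x.2 i = stdMat (d i.castSucc) (d i.succ) := by
  simp only [IsStandard, ← Matrix.ext_iff, stdMat, of_apply]

theorem le_last (hd : StrictMono d) (j : Fin (m + 1)) : d j ≤ d (Fin.last m) :=
  hd.monotone (Fin.le_last j)

theorem le_succ (hd : StrictMono d) (i : Fin m) : d i.castSucc ≤ d i.succ :=
  (hd i.castSucc_lt_succ).le

theorem corner_apply (hd : StrictMono d) (j : Fin (m + 1)) (M : Mat (d (Fin.last m)))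
    (a b : Fin (d j)) : corner d j M a b = M (emb (le_last hd j) a) (emb (le_last hd j) b) := by
  rw [corner, mul_stdMat_transpose (le_last hd j), stdMat_mul (le_last hd j)]
  rfl

theorem corner_one (hd : StrictMono d) (j : Fin (m + 1)) : corner d j 1 = 1 := by
  rw [corner, Matrix.mul_one, stdMat_mul_transpose (le_last hd j)]

theorem corner_last (M : Mat (d (Fin.last m))) : corner d (Fin.last m) M = M := by
  simp [corner, stdMat_self]

/-- As `d` is increasing, the vertices counted by `blockIdx` form a final segment of `Fin m`, so the
count alone decides which of them contain the row `a`. -/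
theorem rev_lt_iff (hd : StrictMono d) (a : Fin (d (Fin.last m))) (j : Fin (m + 1)) :
    (a.rev : ℕ) < d j ↔ m ≤ (j : ℕ) + blockIdx d a := by
  have hcard : ∀ k : ℕ, (Finset.univ.filter fun i : Fin m => k ≤ (i : ℕ)).card = m - k := by
    intro k
    have h1 := Finset.card_filter_add_card_filter_not (s := (Finset.univ : Finset (Fin m)))
      (fun i : Fin m => (i : ℕ) < k)
    rw [Fin.card_filter_val_lt, Finset.card_univ, Fintype.card_fin] at h1
    simp only [not_lt] at h1
    omega
  constructor
  · intro h
    have : (Finset.univ.filter fun i : Fin m => (j : ℕ) ≤ (i : ℕ)).card ≤ blockIdx d a :=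
      Finset.card_le_card fun i hi => by
        simp only [Finset.mem_filter, Finset.mem_univ, true_and] at hi ⊢
        exact h.trans_le (hd.monotone (by rw [Fin.le_def]; exact hi))
    rw [hcard] at this
    omega
  · intro h
    by_contra hlt
    have hjm : (j : ℕ) < m := by
      by_contra hj
      have : j = Fin.last m := Fin.ext (by have := j.2; simp; omega)
      subst this
      exact hlt a.rev.2
    have : blockIdx d a ≤ (Finset.univ.filter fun i : Fin m => (j : ℕ) + 1 ≤ (i : ℕ)).card :=
      Finset.card_le_card fun i hi => by
        simp only [Finset.mem_filter, Finset.mem_univ, true_and] at hi ⊢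
        by_contra hij
        exact hlt (hi.trans_le (hd.monotone (by rw [Fin.le_def]; simp; omega)))
    rw [hcard] at this
    omega

theorem blockIdx_le (a : Fin (d (Fin.last m))) : blockIdx d a ≤ m :=
  (Finset.card_filter_le _ _).trans (by simp)

/-- A block upper triangular matrix preserves the kernel of the projection to the last `d j`
coordinates, and its corner is the map induced on the quotient. Multiplicativity of corners and the
invariance of the forms both rest on this. -/
theorem stdMat_mul_of_blockTriangular (hd : StrictMono d) {p : Mat (d (Fin.last m))}
    (hp : p.BlockTriangular (blockIdx d)) (j : Fin (m + 1)) :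
    stdMat (d j) (d (Fin.last m)) * p = corner d j p * stdMat (d j) (d (Fin.last m)) := by
  have h := le_last hd j
  ext a b
  by_cases hb : (b.rev : ℕ) < d j
  · obtain ⟨b, rfl⟩ := exists_emb_eq h hb
    rw [mul_stdMat_apply_emb h, corner_apply hd, stdMat_mul h]
    rfl
  · rw [mul_stdMat_apply_of_le h _ _ (not_lt.1 hb), stdMat_mul h]
    refine hp ?_
    have h1 := (rev_lt_iff hd (emb h a) j).1 (by rw [emb_rev]; exact a.rev.2)
    rw [rev_lt_iff hd] at hb
    simp only [id]
    omega

/-- Only the left factor has to be block triangular; the normal form uses this with an arbitrary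
right factor. -/
theorem corner_mul (hd : StrictMono d) {p : Mat (d (Fin.last m))}
    (hp : p.BlockTriangular (blockIdx d)) (M : Mat (d (Fin.last m))) (j : Fin (m + 1)) :
    corner d j (p * M) = corner d j p * corner d j M := by
  rw [corner, ← Matrix.mul_assoc, stdMat_mul_of_blockTriangular hd hp]
  simp only [corner, Matrix.mul_assoc]

theorem corner_stdMat (hd : StrictMono d) {p : Mat (d (Fin.last m))}
    (hp : p.BlockTriangular (blockIdx d)) (i : Fin m) :
    stdMat (d i.castSucc) (d i.succ) * corner d i.succ p =
      corner d i.castSucc p * stdMat (d i.castSucc) (d i.succ) := by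
  have h1 := stdMat_mul_stdMat (le_succ hd i) (le_last hd i.succ)
  have h3 := stdMat_mul_transpose (le_last hd i.succ)
  calc stdMat (d i.castSucc) (d i.succ) * corner d i.succ p
      = stdMat (d i.castSucc) (d (Fin.last m)) * p *
          (stdMat (d i.succ) (d (Fin.last m)))ᵀ := by
        rw [corner, ← h1]; simp only [Matrix.mul_assoc]
    _ = _ := by
        rw [stdMat_mul_of_blockTriangular hd hp, ← h1]
        simp only [Matrix.mul_assoc, h3, Matrix.mul_one]

end Corners

/-! ## The commutator subgroup of a parabolic subgroup -/

section Commutator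

variable {m : ℕ} {d : Fin (m + 1) → ℕ}

/-- The block upper triangular matrices whose lower right corners are unimodular. -/
def unimodularParabolic (hd : StrictMono d) : Subgroup (SLC (d (Fin.last m))) where
  carrier := {p | p ∈ parabolic d ∧ ∀ j, (corner d j (p : Mat (d (Fin.last m)))).det = 1}
  mul_mem' {a b} ha hb := ⟨mul_mem ha.1 hb.1, fun j => by
    rw [Matrix.SpecialLinearGroup.coe_mul, corner_mul hd ha.1, det_mul, ha.2, hb.2, one_mul]⟩
  one_mem' := ⟨one_mem _, fun j => by rw [Matrix.SpecialLinearGroup.coe_one, corner_one hd,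
    det_one]⟩
  inv_mem' {a} ha := ⟨inv_mem ha.1, fun j => by
    have h := congrArg Matrix.det (corner_mul hd ha.1 ((a⁻¹ : SLC _) : Mat (d (Fin.last m))) j)
    rw [← Matrix.SpecialLinearGroup.coe_mul, mul_inv_cancel, Matrix.SpecialLinearGroup.coe_one,
      corner_one hd,
      det_one, det_mul, ha.2, one_mul] at h
    exact h.symm⟩

/-- The determinant of each corner is multiplicative on the parabolic and takes values in a
commutative group, so it is trivial on commutators. -/
theorem commutator_le_unimodularParabolic (hd : StrictMono d) :
    ⁅parabolic d, parabolic d⁆ ≤ unimodularParabolic hd := by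
  rw [Subgroup.commutator_le]
  intro a ha b hb
  have hc : ∀ {p q : SLC (d (Fin.last m))}, p ∈ parabolic d → ∀ j,
      (corner d j ((p * q : SLC _) : Mat (d (Fin.last m)))).det =
        (corner d j (p : Mat (d (Fin.last m)))).det *
          (corner d j (q : Mat (d (Fin.last m)))).det := fun hp j => by
    rw [Matrix.SpecialLinearGroup.coe_mul, corner_mul hd hp, det_mul]
  refine ⟨mul_mem (mul_mem (mul_mem ha hb) (inv_mem ha)) (inv_mem hb), fun j => ?_⟩
  have h1 := hc (q := a⁻¹) ha j
  have h2 := hc (q := b⁻¹) hb j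
  rw [mul_inv_cancel, Matrix.SpecialLinearGroup.coe_one, corner_one hd, det_one] at h1 h2
  rw [commutatorElement_def, hc (mul_mem (mul_mem ha hb) (inv_mem ha)), hc (mul_mem ha hb), hc ha]
  linear_combination -h2 - (corner d j (b : Mat (d (Fin.last m)))).det *
    (corner d j ((b⁻¹ : SLC _) : Mat (d (Fin.last m)))).det * h1

theorem transvection_mem_parabolic {i j : Fin (d (Fin.last m))} (hij : i ≠ j)
    (hb : blockIdx d i ≤ blockIdx d j) (c : ℂ) :
    Matrix.SpecialLinearGroup.transvection hij c ∈ parabolic d := by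
  change ((Matrix.SpecialLinearGroup.transvection hij c : SLC _) : Mat (d
    (Fin.last m))).BlockTriangular _
  rw [Matrix.SpecialLinearGroup.transvection_coe]
  intro r s hrs
  rw [Matrix.add_apply, one_apply_ne (by rintro rfl; exact lt_irrefl _ hrs), zero_add,
    Matrix.single_apply_of_ne]
  rintro ⟨rfl, rfl⟩
  omega

/-- Conjugation by the diagonal matrix with `2` at `i` and `1/2` at `j` multiplies the parameter of
the transvection by `4`. The commutator with parameter `c / 3` thus has parameter `4c/3 - c/3 = c`.
-/
theorem transvection_mem_commutator {i j : Fin (d (Fin.last m))} (hij : i ≠ j)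
    (hb : blockIdx d i ≤ blockIdx d j) (c : ℂ) :
    Matrix.SpecialLinearGroup.transvection hij c ∈ ⁅parabolic d, parabolic d⁆ := by
  let v : Fin (d (Fin.last m)) → ℂ := Function.update (Function.update 1 i 2) j 2⁻¹
  have hvi : v i = 2 := by simp [v, hij]
  have hvj : v j = 2⁻¹ := by simp [v]
  have hdet : (diagonal v).det = 1 := by
    rw [det_diagonal, ← Finset.mul_prod_erase _ _ (Finset.mem_univ i),
      ← Finset.mul_prod_erase _ _ (Finset.mem_erase.2 ⟨hij.symm, Finset.mem_univ j⟩), hvi, hvj,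
      Finset.prod_eq_one]
    · norm_num
    · intro k hk
      simp only [Finset.mem_erase] at hk
      simp [v, hk.1, hk.2.1]
  let D : SLC (d (Fin.last m)) := ⟨diagonal v, hdet⟩
  have hD : D ∈ parabolic d := blockTriangular_diagonal v
  have key : D * Matrix.SpecialLinearGroup.transvection hij (c / 3) =
      Matrix.SpecialLinearGroup.transvection hij c * Matrix.SpecialLinearGroup.transvection hij
        (c / 3) * D := by
    apply Subtype.ext
    change diagonal v * Matrix.transvection i j (c / 3) =
      Matrix.transvection i j c * Matrix.transvection i j (c / 3) * diagonal v
    rw [transvection_mul_transvection_same _ _ hij]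
    ext a b
    rw [diagonal_mul, mul_diagonal]
    simp only [Matrix.transvection, Matrix.add_apply, one_apply, single_apply]
    by_cases hab : a = b
    · subst hab
      have : ¬ (i = a ∧ j = a) := by rintro ⟨rfl, rfl⟩; exact hij rfl
      simp [this]
    · by_cases h : i = a ∧ j = b
      · obtain ⟨rfl, rfl⟩ := h
        simp only [hab, if_false, hvi, hvj, and_self, if_true]
        ring
      · simp [hab, h]
  have hcomm : ∀ E F : SLC (d (Fin.last m)), D * F = E * F * D →
      E = D * F * D⁻¹ * F⁻¹ := fun E F h => by
    rw [h]
    group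
  rw [hcomm _ _ key]
  exact Subgroup.commutator_mem_commutator hD (transvection_mem_parabolic hij hb _)

/-- The row and the column with index `i` are those of the identity matrix. -/
def IsReducedAt {n : ℕ} (M : Mat n) (i : Fin n) : Prop :=
  ∀ s, M i s = (1 : Mat n) i s ∧ M s i = (1 : Mat n) s i

/-- Multiples of row `i` are subtracted from the rows in `S`. A nonzero entry `M s i` forces `s`
into a block not below that of `i`, so the transvection required is available as a commutator. The
pivot is still arbitrary; the column is cleared when it equals one. -/
theorem exists_clear_column {M : SLC (d (Fin.last m))} (hM : M ∈ parabolic d)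
    (i : Fin (d (Fin.last m))) (S : Finset (Fin (d (Fin.last m)))) (hS : i ∉ S) :
    ∃ A ∈ ⁅parabolic d, parabolic d⁆, ∀ r b, ((A * M : SLC _) : Mat (d (Fin.last m))) r b =
      M r b - if r ∈ S then M r i * M i b else 0 := by
  induction S using Finset.induction_on with
  | empty => exact ⟨1, one_mem _, by simp⟩
  | insert s S hs ih =>
    obtain ⟨A, hA, h⟩ := ih fun h => hS (Finset.mem_insert_of_mem h)
    have hsi : s ≠ i := by rintro rfl; exact hS (Finset.mem_insert_self _ _)
    have hiS : i ∉ S := fun h => hS (Finset.mem_insert_of_mem h)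
    by_cases h0 : M s i = 0
    · refine ⟨A, hA, fun r b => ?_⟩
      rw [h r b]
      by_cases hr : r = s
      · subst hr; simp [hs, h0]
      · simp [hr]
    · have hb : blockIdx d s ≤ blockIdx d i := by
        by_contra hlt
        exact h0 (hM (not_le.1 hlt))
      refine ⟨Matrix.SpecialLinearGroup.transvection hsi (-M s i) * A,
        mul_mem (transvection_mem_commutator hsi hb _) hA, fun r b => ?_⟩
      rw [mul_assoc, Matrix.SpecialLinearGroup.coe_mul]
      change (Matrix.transvection s i (-M s i) * ((A * M : SLC _) : Mat (d (Fin.last m))) :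
        Mat (d (Fin.last m))) r b = _
      by_cases hr : r = s
      · subst hr
        rw [transvection_mul_apply_same, h, h]
        simp [hs, hiS]; ring
      · rw [transvection_mul_apply_of_ne _ _ _ _ hr, h]
        simp [hr]

theorem exists_clear_row {M : SLC (d (Fin.last m))} (hM : M ∈ parabolic d)
    (i : Fin (d (Fin.last m))) (S : Finset (Fin (d (Fin.last m)))) (hS : i ∉ S) :
    ∃ A ∈ ⁅parabolic d, parabolic d⁆, ∀ r b, ((M * A : SLC _) : Mat (d (Fin.last m))) r b =
      M r b - if b ∈ S then M r i * M i b else 0 := by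
  induction S using Finset.induction_on with
  | empty => exact ⟨1, one_mem _, by simp⟩
  | insert s S hs ih =>
    obtain ⟨A, hA, h⟩ := ih fun h => hS (Finset.mem_insert_of_mem h)
    have hsi : i ≠ s := by rintro rfl; exact hS (Finset.mem_insert_self _ _)
    have hiS : i ∉ S := fun h => hS (Finset.mem_insert_of_mem h)
    by_cases h0 : M i s = 0
    · refine ⟨A, hA, fun r b => ?_⟩
      rw [h r b]
      by_cases hr : b = s
      · subst hr; simp [hs, h0]
      · simp [hr]
    · have hb : blockIdx d i ≤ blockIdx d s := by
        by_contra hlt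
        exact h0 (hM (not_le.1 hlt))
      refine ⟨A * Matrix.SpecialLinearGroup.transvection hsi (-M i s),
        mul_mem hA (transvection_mem_commutator hsi hb _), fun r b => ?_⟩
      rw [← mul_assoc, Matrix.SpecialLinearGroup.coe_mul]
      change (((M * A : SLC _) : Mat (d (Fin.last m))) * Matrix.transvection i s (-M i s) :
        Mat (d (Fin.last m))) r b = _
      by_cases hr : b = s
      · subst hr
        rw [mul_transvection_apply_same, h, h]
        simp [hs, hiS]; ring
      · rw [mul_transvection_apply_of_ne _ _ _ _ hr, h]
        simp [hr]

/-- A pivot equal to one can be used to reduce its row and its column. -/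
theorem exists_reduce {M : SLC (d (Fin.last m))} (hM : M ∈ parabolic d)
    {i : Fin (d (Fin.last m))} (hi : M i i = 1) :
    ∃ A ∈ ⁅parabolic d, parabolic d⁆, ∃ B ∈ ⁅parabolic d, parabolic d⁆,
      IsReducedAt ((A * M * B : SLC _) : Mat (d (Fin.last m))) i ∧
      ∀ r, IsReducedAt (M : Mat (d (Fin.last m))) r →
        IsReducedAt ((A * M * B : SLC _) : Mat (d (Fin.last m))) r := by
  have hle : ⁅parabolic d, parabolic d⁆ ≤ parabolic d := Subgroup.commutator_le_self _
  obtain ⟨A, hA, h⟩ := exists_clear_column hM i (Finset.univ.erase i) (by simp)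
  obtain ⟨B, hB, h'⟩ := exists_clear_row (mul_mem (hle hA) hM) i (Finset.univ.erase i) (by simp)
  have h1 : ∀ b, ((A * M : SLC _) : Mat (d (Fin.last m))) i b = M i b := fun b => by
    rw [h]; simp
  have h2 : ∀ r, r ≠ i → ((A * M : SLC _) : Mat (d (Fin.last m))) r i = 0 := fun r hr => by
    rw [h]; simp [hr, hi]
  have h3 : ∀ r, r ≠ i → ∀ b, ((A * M * B : SLC _) : Mat (d (Fin.last m))) r b =
      M r b - M r i * M i b := fun r hr b => by
    rw [h', h2 r hr, h]; simp [hr]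
  have h4 : ∀ b, ((A * M * B : SLC _) : Mat (d (Fin.last m))) i b = (1 : Mat _) i b := fun b => by
    rw [h', h1, h1]
    by_cases hb : b = i
    · subst hb; simp [hi]
    · simp [hb, hi, one_apply_ne (Ne.symm hb)]
  refine ⟨A, hA, B, hB, fun s => ⟨h4 s, ?_⟩, fun r hr => ?_⟩
  · by_cases hs : s = i
    · subst hs; exact h4 s
    · rw [h3 s hs, hi, mul_one, sub_self, one_apply_ne hs]
  · by_cases hri : r = i
    · subst hri
      exact fun s => ⟨h4 s, by
        by_cases hs : s = r
        · subst hs; exact h4 s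
        · rw [h3 s hs, hi, mul_one, sub_self, one_apply_ne hs]⟩
    · refine fun s => ⟨?_, ?_⟩
      · rw [h3 r hri, (hr s).1, (hr i).1, one_apply_ne hri, zero_mul, sub_zero]
      · by_cases hs : s = i
        · subst hs; rw [h4]
        · rw [h3 s hs, (hr s).2, (hr i).2, one_apply_ne (Ne.symm hri), mul_zero, sub_zero]

theorem isReducedAt_mul_transvection {n : ℕ} {M : Mat n} {r : Fin n} (h : IsReducedAt M r)
    {i j : Fin n} (hi : r ≠ i) (hj : r ≠ j) (c : ℂ) :
    IsReducedAt (M * Matrix.transvection i j c) r := by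
  refine fun s => ⟨?_, ?_⟩
  · by_cases hs : s = j
    · subst hs
      rw [mul_transvection_apply_same, (h _).1, (h _).1, one_apply_ne hi, mul_zero, add_zero]
    · rw [mul_transvection_apply_of_ne _ _ _ _ hs, (h _).1]
  · rw [mul_transvection_apply_of_ne _ _ _ _ hj, (h _).2]

/-- A unimodular block upper triangular matrix can be multiplied by commutators so that a pivot
becomes one, keeping reduced rows and columns. -/
theorem exists_pivot (hd : StrictMono d) {M : SLC (d (Fin.last m))}
    (hM : M ∈ unimodularParabolic hd)
    (hne : ∃ i, ¬ IsReducedAt (M : Mat (d (Fin.last m))) i) :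
    ∃ i, ¬ IsReducedAt (M : Mat (d (Fin.last m))) i ∧ ∃ B ∈ ⁅parabolic d, parabolic d⁆,
      ((M * B : SLC _) : Mat (d (Fin.last m))) i i = 1 ∧
      ∀ r, IsReducedAt (M : Mat (d (Fin.last m))) r →
        IsReducedAt ((M * B : SLC _) : Mat (d (Fin.last m))) r := by
  classical
  -- An unreduced index in the lowest possible block is chosen. Row `i` is then supported on
  -- unreduced indices of its own block: reduced columns contribute nothing, and block triangularity
  -- excludes blocks further up.
  obtain ⟨i, hi, hmax⟩ := (Finset.univ.filter fun i =>
    ¬ IsReducedAt (M : Mat (d (Fin.last m))) i).exists_max_image (blockIdx d) (by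
      obtain ⟨i, hi⟩ := hne; exact ⟨i, by simpa using hi⟩)
  simp only [Finset.mem_filter, Finset.mem_univ, true_and] at hi hmax
  have hsupp : ∀ s, M i s ≠ 0 → ¬ IsReducedAt (M : Mat (d (Fin.last m))) s ∧
      blockIdx d s = blockIdx d i := by
    intro s hs
    have h1 : ¬ IsReducedAt (M : Mat (d (Fin.last m))) s := fun h => by
      have := (h i).2
      rw [one_apply_ne (by rintro rfl; exact hi h)] at this
      exact hs this
    refine ⟨h1, le_antisymm (hmax s h1) ?_⟩
    by_contra hlt
    exact hs (hM.1 (not_le.1 hlt))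
  refine ⟨i, hi, ?_⟩
  by_cases hex : ∃ j, j ≠ i ∧ ¬ IsReducedAt (M : Mat (d (Fin.last m))) j ∧
      blockIdx d j = blockIdx d i
  · have step : ∀ N : SLC (d (Fin.last m)), (∀ r, IsReducedAt (M : Mat (d (Fin.last m))) r →
        IsReducedAt (N : Mat (d (Fin.last m))) r) → ∀ j, j ≠ i →
        ¬ IsReducedAt (M : Mat (d (Fin.last m))) j → blockIdx d j = blockIdx d i → N i j ≠ 0 →
        ∃ B ∈ ⁅parabolic d, parabolic d⁆,
          ((N * B : SLC _) : Mat (d (Fin.last m))) i i = 1 ∧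
          ∀ r, IsReducedAt (M : Mat (d (Fin.last m))) r →
            IsReducedAt ((N * B : SLC _) : Mat (d (Fin.last m))) r := by
      intro N hN j hji hj hbj h0
      refine ⟨Matrix.SpecialLinearGroup.transvection hji ((1 - N i i) / N i j),
        transvection_mem_commutator hji hbj.le _, ?_, fun r hr => ?_⟩
      · change ((N : Mat (d (Fin.last m))) * Matrix.transvection j i _ : Mat (d
          (Fin.last m))) i i = _
        rw [mul_transvection_apply_same, div_mul_cancel₀ _ h0]
        ring
      · exact isReducedAt_mul_transvection (hN r hr) (by rintro rfl; exact hj hr)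
          (by rintro rfl; exact hi hr) _
    obtain ⟨j, hji, hj, hbj⟩ := hex
    -- A nonzero off-diagonal entry of row `i` lets a column operation set the pivot to one. If
    -- there is none, the diagonal entry is nonzero, and adding column `i` to column `j` first
    -- creates such an entry.
    by_cases hs : ∃ s, s ≠ i ∧ M i s ≠ 0
    · obtain ⟨s, hsi, hs0⟩ := hs
      exact step M (fun _ h => h) s hsi (hsupp s hs0).1 (hsupp s hs0).2 hs0
    · push Not at hs
      have hii : M i i ≠ 0 := fun h => by
        have h0 : (M : Mat (d (Fin.last m))).det = 0 :=
          det_eq_zero_of_row_eq_zero i fun s => by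
            by_cases hsi : s = i
            · subst hsi; exact h
            · exact hs s hsi
        rw [M.det_coe] at h0
        exact one_ne_zero h0
      obtain ⟨B, hB, hB1, hB2⟩ := step (M * Matrix.SpecialLinearGroup.transvection hji.symm 1)
        (fun r hr => isReducedAt_mul_transvection hr (by rintro rfl; exact hi hr)
          (by rintro rfl; exact hj hr) _) j hji hj hbj (by
            change ((M : Mat (d (Fin.last m))) * Matrix.transvection i j 1 :
              Mat (d (Fin.last m))) i j ≠ 0
            rw [mul_transvection_apply_same, hs j hji]
            simpa using hii)
      refine ⟨Matrix.SpecialLinearGroup.transvection hji.symm 1 * B,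
        mul_mem (transvection_mem_commutator hji.symm hbj.ge _) hB, ?_, ?_⟩
      · rw [← mul_assoc]; exact hB1
      · rw [← mul_assoc]; exact hB2
  -- Here `i` is the only unreduced index in its block. The corner beginning with this block is
  -- diagonal with all entries one except possibly `M i i`, so its determinant forces `M i i = 1`.
  · refine ⟨1, one_mem _, ?_, by simp⟩
    rw [mul_one]
    push Not at hex
    have hbm := blockIdx_le i
    let j : Fin (m + 1) := ⟨m - blockIdx d i, by omega⟩
    obtain ⟨i', hi'⟩ := exists_emb_eq (le_last hd j) (j := i)
      ((rev_lt_iff hd i j).2 (by simp only [j]; omega))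
    have hdiag : corner d j (M : Mat (d (Fin.last m))) =
        diagonal (Function.update 1 i' (M i i)) := by
      ext a b
      rw [corner_apply hd]
      by_cases ha : a = i'
      · subst ha
        by_cases hab : a = b
        · subst hab; rw [hi']; simp
        · rw [diagonal_apply_ne _ hab, hi']
          by_contra h0
          obtain ⟨h1, h2⟩ := hsupp _ h0
          exact hex _ (by rw [← hi']; exact fun h => hab (emb_injective _ h).symm) h1 h2
      · have hra : IsReducedAt (M : Mat (d (Fin.last m))) (emb (le_last hd j) a) := by
          by_contra hra
          have hne : emb (le_last hd j) a ≠ i := by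
            rw [← hi']; exact fun h => ha (emb_injective _ h)
          refine hex _ hne hra (le_antisymm (hmax _ hra) ?_)
          have := (rev_lt_iff hd (emb (le_last hd j) a) j).1 (by rw [emb_rev]; exact a.rev.2)
          simp only [j] at this ⊢
          omega
        rw [(hra _).1, diagonal_apply, one_apply]
        simp [Function.update_of_ne ha, (emb_injective (le_last hd j)).eq_iff]
    have hdet := hM.2 j
    rw [hdiag, det_diagonal, Finset.prod_update_of_mem (Finset.mem_univ _)] at hdet
    simpa using hdet

/-- Gaussian elimination inside `[P, P]`: produce a pivot equal to one, clear its row and column,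
and induct on the number of unreduced indices. Multiplication by commutators does not affect
membership, and the process ends at the identity. -/
theorem commutator_parabolic (hd : StrictMono d) :
    ⁅parabolic d, parabolic d⁆ = unimodularParabolic hd := by
  classical
  refine le_antisymm (commutator_le_unimodularParabolic hd) fun M hM => ?_
  induction hk : (Finset.univ.filter fun i =>
      ¬ IsReducedAt (M : Mat (d (Fin.last m))) i).card using Nat.strong_induction_on
      generalizing M with
  | _ k ih =>
  by_cases hne : ∃ i, ¬ IsReducedAt (M : Mat (d (Fin.last m))) i
  · obtain ⟨i, hi, B, hB, hpiv, hred⟩ := exists_pivot hd hM hne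
    have hcl := commutator_le_unimodularParabolic hd
    have hMB := mul_mem hM (hcl hB)
    obtain ⟨A', hA', B', hB', hredi, hred'⟩ := exists_reduce hMB.1 hpiv
    have hmem := ih _ (by
      rw [← hk]
      refine Finset.card_lt_card ((Finset.ssubset_iff_of_subset fun r hr => ?_).2 ⟨i, ?_, ?_⟩)
      · simp only [Finset.mem_filter, Finset.mem_univ, true_and] at hr ⊢
        exact fun h => hr (hred' r (hred r h))
      · simpa using hi
      · simpa using hredi) _ (mul_mem (mul_mem (hcl hA') hMB) (hcl hB')) rfl
    rwa [Subgroup.mul_mem_cancel_right _ hB', Subgroup.mul_mem_cancel_left _ hA',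
      Subgroup.mul_mem_cancel_right _ hB] at hmem
  · push Not at hne
    have : M = 1 := by
      ext r s
      exact (hne r s).1
    rw [this]
    exact one_mem _

theorem strictMono_fullFlag (m : ℕ) : StrictMono (fullFlag m) := fun i j hij => by
  simp only [fullFlag]
  have := Fin.lt_def.1 hij
  omega

theorem blockIdx_fullFlag (m : ℕ) (a : Fin (fullFlag m (Fin.last m))) :
    blockIdx (fullFlag m) a = a := by
  have hle := blockIdx_le (d := fullFlag m) a
  have ha : (a : ℕ) < m + 1 := a.2
  have h1 := rev_lt_iff (strictMono_fullFlag m) a ⟨m - a, by omega⟩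
  have h2 := rev_lt_iff (strictMono_fullFlag m) a ⟨m - blockIdx (fullFlag m) a, by omega⟩
  simp only [Fin.val_rev, fullFlag, Fin.val_last] at h1 h2
  have := h1.1 (by omega)
  have := h2.2 (by omega)
  omega

theorem blockTriangular_fullFlag_iff {m : ℕ} {M : Mat (m + 1)} :
    M.BlockTriangular (blockIdx (fullFlag m)) ↔ M.BlockTriangular id := by
  have h : ∀ a b : Fin (m + 1), blockIdx (fullFlag m) a < blockIdx (fullFlag m) b ↔ a < b :=
    fun a b => by rw [blockIdx_fullFlag, blockIdx_fullFlag, Fin.lt_def]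
  exact ⟨fun hM i j hij => hM ((h j i).2 hij), fun hM i j hij => hM ((h j i).1 hij)⟩

/-- Diagonal entries of triangular matrices multiply, so a commutator has unit diagonal; the
description as `[P, P]` then gives one inclusion. For the other, the corners of a unitriangular
matrix are unitriangular. -/
theorem unimodularParabolic_fullFlag (m : ℕ) :
    unimodularParabolic (strictMono_fullFlag m) = unip (m + 1) := by
  have hd := strictMono_fullFlag m
  apply le_antisymm
  · rw [← commutator_parabolic]
    rw [Subgroup.commutator_le]
    intro (a : SLC (m + 1)) ha (b : SLC (m + 1)) hb
    have ha' : a ∈ borelSL (m + 1) := blockTriangular_fullFlag_iff.1 ha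
    have hb' : b ∈ borelSL (m + 1) := blockTriangular_fullFlag_iff.1 hb
    refine ⟨mul_mem (mul_mem (mul_mem ha' hb') (inv_mem ha')) (inv_mem hb'), fun i => ?_⟩
    have h1 := upper_mul_diag ha' (inv_mem ha') i
    have h2 := upper_mul_diag hb' (inv_mem hb') i
    rw [← Matrix.SpecialLinearGroup.coe_mul, mul_inv_cancel, Matrix.SpecialLinearGroup.coe_one,
      one_apply_eq] at h1 h2
    rw [commutatorElement_def, Matrix.SpecialLinearGroup.coe_mul,
      upper_mul_diag (mul_mem (mul_mem ha' hb') (inv_mem ha')) (inv_mem hb'),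
      Matrix.SpecialLinearGroup.coe_mul, upper_mul_diag (mul_mem ha' hb') (inv_mem ha'),
      Matrix.SpecialLinearGroup.coe_mul, upper_mul_diag ha' hb']
    linear_combination -h2 - (b : Mat (m + 1)) i i *
      ((b⁻¹ : SLC (m + 1)) : Mat (m + 1)) i i * h1
  · intro p hp
    refine ⟨blockTriangular_fullFlag_iff.2 hp.1, fun j => ?_⟩
    rw [det_of_isUpperTriangular (fun a b hab => ?_), Finset.prod_eq_one fun a _ => ?_]
    · rw [corner_apply hd]; exact hp.2 _
    · rw [corner_apply hd]
      refine hp.1 ?_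
      simp only [id, emb, Fin.lt_def] at hab ⊢
      omega

end Commutator

/-! ## The action on quivers -/

section Action

variable {m : ℕ} {d : Fin (m + 1) → ℕ}

theorem coe_mul_coe_inv {n : ℕ} (g : SLC n) : (g : Mat n) * ((g⁻¹ : SLC n) : Mat n) = 1 := by
  rw [← Matrix.SpecialLinearGroup.coe_mul, mul_inv_cancel, Matrix.SpecialLinearGroup.coe_one]

theorem coe_inv_mul_coe {n : ℕ} (g : SLC n) : ((g⁻¹ : SLC n) : Mat n) * (g : Mat n) = 1 := by
  rw [← Matrix.SpecialLinearGroup.coe_mul, inv_mul_cancel, Matrix.SpecialLinearGroup.coe_one]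

theorem coe_inv_mul_cancel_left {n : ℕ} {γ : Type*} (g : SLC n) (M : Matrix (Fin n) γ ℂ) :
    ((g⁻¹ : SLC n) : Mat n) * ((g : Mat n) * M) = M := by
  rw [← Matrix.mul_assoc, coe_inv_mul_coe, Matrix.one_mul]

theorem act_one (x : QuiverRep d) : act 1 x = x := by
  simp [act]

theorem act_mul (g h : ∀ j : Fin (m + 1), SLC (d j)) (x : QuiverRep d) :
    act (g * h) x = act g (act h x) := by
  simp only [act, Pi.mul_apply, _root_.mul_inv_rev, Matrix.SpecialLinearGroup.coe_mul,
    Matrix.mul_assoc]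

theorem incoming_act (g : ∀ j : Fin (m + 1), SLC (d j)) (x : QuiverRep d) (j : Fin (m + 1)) :
    incoming (act g x) j =
      (g j : Mat (d j)) * incoming x j * (((g j)⁻¹ : SLC (d j)) : Mat (d j)) := by
  cases j using Fin.cases with
  | zero => simp [incoming]
  | succ i =>
    simp only [incoming, Fin.cases_succ, act, Matrix.mul_assoc, coe_inv_mul_cancel_left]

theorem one_add_conj {n : ℕ} (g : SLC n) (M : Mat n) :
    1 + (g : Mat n) * M * ((g⁻¹ : SLC n) : Mat n) =
      (g : Mat n) * (1 + M) * ((g⁻¹ : SLC n) : Mat n) := by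
  rw [Matrix.mul_add, Matrix.add_mul, Matrix.mul_one, coe_mul_coe_inv]

theorem lastY_act (g : ∀ j : Fin (m + 1), SLC (d j)) (x : QuiverRep d) :
    lastY (act g x) = (g (Fin.last m) : Mat (d (Fin.last m))) * lastY x *
      (((g (Fin.last m))⁻¹ : SLC (d (Fin.last m))) : Mat (d (Fin.last m))) := by
  rw [lastY, incoming_act, one_add_conj, lastY]

theorem alpha_mul_beta_act (g : ∀ j : Fin (m + 1), SLC (d j)) (x : QuiverRep d) (i : Fin m) :
    1 + (act g x).1 i * (act g x).2 i = (g i.succ : Mat (d i.succ)) * (1 + x.1 i * x.2 i) *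
      (((g i.succ)⁻¹ : SLC (d i.succ)) : Mat (d i.succ)) := by
  rw [← one_add_conj]
  simp only [act, Matrix.mul_assoc, coe_inv_mul_cancel_left]

theorem beta_mul_alpha_act (g : ∀ j : Fin (m + 1), SLC (d j)) (x : QuiverRep d) (i : Fin m) :
    1 + (act g x).2 i * (act g x).1 i = (g i.castSucc : Mat (d i.castSucc)) *
      (1 + x.2 i * x.1 i) * (((g i.castSucc)⁻¹ : SLC (d i.castSucc)) : Mat (d i.castSucc)) := by
  rw [← one_add_conj]
  simp only [act, Matrix.mul_assoc, coe_inv_mul_cancel_left]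

theorem isUnit_coe {n : ℕ} (g : SLC n) : IsUnit (g : Mat n) := by
  rw [Matrix.isUnit_iff_isUnit_det, g.det_coe]; exact isUnit_one

theorem isMult_act {x : QuiverRep d} (hx : IsMult x) (g : ∀ j : Fin (m + 1), SLC (d j)) :
    IsMult (act g x) := fun i => by
  rw [alpha_mul_beta_act, beta_mul_alpha_act]
  exact ⟨((isUnit_coe _).mul (hx i).1).mul (isUnit_coe _),
    ((isUnit_coe _).mul (hx i).2).mul (isUnit_coe _)⟩

theorem allSurj_act {x : QuiverRep d} (hx : AllSurj x) (g : ∀ j : Fin (m + 1), SLC (d j)) :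
    AllSurj (act g x) := fun i v => by
  obtain ⟨w, hw⟩ := hx i ((((g i.castSucc)⁻¹ : SLC (d i.castSucc)) : Mat (d i.castSucc)) *ᵥ v)
  refine ⟨(g i.succ : Mat (d i.succ)) *ᵥ w, ?_⟩
  simp only [act, mulVec_mulVec, Matrix.mul_assoc, coe_inv_mul_coe, Matrix.mul_one]
  rw [← mulVec_mulVec, hw, mulVec_mulVec, coe_mul_coe_inv, one_mulVec]

theorem multEq_act {x : QuiverRep d} {q : Fin m → ℂ} (hx : MultEq x q)
    (g : ∀ j : Fin (m + 1), SLC (d j)) : MultEq (act g x) q := fun i => by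
  rw [beta_mul_alpha_act, incoming_act, one_add_conj, hx i, Matrix.mul_smul, Matrix.smul_mul]

theorem modMultEq_act {x : QuiverRep d} {t : Fin (m + 1) → ℂ} (hx : ModMultEq x t)
    (g : ∀ j : Fin (m + 1), SLC (d j)) : ModMultEq (act g x) t :=
  ⟨hx.1, fun i => by
    rw [beta_mul_alpha_act, incoming_act, one_add_conj, ← Matrix.smul_mul, ← Matrix.mul_smul,
      hx.2 i, Matrix.mul_smul, Matrix.smul_mul]⟩

theorem act_mem_surjSol {x : QuiverRep d} (hx : x ∈ surjSol d) (g : ∀ j : Fin (m + 1), SLC (d j)) :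
    act g x ∈ surjSol d :=
  ⟨isMult_act hx.1 g, hx.2.1.imp fun _ h => multEq_act h g, allSurj_act hx.2.2 g⟩

theorem act_mem_modSurjSol {x : QuiverRep d} {t : Fin (m + 1) → ℂ} (hx : (x, t) ∈ modSurjSol d)
    (g : ∀ j : Fin (m + 1), SLC (d j)) : (act g x, t) ∈ modSurjSol d :=
  ⟨isMult_act hx.1 g, modMultEq_act hx.2.1 g, allSurj_act hx.2.2 g⟩

theorem isUnit_one_add_incoming {x : QuiverRep d} (hx : IsMult x) (j : Fin (m + 1)) :
    IsUnit (1 + incoming x j) := by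
  cases j using Fin.cases with
  | zero => simp [incoming]
  | succ i => simpa [incoming] using (hx i).1

end Action

/-! ## Quivers in standard form -/

section Standard

variable {m : ℕ} {d : Fin (m + 1) → ℕ}

theorem dim_pos (hd : StrictMono d) (h0 : 0 < d 0) (j : Fin (m + 1)) : 0 < d j :=
  h0.trans_le (hd.monotone (Fin.zero_le j))

/-- The first of the last `d j` rows. -/
def topRow (hd : StrictMono d) (h0 : 0 < d 0) (j : Fin (m + 1)) : Fin (d (Fin.last m)) :=
  emb (le_last hd j) ⟨0, dim_pos hd h0 j⟩

/-- The diagonal entry of `Y` in the row `topRow hd h0 j`. -/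
def blockScalar (hd : StrictMono d) (h0 : 0 < d 0) (Y : Mat (d (Fin.last m))) (j : Fin (m + 1)) :
    ℂ := Y (topRow hd h0 j) (topRow hd h0 j)

/-- The least `j` such that `a` is among the last `d j` rows. -/
def level (a : Fin (d (Fin.last m))) : Fin (m + 1) := ⟨m - blockIdx d a, by omega⟩

theorem rev_lt_level (hd : StrictMono d) (a : Fin (d (Fin.last m))) :
    (a.rev : ℕ) < d (level a) :=
  (rev_lt_iff hd a _).2 (by simp only [level]; omega)

theorem rev_lt_iff_level_le (hd : StrictMono d) (a : Fin (d (Fin.last m))) (j : Fin (m + 1)) :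
    (a.rev : ℕ) < d j ↔ level a ≤ j := by
  rw [rev_lt_iff hd, Fin.le_def]
  simp only [level]
  omega

theorem blockIdx_le_iff {a b : Fin (d (Fin.last m))} :
    blockIdx d a ≤ blockIdx d b ↔ level b ≤ level a := by
  have := blockIdx_le a
  have := blockIdx_le b
  rw [Fin.le_def]
  simp only [level]
  omega

theorem level_topRow (hd : StrictMono d) (h0 : 0 < d 0) (j : Fin (m + 1)) :
    level (topRow hd h0 j) = j := by
  have h : ∀ j', level (topRow hd h0 j) ≤ j' ↔ j ≤ j' := fun j' => by
    rw [← rev_lt_iff_level_le hd, topRow, emb_rev, ← hd.le_iff_le]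
    have := dim_pos hd h0 j
    simp only [Fin.val_rev]
    omega
  exact le_antisymm ((h j).2 le_rfl) ((h _).1 le_rfl)

theorem level_anti (hd : StrictMono d) {a b : Fin (d (Fin.last m))} (h : a ≤ b) :
    level b ≤ level a := by
  rw [← rev_lt_iff_level_le hd]
  refine lt_of_le_of_lt ?_ (rev_lt_level hd a)
  rw [← Fin.le_def, Fin.rev_le_rev]
  exact h

theorem prod_div_telescope {m : ℕ} (f : Fin (m + 1) → ℂ) (hf : ∀ j, f j ≠ 0) (j : Fin (m + 1)) :
    ∏ i ∈ Finset.univ.filter (fun i : Fin m => (j : ℕ) ≤ i), f i.castSucc / f i.succ =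
      f j / f (Fin.last m) := by
  induction j using Fin.reverseInduction with
  | last =>
    rw [Finset.prod_eq_one, div_self (hf _)]
    intro i hi
    simp only [Finset.mem_filter, Fin.val_last] at hi
    exact absurd i.2 (by omega)
  | cast i ih =>
    have : (Finset.univ.filter fun k : Fin m => (i.castSucc : ℕ) ≤ k) =
        insert i (Finset.univ.filter fun k : Fin m => (i.succ : ℕ) ≤ k) := by
      ext k
      simp only [Finset.mem_filter, Finset.mem_insert, Finset.mem_univ, true_and, Fin.ext_iff,
        Fin.val_castSucc, Fin.val_succ]
      omega
    rw [this, Finset.prod_insert (by simp), ih, div_mul_div_cancel₀ (hf _)]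

/-- The parameters are determined by `Y` as ratios of consecutive diagonal scalars. Eliminating them
leaves polynomial equations and nonvanishing conditions; the condition on `level r ≤ level s`
contains both triangularity and the shape of the diagonal blocks. -/
theorem mem_scalarBlock_iff (hd : StrictMono d) (h0 : 0 < d 0) {Y : Mat (d (Fin.last m))} :
    Y ∈ scalarBlock d ↔ blockScalar hd h0 Y (Fin.last m) = 1 ∧ (∀ j, blockScalar hd h0 Y j ≠ 0) ∧
      ∀ r s, level r ≤ level s →
        Y r s = if r = s then blockScalar hd h0 Y (level s) else 0 := by
  have hfilter : ∀ a : Fin (d (Fin.last m)), ∀ i : Fin m,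
      m ≤ (i : ℕ) + blockIdx d a ↔ (level a : ℕ) ≤ i := fun a i => by
    simp only [level]; omega
  have hlev : ∀ a b : Fin (d (Fin.last m)), blockIdx d a = blockIdx d b ↔ level a = level b :=
    fun a b => by
      rw [le_antisymm_iff, le_antisymm_iff, blockIdx_le_iff, blockIdx_le_iff, and_comm]
  constructor
  · rintro ⟨htri, q, hq, hY⟩
    have hs : ∀ j, blockScalar hd h0 Y j =
        ∏ i ∈ Finset.univ.filter (fun i : Fin m => (j : ℕ) ≤ i), q i := fun j => by
      rw [blockScalar, hY _ _ rfl, if_pos rfl]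
      simp only [hfilter, level_topRow]
    refine ⟨?_, fun j => ?_, fun r s hrs => ?_⟩
    · rw [hs]
      refine Finset.prod_eq_one fun i hi => ?_
      simp only [Finset.mem_filter, Fin.val_last] at hi
      exact absurd i.2 (by omega)
    · rw [hs]
      exact Finset.prod_ne_zero_iff.2 fun i _ => hq i
    · rcases hrs.lt_or_eq with hlt | heq
      · have h1 : blockIdx d s < blockIdx d r := by
          rw [← not_le, blockIdx_le_iff, not_le]; exact hlt
        rw [htri h1, if_neg]
        rintro rfl
        exact lt_irrefl _ hlt
      · rw [hY r s ((hlev r s).2 heq), hs, ← heq]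
        simp only [hfilter]
  · rintro ⟨h1, hne, hY⟩
    refine ⟨fun r s hrs => ?_, fun i => blockScalar hd h0 Y i.castSucc / blockScalar hd h0 Y i.succ,
      fun i => div_ne_zero (hne _) (hne _), fun a b hab => ?_⟩
    · rw [hY r s (blockIdx_le_iff.1 hrs.le), if_neg]
      rintro rfl
      exact lt_irrefl _ hrs
    · simp only [hfilter]
      rw [hY a b ((hlev a b).1 hab).le, prod_div_telescope _ hne, h1, div_one, (hlev a b).1 hab]

theorem corner_corner (hd : StrictMono d) (M : Mat (d (Fin.last m))) (i : Fin m) :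
    stdMat (d i.castSucc) (d i.succ) * corner d i.succ M * (stdMat (d i.castSucc) (d i.succ))ᵀ =
      corner d i.castSucc M := by
  rw [corner, corner, ← stdMat_mul_stdMat (le_succ hd i) (le_last hd i.succ), transpose_mul]
  simp only [Matrix.mul_assoc]

/-- The quiver in standard form determined by `Y`. -/
def stdQuiver (hd : StrictMono d) (h0 : 0 < d 0) (Y : Mat (d (Fin.last m))) : QuiverRep d :=
  (fun i => ((blockScalar hd h0 Y i.succ)⁻¹ • corner d i.succ Y - 1) *
      (stdMat (d i.castSucc) (d i.succ))ᵀ,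
    fun i => stdMat (d i.castSucc) (d i.succ))

theorem isStandard_stdQuiver (hd : StrictMono d) (h0 : 0 < d 0) (Y : Mat (d (Fin.last m))) :
    IsStandard (stdQuiver hd h0 Y) := isStandard_iff.2 fun _ => rfl

theorem incoming_apply_of_isStandard (hd : StrictMono d) {x : QuiverRep d} (hx : IsStandard x)
    (s : Fin (d (Fin.last m))) {r' s' : Fin (d (level s))}
    (hs' : emb (le_last hd (level s)) s' = s) : incoming x (level s) r' s' = 0 := by
  -- The level is replaced by a variable so that the vertex can be split into zero and successor
  -- despite the dependent index types.
  obtain ⟨j, hj⟩ : ∃ j, j = level s := ⟨_, rfl⟩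
  have hrev : ((s' : Fin (d (level s))).rev : ℕ) = s.rev := by rw [← emb_rev (le_last hd _), hs']
  clear hs'
  revert r' s'
  rw [← hj]
  intro r' s' hrev
  cases j using Fin.cases with
  | zero => rfl
  | succ i =>
    simp only [incoming, Fin.cases_succ]
    rw [isStandard_iff.1 hx, mul_stdMat_apply_of_le (le_succ hd i)]
    rw [hrev, ← not_lt, rev_lt_iff_level_le hd, ← hj, not_le]
    exact i.castSucc_lt_succ

/-- Standard `β` satisfies `β βᵀ = 1`, so `β (1 + αβ) βᵀ = 1 + βα`: passing to the next smaller
corner turns `1 + αβ` into `1 + βα`, which the quiver equation replaces by `q` times the matrix at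
the preceding vertex. Descending induction collects the scalars. -/
theorem corner_lastY (hd : StrictMono d) {x : QuiverRep d} (hx : IsStandard x) {q : Fin m → ℂ}
    (hq : MultEq x q) (j : Fin (m + 1)) : corner d j (lastY x) =
      (∏ i ∈ Finset.univ.filter (fun i : Fin m => (j : ℕ) ≤ i), q i) • (1 + incoming x j) := by
  induction j using Fin.reverseInduction with
  | last =>
    rw [corner_last, Finset.prod_eq_one, one_smul, lastY]
    intro i hi
    simp only [Finset.mem_filter, Fin.val_last] at hi
    exact absurd i.2 (by omega)
  | cast i ih =>
    have hset : (Finset.univ.filter fun k : Fin m => (i.castSucc : ℕ) ≤ k) =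
        insert i (Finset.univ.filter fun k : Fin m => (i.succ : ℕ) ≤ k) := by
      ext k
      simp only [Finset.mem_filter, Finset.mem_insert, Finset.mem_univ, true_and, Fin.ext_iff,
        Fin.val_castSucc, Fin.val_succ]
      omega
    have hE := stdMat_mul_transpose (le_succ hd i)
    rw [← corner_corner hd, ih, hset, Finset.prod_insert (by simp), mul_comm, mul_smul, ← hq i,
      Matrix.mul_smul, Matrix.smul_mul]
    congr 1
    simp only [incoming, Fin.cases_succ]
    rw [isStandard_iff.1 hx, Matrix.mul_add, Matrix.add_mul, Matrix.mul_one, hE]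
    simp only [Matrix.mul_assoc, hE, Matrix.mul_one]

theorem blockScalar_lastY (hd : StrictMono d) (h0 : 0 < d 0) {x : QuiverRep d} (hx : IsStandard x)
    {q : Fin m → ℂ} (hq : MultEq x q) (j : Fin (m + 1)) : blockScalar hd h0 (lastY x) j =
      ∏ i ∈ Finset.univ.filter (fun i : Fin m => (j : ℕ) ≤ i), q i := by
  -- Since `d` is strictly increasing, `β = (0 I)` has at least one zero column on the left, and so
  -- does `αβ`.
  have hinc : ∀ a : Fin (d j), (a : ℕ) = 0 → incoming x j a a = 0 := by
    cases j using Fin.cases with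
    | zero => intro a _; rfl
    | succ i =>
      intro a ha
      simp only [incoming, Fin.cases_succ]
      rw [isStandard_iff.1 hx, mul_stdMat_apply_of_le (le_succ hd i)]
      have := hd i.castSucc_lt_succ
      simp only [Fin.val_rev]
      omega
  rw [blockScalar, topRow, ← corner_apply hd j (lastY x), corner_lastY hd hx hq, Matrix.smul_apply,
    Matrix.add_apply, hinc _ rfl, one_apply_eq, add_zero, smul_eq_mul, mul_one]

theorem multEq_ne_zero (hd : StrictMono d) (h0 : 0 < d 0) {x : QuiverRep d} (hx : IsMult x)
    {q : Fin m → ℂ} (hq : MultEq x q) (i : Fin m) : q i ≠ 0 := fun h => by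
  have hu := (hx i).2
  have : Nonempty (Fin (d i.castSucc)) := ⟨⟨0, dim_pos hd h0 _⟩⟩
  rw [hq i, h, zero_smul] at hu
  exact not_isUnit_zero hu

theorem lastY_mem_scalarBlock (hd : StrictMono d) (h0 : 0 < d 0) {x : QuiverRep d}
    (hx : x ∈ surjSol d) (hst : IsStandard x) : lastY x ∈ scalarBlock d := by
  obtain ⟨hmul, ⟨q, hq⟩, -⟩ := hx
  rw [mem_scalarBlock_iff hd h0]
  simp only [blockScalar_lastY hd h0 hst hq]
  refine ⟨Finset.prod_eq_one fun i hi => ?_,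
    fun j => Finset.prod_ne_zero_iff.2 fun i _ => multEq_ne_zero hd h0 hmul hq i,
    fun r s hrs => ?_⟩
  · simp only [Finset.mem_filter, Fin.val_last] at hi
    exact absurd i.2 (by omega)
  · obtain ⟨s', hs'⟩ := exists_emb_eq (le_last hd (level s)) (rev_lt_level hd s)
    obtain ⟨r', hr'⟩ := exists_emb_eq (le_last hd (level s)) ((rev_lt_iff_level_le hd r _).2 hrs)
    have h1 := congrFun (congrFun (corner_lastY hd hst hq (level s)) r') s'
    rw [corner_apply hd, hr', hs', Matrix.smul_apply, Matrix.add_apply,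
      incoming_apply_of_isStandard hd hst s hs', add_zero, one_apply] at h1
    rw [h1]
    by_cases h : r' = s'
    · subst h
      rw [if_pos rfl, if_pos (hr'.symm.trans hs'), smul_eq_mul, mul_one]
    · rw [if_neg h, if_neg, smul_zero]
      rintro rfl
      exact h (emb_injective _ (hr'.trans hs'.symm))

theorem stdQuiver_lastY (hd : StrictMono d) (h0 : 0 < d 0) {x : QuiverRep d}
    (hx : x ∈ surjSol d) (hst : IsStandard x) : stdQuiver hd h0 (lastY x) = x := by
  obtain ⟨hmul, ⟨q, hq⟩, -⟩ := hx
  refine Prod.ext (funext fun i => ?_) (funext fun i => (isStandard_iff.1 hst i).symm)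
  simp only [stdQuiver]
  rw [blockScalar_lastY hd h0 hst hq, corner_lastY hd hst hq, inv_smul_smul₀
    (Finset.prod_ne_zero_iff.2 fun i _ => multEq_ne_zero hd h0 hmul hq i), add_sub_cancel_left]
  simp only [incoming, Fin.cases_succ]
  rw [isStandard_iff.1 hst, Matrix.mul_assoc, stdMat_mul_transpose (le_succ hd i), Matrix.mul_one]

theorem isUnit_corner_of_mem_scalarBlock (hd : StrictMono d) (h0 : 0 < d 0)
    {Y : Mat (d (Fin.last m))} (hY : Y ∈ scalarBlock d) (j : Fin (m + 1)) :
    IsUnit (corner d j Y) := by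
  obtain ⟨-, hne, hY⟩ := (mem_scalarBlock_iff hd h0).1 hY
  rw [isUnit_iff_isUnit_det, isUnit_iff_ne_zero, det_of_isUpperTriangular fun a b hab => ?_]
  · refine Finset.prod_ne_zero_iff.2 fun a _ => ?_
    rw [corner_apply hd, hY _ _ le_rfl, if_pos rfl]
    exact hne _
  · have hlt : emb (le_last hd j) b < emb (le_last hd j) a := by
      simp only [id, emb, Fin.lt_def] at hab ⊢
      omega
    rw [corner_apply hd, hY _ _ (level_anti hd hlt.le), if_neg hlt.ne']

/-- Multiplying by `βᵀ β` keeps the last columns and kills the others. Nothing is lost, because in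
those other columns the rescaled corner already agrees with the identity, `Y` having a scalar
diagonal block there. -/
theorem one_add_incoming_stdQuiver (hd : StrictMono d) (h0 : 0 < d 0)
    {Y : Mat (d (Fin.last m))} (hY : ∀ r s, level r ≤ level s →
        Y r s = if r = s then blockScalar hd h0 Y (level s) else 0)
    (hne : ∀ j, blockScalar hd h0 Y j ≠ 0) (j : Fin (m + 1)) :
    1 + incoming (stdQuiver hd h0 Y) j = (blockScalar hd h0 Y j)⁻¹ • corner d j Y := by
  have key : ∀ a b : Fin (d j), level (emb (le_last hd j) b) = j →
      ((blockScalar hd h0 Y j)⁻¹ • corner d j Y) a b = (1 : Mat (d j)) a b := fun a b hb => by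
    have hle : level (emb (le_last hd j) a) ≤ j := by
      rw [← rev_lt_iff_level_le hd, emb_rev]; exact a.rev.2
    rw [Matrix.smul_apply, corner_apply hd, hY _ _ (hle.trans hb.ge), hb, one_apply]
    simp only [(emb_injective (le_last hd j)).eq_iff]
    split_ifs
    · exact inv_mul_cancel₀ (hne j)
    · simp
  cases j using Fin.cases with
  | zero =>
    ext a b
    have hb : level (emb (le_last hd 0) b) = 0 := by
      rw [← Fin.le_zero_iff, ← rev_lt_iff_level_le hd, emb_rev]; exact b.rev.2
    rw [key a b hb]
    simp [incoming]
  | succ i =>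
    rw [← eq_sub_iff_add_eq']
    simp only [incoming, Fin.cases_succ, stdQuiver]
    ext a b
    by_cases hb : (b.rev : ℕ) < d i.castSucc
    · obtain ⟨b, rfl⟩ := exists_emb_eq (le_succ hd i) hb
      rw [mul_stdMat_apply_emb (le_succ hd i), mul_stdMat_transpose (le_succ hd i)]
      rfl
    · rw [mul_stdMat_apply_of_le (le_succ hd i) _ _ (not_lt.1 hb), Matrix.sub_apply, key, sub_self]
      refine le_antisymm ?_ ?_
      · rw [← rev_lt_iff_level_le hd, emb_rev]; exact b.rev.2
      · rw [← emb_rev (le_last hd i.succ), rev_lt_iff_level_le hd, not_le] at hb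
        rw [Fin.lt_def] at hb
        rw [Fin.le_def, Fin.val_succ]
        exact hb

theorem beta_mul_alpha_stdQuiver (hd : StrictMono d) (h0 : 0 < d 0) (Y : Mat (d (Fin.last m)))
    (i : Fin m) : 1 + (stdQuiver hd h0 Y).2 i * (stdQuiver hd h0 Y).1 i =
      (blockScalar hd h0 Y i.succ)⁻¹ • corner d i.castSucc Y := by
  simp only [stdQuiver]
  rw [← Matrix.mul_assoc, Matrix.mul_sub, Matrix.sub_mul, Matrix.mul_one,
    stdMat_mul_transpose (le_succ hd i), Matrix.mul_smul, Matrix.smul_mul, corner_corner hd,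
    add_sub_cancel]

theorem stdQuiver_mem_surjSol (hd : StrictMono d) (h0 : 0 < d 0)
    {Y : Mat (d (Fin.last m))} (hY : Y ∈ scalarBlock d) : stdQuiver hd h0 Y ∈ surjSol d := by
  have hu := isUnit_corner_of_mem_scalarBlock hd h0 hY
  obtain ⟨-, hne, hY⟩ := (mem_scalarBlock_iff hd h0).1 hY
  have hinc := one_add_incoming_stdQuiver hd h0 hY hne
  have hsm : ∀ {j k}, IsUnit ((blockScalar hd h0 Y j)⁻¹ • corner d k Y) := fun {j k} =>
    (hu k).smul (Units.mk0 _ (inv_ne_zero (hne j)))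
  -- At each arrow, `1 + βα` and the preceding `1 + αβ` are the same corner divided by two
  -- consecutive diagonal scalars, whence this ratio.
  refine ⟨fun i => ⟨?_, ?_⟩, ⟨fun i => blockScalar hd h0 Y i.castSucc / blockScalar hd h0 Y i.succ,
    fun i => ?_⟩, fun i => stdMat_surjective (le_succ hd i)⟩
  · have := hinc i.succ
    simp only [incoming, Fin.cases_succ] at this
    rw [this]
    exact hsm
  · rw [beta_mul_alpha_stdQuiver]
    exact hsm
  · beta_reduce
    rw [beta_mul_alpha_stdQuiver, hinc, smul_smul, div_eq_inv_mul, mul_assoc,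
      mul_inv_cancel₀ (hne _), mul_one]

theorem lastY_stdQuiver (hd : StrictMono d) (h0 : 0 < d 0)
    {Y : Mat (d (Fin.last m))} (hY : Y ∈ scalarBlock d) : lastY (stdQuiver hd h0 Y) = Y := by
  obtain ⟨h1, hne, hY⟩ := (mem_scalarBlock_iff hd h0).1 hY
  rw [lastY, one_add_incoming_stdQuiver hd h0 hY hne, h1, corner_last, inv_one, one_smul]

theorem bijOn_lastY (hd : StrictMono d) (h0 : 0 < d 0) :
    Set.BijOn lastY {x | x ∈ surjSol d ∧ IsStandard x} (scalarBlock d) :=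
  ⟨fun _ hx => lastY_mem_scalarBlock hd h0 hx.1 hx.2,
    fun x hx y hy hxy => by
      rw [← stdQuiver_lastY hd h0 hx.1 hx.2, ← stdQuiver_lastY hd h0 hy.1 hy.2, hxy],
    fun Y hY => ⟨stdQuiver hd h0 Y, ⟨stdQuiver_mem_surjSol hd h0 hY, isStandard_stdQuiver hd h0 Y⟩,
      lastY_stdQuiver hd h0 hY⟩⟩

end Standard

/-! ## The invariants -/

section Forms

/-- The alternating form `v ↦ det (M v₁, …, M v_a)`, whose coefficients are the maximal minors
of `M`. -/
def minorForm {a n : ℕ} (M : Matrix (Fin a) (Fin n) ℂ) : (Fin n → ℂ) [⋀^Fin a]→ₗ[ℂ] ℂ :=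
  detRowAlternating.compLinearMap M.mulVecLin

theorem minorForm_apply {a n : ℕ} (M : Matrix (Fin a) (Fin n) ℂ) (v : Fin a → Fin n → ℂ) :
    minorForm M v = (of fun i => M *ᵥ v i).det := rfl

theorem minorForm_mul {a n : ℕ} (A : Mat a) (M : Matrix (Fin a) (Fin n) ℂ) :
    minorForm (A * M) = A.det • minorForm M := by
  ext v
  rw [AlternatingMap.smul_apply, minorForm_apply, minorForm_apply, smul_eq_mul, mul_comm,
    ← det_transpose A, ← det_mul]
  congr 1
  ext i j
  rw [of_apply, ← mulVec_mulVec, mul_apply]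
  simp only [mulVec, dotProduct, of_apply, transpose_apply, mul_comm]

theorem minorForm_frame {a n : ℕ} (M : Matrix (Fin a) (Fin n) ℂ) (g : Mat n) (t : Fin a → Fin n) :
    minorForm M (fun i => g *ᵥ Pi.single (t i) 1) = ((M * g).submatrix id t).det := by
  rw [minorForm_apply, ← det_transpose]
  congr 1
  ext i j
  simp only [transpose_apply, of_apply, submatrix_apply, mulVec_single_one, id]
  rfl

/-- Cramer's rule. It lets the inverse of a square block times the whole matrix be written in minors
alone, hence in terms of the invariants. -/
theorem det_submatrix_update {a n : ℕ} (M : Matrix (Fin a) (Fin n) ℂ) (t : Fin a → Fin n)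
    (r : Fin a) (b : Fin n) : (M.submatrix id (Function.update t r b)).det =
      ((M.submatrix id t).adjugate * M) r b := by
  have h : M.submatrix id (Function.update t r b) =
      (M.submatrix id t).updateCol r (fun i => M i b) := by
    ext i j
    by_cases hj : j = r
    · subst hj; simp
    · simp [hj]
  rw [h, ← cramer_apply, cramer_eq_adjugate_mulVec]
  rfl

instance finite_alternating (a n : ℕ) : Module.Finite ℂ ((Fin n → ℂ) [⋀^Fin a]→ₗ[ℂ] ℂ) := by
  refine Module.Finite.of_injective (AlternatingMap.toMultilinearMapLM (R := ℂ) (S := ℂ)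
    (M := Fin n → ℂ) (N := ℂ) (ι := Fin a)) AlternatingMap.coe_multilinearMap_injective

/-- An alternating form is determined by its values on tuples of basis vectors, here minors. A
linear left inverse of this injective evaluation carries regularity back to the form. -/
theorem isRegularMap_minorForm {V : Type*} [AddCommGroup V] [Module ℂ V] {a n : ℕ} {U : Set V}
    {M : V → Matrix (Fin a) (Fin n) ℂ} (hM : IsRegularMap M U) :
    IsRegularMap (fun v => minorForm (M v)) U := by
  let ev : ((Fin n → ℂ) [⋀^Fin a]→ₗ[ℂ] ℂ) →ₗ[ℂ] ((Fin a → Fin n) → ℂ) :=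
    { toFun := fun ω t => ω fun i => (1 : Mat n) *ᵥ Pi.single (t i) 1
      map_add' := fun _ _ => rfl
      map_smul' := fun _ _ => rfl }
  have hev : LinearMap.ker ev = ⊥ := by
    rw [LinearMap.ker_eq_bot]
    intro ω ω' h
    refine Module.Basis.ext_alternating (Pi.basisFun ℂ (Fin n)) fun t _ => ?_
    have ht : (ω fun i => (1 : Mat n) *ᵥ Pi.single (t i) 1) =
      ω' fun i => (1 : Mat n) *ᵥ Pi.single (t i) 1 := congrFun h t
    simpa only [one_mulVec, Pi.basisFun_apply] using ht
  obtain ⟨L, hL⟩ := ev.exists_leftInverse_of_injective hev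
  have hreg : IsRegularMap (fun v => ev (minorForm (M v))) U :=
    IsRegularMap.pi fun t => .of_regularOn <| by
      refine (IsRegularOn.det (M := fun v => (M v).submatrix id t)
        fun i j => hM.entry i (t j)).congr fun v _ => ?_
      change minorForm (M v) (fun i => (1 : Mat n) *ᵥ Pi.single (t i) 1) = _
      rw [minorForm_frame, Matrix.mul_one]
  refine (hreg.linear_comp L).congr fun v _ => ?_
  exact (LinearMap.congr_fun hL (minorForm (M v))).symm

end Forms

/-! ### The normal form computed from minors -/

section NormalForm

variable {m : ℕ} {d : Fin (m + 1) → ℕ}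

variable (d) in
/-- The space in which the invariants take their values. -/
abbrev InvSpace : Type :=
  Mat (d (Fin.last m)) × ∀ j : Fin (m + 1), (Fin (d (Fin.last m)) → ℂ) [⋀^Fin (d j)]→ₗ[ℂ] ℂ

/-- The value of the form with index `j` at the columns of `g` with indices `t`. -/
def coeff (g : Mat (d (Fin.last m))) (j : Fin (m + 1)) (t : Fin (d j) → Fin (d (Fin.last m))) :
    Module.Dual ℂ (InvSpace d) where
  toFun z := z.2 j fun i => g *ᵥ Pi.single (t i) 1
  map_add' _ _ := rfl
  map_smul' _ _ := rfl

/-- The value of the form with index `j` at the last `d j` columns of `g`. -/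
def leadCoeff (hd : StrictMono d) (g : Mat (d (Fin.last m))) (j : Fin (m + 1)) :
    Module.Dual ℂ (InvSpace d) := coeff g j (emb (le_last hd j))

/-- Quotients of successive leading coefficients. -/
def leadRatio (hd : StrictMono d) (g : Mat (d (Fin.last m))) (z : InvSpace d) :
    Fin (m + 1) → ℂ :=
  Fin.cases (leadCoeff hd g 0 z) fun i => leadCoeff hd g i.succ z / leadCoeff hd g i.castSucc z

/-- The scale of the row `r` of the normal form. -/
def rowScale (hd : StrictMono d) (h0 : 0 < d 0) (g : Mat (d (Fin.last m))) (z : InvSpace d)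
    (r : Fin (d (Fin.last m))) : ℂ :=
  ∏ j, if r = topRow hd h0 j then leadRatio hd g z j else 1

/-- The position of the row `r` among the last `d (level r)` rows. -/
def posInBlock (hd : StrictMono d) (r : Fin (d (Fin.last m))) : Fin (d (level r)) :=
  (exists_emb_eq (le_last hd (level r)) (rev_lt_level hd r)).choose

theorem emb_posInBlock (hd : StrictMono d) (r : Fin (d (Fin.last m))) :
    emb (le_last hd (level r)) (posInBlock hd r) = r :=
  (exists_emb_eq (le_last hd (level r)) (rev_lt_level hd r)).choose_spec

/-- A block lower triangular representative, with respect to the basis given by the columns of `g`,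
of the class of matrices with given minors. -/
def normalMat (hd : StrictMono d) (h0 : 0 < d 0) (g : Mat (d (Fin.last m))) (z : InvSpace d) :
    Mat (d (Fin.last m)) := of fun r b =>
  rowScale hd h0 g z r * ((leadCoeff hd g (level r) z)⁻¹ *
    coeff g (level r) (Function.update (emb (le_last hd (level r))) (posInBlock hd r) b) z)

theorem prod_leadRatio (hd : StrictMono d) {g : Mat (d (Fin.last m))} {z : InvSpace d}
    (hz : ∀ j, leadCoeff hd g j z ≠ 0) (j : Fin (m + 1)) :
    ∏ i ∈ Finset.univ.filter (fun i => i ≤ j), leadRatio hd g z i = leadCoeff hd g j z := by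
  induction j using Fin.induction with
  | zero =>
    have : (Finset.univ.filter fun i : Fin (m + 1) => i ≤ 0) = {0} := by
      ext i; simp
    rw [this, Finset.prod_singleton]
    rfl
  | succ i ih =>
    have : (Finset.univ.filter fun k => k ≤ i.succ) =
        insert i.succ (Finset.univ.filter fun k => k ≤ i.castSucc) := by
      ext k
      simp only [Finset.mem_filter, Finset.mem_insert, Finset.mem_univ, true_and, Fin.ext_iff,
        Fin.le_def, Fin.val_castSucc, Fin.val_succ]
      omega
    rw [this, Finset.prod_insert (by simp [Fin.le_def]), ih]
    exact div_mul_cancel₀ _ (hz _)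

/-- The scale is one except in the top row of each block, where it is a ratio of successive leading
coefficients; the product telescopes. This choice makes the corners of the normal form have the
prescribed determinants. -/
theorem prod_rowScale (hd : StrictMono d) (h0 : 0 < d 0) {g : Mat (d (Fin.last m))}
    {z : InvSpace d} (hz : ∀ j, leadCoeff hd g j z ≠ 0) (j : Fin (m + 1)) :
    ∏ a, rowScale hd h0 g z (emb (le_last hd j) a) = leadCoeff hd g j z := by
  simp only [rowScale]
  rw [Finset.prod_comm, ← prod_leadRatio hd hz, Finset.prod_filter]
  refine Finset.prod_congr rfl fun i _ => ?_
  split_ifs with hij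
  · obtain ⟨a, ha⟩ := exists_emb_eq (le_last hd j) (j := topRow hd h0 i)
      ((rev_lt_iff_level_le hd _ _).2 (by rwa [level_topRow]))
    rw [← ha]
    simp only [(emb_injective (le_last hd j)).eq_iff]
    simp
  · refine Finset.prod_eq_one fun a _ => if_neg fun h => hij ?_
    rw [← level_topRow hd h0 i, ← h, ← rev_lt_iff_level_le hd, emb_rev]
    exact a.rev.2

/-- The forms determined by the last rows of `k`. -/
def flagForms (d : Fin (m + 1) → ℕ) (k : Mat (d (Fin.last m))) (j : Fin (m + 1)) :
    (Fin (d (Fin.last m)) → ℂ) [⋀^Fin (d j)]→ₗ[ℂ] ℂ :=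
  minorForm (stdMat (d j) (d (Fin.last m)) * k)

theorem coeff_flagForms (g k Y : Mat (d (Fin.last m))) (j : Fin (m + 1))
    (t : Fin (d j) → Fin (d (Fin.last m))) : coeff g j t (Y, flagForms d k) =
      ((stdMat (d j) (d (Fin.last m)) * (k * g)).submatrix id t).det := by
  rw [← Matrix.mul_assoc, ← minorForm_frame]
  rfl

theorem leadCoeff_flagForms (hd : StrictMono d) (g k Y : Mat (d (Fin.last m)))
    (j : Fin (m + 1)) : leadCoeff hd g j (Y, flagForms d k) = (corner d j (k * g)).det := by
  rw [leadCoeff, coeff_flagForms, corner, mul_stdMat_transpose (le_last hd j)]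

/-- The block upper triangular factor between a matrix and its normal form. -/
theorem exists_normalMat_eq (hd : StrictMono d) (h0 : 0 < d 0) (g k : SLC (d (Fin.last m)))
    (Y : Mat (d (Fin.last m)))
    (hz : ∀ j, leadCoeff hd (g : Mat (d (Fin.last m))) j (Y, flagForms d k) ≠ 0) :
    ∃ p ∈ unimodularParabolic hd,
      normalMat hd h0 (g : Mat (d (Fin.last m))) (Y, flagForms d k) = ((p * (k * g) : SLC _) :
        Mat (d (Fin.last m))) := by
  set z : InvSpace d := (Y, flagForms d k) with hzdef
  set K : Mat (d (Fin.last m)) := (k : Mat (d (Fin.last m))) * (g : Mat (d (Fin.last m))) with hK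
  have hlead : ∀ j, leadCoeff hd (g : Mat (d (Fin.last m))) j z = (corner d j K).det := fun j =>
    leadCoeff_flagForms hd _ _ _ j
  let R := fun j => stdMat (d j) (d (Fin.last m))
  -- Up to the row scale, row `r` of `T` is a row of the inverse of the corner of `K` at `level r`,
  -- extended by zero. In `T * K` it therefore becomes a row of the identity in the columns of that
  -- corner.
  let T : Mat (d (Fin.last m)) := of fun r s =>
    rowScale hd h0 (g : Mat (d (Fin.last m))) z r * ((leadCoeff hd (g : Mat (d (Fin.last m)))
      (level r) z)⁻¹ * ((corner d (level r) K).adjugate * R (level r)) (posInBlock hd r) s)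
  have hN : ∀ r b, normalMat hd h0 (g : Mat (d (Fin.last m))) z r b =
      rowScale hd h0 (g : Mat (d (Fin.last m))) z r * ((leadCoeff hd (g : Mat (d (Fin.last m)))
        (level r) z)⁻¹ * ((corner d (level r) K).adjugate * (R (level r) * K))
          (posInBlock hd r) b) := fun r b => by
    rw [normalMat, of_apply]
    congr 2
    rw [hzdef, coeff_flagForms, det_submatrix_update, corner,
      mul_stdMat_transpose (le_last hd (level r))]
  have hTK : normalMat hd h0 (g : Mat (d (Fin.last m))) z = T * K := by
    ext r b
    rw [hN, ← Matrix.mul_assoc, mul_apply, mul_apply, Finset.mul_sum, Finset.mul_sum]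
    refine Finset.sum_congr rfl fun s _ => ?_
    simp only [T, of_apply]
    ring
  have hTtri : T.BlockTriangular (blockIdx d) := fun r s hrs => by
    have hlt : level r < level s := by
      rw [← not_le, ← blockIdx_le_iff, not_le]; exact hrs
    simp only [T, of_apply]
    rw [mul_stdMat_apply_of_le (le_last hd _), mul_zero, mul_zero]
    rw [← not_lt, rev_lt_iff_level_le hd, not_le]
    exact hlt
  have hNtri : ∀ r s, level s ≤ level r → normalMat hd h0 (g : Mat (d (Fin.last m))) z r s =
      if r = s then rowScale hd h0 (g : Mat (d (Fin.last m))) z r else 0 := fun r s hrs => by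
    obtain ⟨s', hs'⟩ := exists_emb_eq (le_last hd (level r)) ((rev_lt_iff_level_le hd s _).2 hrs)
    have h1 : ((corner d (level r) K).adjugate * (R (level r) * K)) (posInBlock hd r) s =
        ((corner d (level r) K).adjugate * corner d (level r) K) (posInBlock hd r) s' := by
      rw [mul_apply, mul_apply]
      refine Finset.sum_congr rfl fun i _ => ?_
      rw [corner_apply hd, hs']
      simp only [R]
      rw [stdMat_mul (le_last hd _)]
      rfl
    rw [hN, h1, adjugate_mul, Matrix.smul_apply, smul_eq_mul, ← hlead, inv_mul_cancel_left₀ (hz _),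
      one_apply]
    have : posInBlock hd r = s' ↔ r = s := by
      rw [← (emb_injective (le_last hd (level r))).eq_iff, emb_posInBlock, hs']
    simp only [this]
    split_ifs <;> simp
  have hdet : ∀ j, (corner d j (normalMat hd h0 (g : Mat (d (Fin.last m))) z)).det =
      leadCoeff hd (g : Mat (d (Fin.last m))) j z := fun j => by
    rw [det_of_isLowerTriangular _ fun a b hab => ?_]
    · rw [← prod_rowScale hd h0 hz]
      refine Finset.prod_congr rfl fun a _ => ?_
      rw [corner_apply hd, hNtri _ _ le_rfl, if_pos rfl]
    · have hlt : emb (le_last hd j) a < emb (le_last hd j) b := by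
        have hab' : a < b := hab
        simp only [emb, Fin.lt_def] at hab' ⊢
        omega
      rw [corner_apply hd, hNtri _ _ (level_anti hd hlt.le), if_neg hlt.ne]
  -- The corners of `T * K` and of `K` have the same determinant, the leading coefficient, which can
  -- be cancelled.
  have hTdet : ∀ j, (corner d j T).det = 1 := fun j => by
    have h := hdet j
    rw [hTK, corner_mul hd hTtri, det_mul, ← hlead] at h
    exact mul_right_cancel₀ (hz j) (h.trans (one_mul _).symm)
  have hT1 : T.det = 1 := by
    have := hTdet (Fin.last m)
    rwa [corner_last] at this
  refine ⟨⟨T, hT1⟩, ⟨hTtri, hTdet⟩, ?_⟩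
  rw [hTK]
  rfl

end NormalForm

/-! ## The quotient `SL ×_S F` -/

section Twisted

variable {m : ℕ} {d : Fin (m + 1) → ℕ}

variable (d) in
/-- The invariants of a pair of matrices. -/
def twistInv (z : Mat (d (Fin.last m)) × Mat (d (Fin.last m))) : InvSpace d :=
  (z.1 * z.2 * z.1.adjugate, flagForms d z.1.adjugate)

theorem twistInv_coe (g : SLC (d (Fin.last m))) (v : Mat (d (Fin.last m))) :
    twistInv d ((g : Mat (d (Fin.last m))), v) =
      ((g : Mat (d (Fin.last m))) * v * ((g⁻¹ : SLC _) : Mat (d (Fin.last m))),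
        flagForms d ((g⁻¹ : SLC _) : Mat (d (Fin.last m)))) := by
  rw [twistInv, Matrix.SpecialLinearGroup.coe_inv]

theorem flagForms_mul (hd : StrictMono d) {p : SLC (d (Fin.last m))}
    (hp : p ∈ unimodularParabolic hd) (k : Mat (d (Fin.last m))) :
    flagForms d ((p : Mat (d (Fin.last m))) * k) = flagForms d k := by
  ext1 j
  rw [flagForms, ← Matrix.mul_assoc, stdMat_mul_of_blockTriangular hd hp.1, Matrix.mul_assoc,
    minorForm_mul, hp.2, one_smul, flagForms]

theorem twistInv_twist (hd : StrictMono d) {p : SLC (d (Fin.last m))}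
    (hp : p ∈ unimodularParabolic hd) (g : SLC (d (Fin.last m))) (v : Mat (d (Fin.last m))) :
    twistInv d (((g * p⁻¹ : SLC _) : Mat (d (Fin.last m))),
      (p : Mat (d (Fin.last m))) * v * ((p⁻¹ : SLC _) : Mat (d (Fin.last m)))) =
      twistInv d ((g : Mat (d (Fin.last m))), v) := by
  rw [twistInv_coe, twistInv_coe, _root_.mul_inv_rev, inv_inv, Matrix.SpecialLinearGroup.coe_mul,
    Matrix.SpecialLinearGroup.coe_mul, flagForms_mul hd hp]
  simp only [Matrix.mul_assoc, coe_inv_mul_cancel_left]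

theorem leadCoeff_twistInv_self (hd : StrictMono d) (g : SLC (d (Fin.last m)))
    (v : Mat (d (Fin.last m))) (j : Fin (m + 1)) :
    leadCoeff hd (g : Mat (d (Fin.last m))) j (twistInv d ((g : Mat (d (Fin.last m))), v)) = 1 := by
  rw [twistInv_coe, leadCoeff_flagForms, coe_inv_mul_coe, corner_one hd, det_one]

/-- In the chart of `g` itself all leading coefficients are one, so the normal form applies to both
pairs. It depends only on the forms, which gives `p g⁻¹ g = p' g'⁻¹ g` and hence the element
relating `g` and `g'`; the conjugated matrix then determines `v'`. -/
theorem exists_of_twistInv_eq (hd : StrictMono d) (h0 : 0 < d 0) {g g' : SLC (d (Fin.last m))}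
    {v v' : Mat (d (Fin.last m))} (h : twistInv d ((g : Mat (d (Fin.last m))), v) =
      twistInv d ((g' : Mat (d (Fin.last m))), v')) :
    ∃ p ∈ unimodularParabolic hd, g * p⁻¹ = g' ∧
      (p : Mat (d (Fin.last m))) * v * ((p⁻¹ : SLC _) : Mat (d (Fin.last m))) = v' := by
  have hlead := leadCoeff_twistInv_self hd g v
  have hlead' := hlead
  rw [h] at hlead'
  rw [twistInv_coe] at hlead hlead' h
  rw [twistInv_coe] at h
  obtain ⟨p, hp, hpN⟩ := exists_normalMat_eq hd h0 g g⁻¹ _ fun j => by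
    rw [hlead]; exact one_ne_zero
  obtain ⟨p', hp', hpN'⟩ := exists_normalMat_eq hd h0 g g'⁻¹ _ fun j => by
    rw [hlead']; exact one_ne_zero
  rw [← h, hpN] at hpN'
  have heq : p * (g⁻¹ * g) = p' * (g'⁻¹ * g) := Subtype.ext hpN'
  have hg' : g' = g * (p'⁻¹ * p)⁻¹ := by
    have : g'⁻¹ = p'⁻¹ * p * g⁻¹ := by
      rw [← mul_assoc, ← mul_assoc, mul_left_inj, ← eq_inv_mul_iff_mul_eq] at heq
      rw [mul_assoc, heq]
      group
    rw [← inv_inv g', this]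
    group
  refine ⟨p'⁻¹ * p, mul_mem (inv_mem hp') hp, hg'.symm, ?_⟩
  have h1 := congrArg Prod.fst h
  simp only at h1
  have hP : (p'⁻¹ * p : SLC (d (Fin.last m))) = g'⁻¹ * g := by rw [hg']; group
  have hP' : (p'⁻¹ * p : SLC (d (Fin.last m)))⁻¹ = g⁻¹ * g' := by rw [hP]; group
  rw [hP', hP, Matrix.SpecialLinearGroup.coe_mul, Matrix.SpecialLinearGroup.coe_mul]
  calc _ = ((g'⁻¹ : SLC _) : Mat (d (Fin.last m))) * ((g : Mat (d (Fin.last m))) * v *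
          ((g⁻¹ : SLC _) : Mat (d (Fin.last m)))) * (g' : Mat (d (Fin.last m))) := by
        simp only [Matrix.mul_assoc]
    _ = v' := by
        rw [h1]
        simp only [Matrix.mul_assoc, coe_inv_mul_cancel_left, coe_inv_mul_coe, Matrix.mul_one]

/-- The chart of the quotient attached to `g`. -/
def chart (hd : StrictMono d) (g : Mat (d (Fin.last m))) (z : InvSpace d) : ℂ :=
  ∏ j, leadCoeff hd g j z

/-- The section over the chart attached to `g`. -/
def chartSection (hd : StrictMono d) (h0 : 0 < d 0) (g : Mat (d (Fin.last m))) (z : InvSpace d) :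
    Mat (d (Fin.last m)) × Mat (d (Fin.last m)) :=
  ((normalMat hd h0 g z * g.adjugate).adjugate,
    normalMat hd h0 g z * g.adjugate * z.1 * (normalMat hd h0 g z * g.adjugate).adjugate)

theorem chart_mem_polyFun (hd : StrictMono d) (g : Mat (d (Fin.last m))) :
    chart hd g ∈ polyFun (InvSpace d) := polyFun_prod _ fun _ _ => dual_mem_polyFun _

theorem chart_ne_zero_iff {hd : StrictMono d} {g : Mat (d (Fin.last m))} {z : InvSpace d} :
    chart hd g z ≠ 0 ↔ ∀ j, leadCoeff hd g j z ≠ 0 := by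
  simp [chart, Finset.prod_ne_zero_iff]

theorem isRegularMap_chartSection (hd : StrictMono d) (h0 : 0 < d 0) (g : Mat (d (Fin.last m))) :
    IsRegularMap (chartSection hd h0 g) {z | chart hd g z ≠ 0} := by
  have hne : ∀ j, ∀ z ∈ {z | chart hd g z ≠ 0}, leadCoeff hd g j z ≠ 0 := fun j z hz =>
    chart_ne_zero_iff.1 hz j
  have hN : IsRegularMap (normalMat hd h0 g) {z | chart hd g z ≠ 0} :=
    IsRegularMap.matrix fun r b => by
      refine IsRegularOn.mul (IsRegularOn.prod _ fun j _ => ?_)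
        (((IsRegularOn.dual _ _).inv (hne _)).mul (IsRegularOn.dual _ _))
      split_ifs
      · cases j using Fin.cases with
        | zero => exact IsRegularOn.dual _ _
        | succ i => exact (IsRegularOn.dual _ _).div (IsRegularOn.dual _ _) (hne _)
      · exact IsRegularOn.const _ _
  have hH := hN.matMul (IsRegularMap.const g.adjugate _)
  exact hH.adjugate.prodMk ((hH.matMul (IsRegularMap.id _).fst).matMul hH.adjugate)

variable {F : Set (Mat (d (Fin.last m)))}

theorem exists_coe_of_mem_slProd {n : ℕ} {F : Set (Mat n)} {z : Mat n × Mat n}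
    (hz : z ∈ slProd F) : ∃ g : SLC n, ∃ v ∈ F, z = ((g : Mat n), v) :=
  ⟨⟨z.1, hz.1⟩, z.2, hz.2, rfl⟩

theorem coe_mem_slProd {n : ℕ} {F : Set (Mat n)} (g : SLC n) {v : Mat n} (hv : v ∈ F) :
    ((g : Mat n), v) ∈ slProd F := ⟨g.det_coe, hv⟩

/-- Applied to the invariants of `(k, v)`, the section returns a point `(k p⁻¹, p v p⁻¹)` of the
same orbit, with `p` the factor between `k⁻¹ g` and its normal form. -/
theorem isLocalSection_chart (hd : StrictMono d) (h0 : 0 < d 0)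
    (hF : ∀ p ∈ unimodularParabolic hd, ∀ v ∈ F,
      (p : Mat (d (Fin.last m))) * v * ((p⁻¹ : SLC _) : Mat (d (Fin.last m))) ∈ F)
    (g : SLC (d (Fin.last m))) :
    IsLocalSection (slProd F) (twistInv d) (chart hd (g : Mat (d (Fin.last m))))
      (chartSection hd h0 (g : Mat (d (Fin.last m)))) := by
  have key : ∀ (k : SLC (d (Fin.last m))), ∀ v ∈ F,
      chart hd (g : Mat (d (Fin.last m))) (twistInv d ((k : Mat (d (Fin.last m))), v)) ≠ 0 →
      ∃ p ∈ unimodularParabolic hd,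
        chartSection hd h0 (g : Mat (d (Fin.last m))) (twistInv d ((k : Mat (d (Fin.last m))), v)) =
          (((k * p⁻¹ : SLC _) : Mat (d (Fin.last m))),
            (p : Mat (d (Fin.last m))) * v * ((p⁻¹ : SLC _) : Mat (d (Fin.last m)))) := by
    intro k v _ hc
    rw [chart_ne_zero_iff] at hc
    rw [twistInv_coe] at hc ⊢
    obtain ⟨p, hp, hpN⟩ := exists_normalMat_eq hd h0 g k⁻¹ _ hc
    refine ⟨p, hp, ?_⟩
    have hH : normalMat hd h0 (g : Mat (d (Fin.last m)))
        ((k : Mat (d (Fin.last m))) * v * ((k⁻¹ : SLC _) : Mat (d (Fin.last m))),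
          flagForms d ((k⁻¹ : SLC _) : Mat (d (Fin.last m)))) *
        (g : Mat (d (Fin.last m))).adjugate = ((p * k⁻¹ : SLC _) : Mat (d (Fin.last m))) := by
      rw [hpN, ← Matrix.SpecialLinearGroup.coe_inv, ← Matrix.SpecialLinearGroup.coe_mul]
      simp only [mul_assoc, mul_inv_cancel, mul_one]
    rw [chartSection, hH, ← Matrix.SpecialLinearGroup.coe_inv, _root_.mul_inv_rev, inv_inv]
    refine Prod.ext rfl ?_
    simp only [Matrix.SpecialLinearGroup.coe_mul, Matrix.mul_assoc, coe_inv_mul_cancel_left]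
  refine ⟨chart_mem_polyFun hd _, (isRegularMap_chartSection hd h0 _).mono Set.inter_subset_right,
    ?_, ?_⟩
  · rintro _ ⟨x, hx, rfl⟩ hc
    obtain ⟨k, v, hv, rfl⟩ := exists_coe_of_mem_slProd hx
    obtain ⟨p, hp, h⟩ := key k v hv hc
    rw [h]
    exact coe_mem_slProd _ (hF p hp v hv)
  · rintro _ ⟨x, hx, rfl⟩ hc
    obtain ⟨k, v, hv, rfl⟩ := exists_coe_of_mem_slProd hx
    obtain ⟨p, hp, h⟩ := key k v hv hc
    rw [h, twistInv_twist hd hp]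

theorem exists_section_twistInv (hd : StrictMono d) (h0 : 0 < d 0)
    (hF : ∀ p ∈ unimodularParabolic hd, ∀ v ∈ F,
      (p : Mat (d (Fin.last m))) * v * ((p⁻¹ : SLC _) : Mat (d (Fin.last m))) ∈ F) :
    ∀ z ∈ twistInv d '' slProd F, ∃ c σ, c z ≠ 0 ∧ IsLocalSection (slProd F) (twistInv d) c σ ∧
      IsRegularMap σ {w | c w ≠ 0} := by
  rintro _ ⟨x, hx, rfl⟩
  obtain ⟨g, v, hv, rfl⟩ := exists_coe_of_mem_slProd hx
  refine ⟨_, _, ?_, isLocalSection_chart hd h0 hF g, isRegularMap_chartSection hd h0 _⟩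
  rw [chart_ne_zero_iff]
  intro j
  rw [leadCoeff_twistInv_self]
  exact one_ne_zero

theorem isRegularMap_twistInv (U : Set (Mat (d (Fin.last m)) × Mat (d (Fin.last m)))) :
    IsRegularMap (twistInv d) U := by
  have h1 := (IsRegularMap.id U).fst
  have h2 := (IsRegularMap.id U).snd
  exact ((h1.matMul h2).matMul h1.adjugate).prodMk (IsRegularMap.pi fun j =>
    isRegularMap_minorForm ((IsRegularMap.const _ U).matMul h1.adjugate))

theorem twistInv_eq_iff (hd : StrictMono d) (h0 : 0 < d 0) {S : Subgroup (SLC (d (Fin.last m)))}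
    (hS : S = unimodularParabolic hd) :
    ∀ x ∈ slProd F, ∀ y ∈ slProd F, twistInv d x = twistInv d y ↔ ∃ p : S, twist S p x = y := by
  subst hS
  intro x hx y hy
  obtain ⟨g, v, hv, rfl⟩ := exists_coe_of_mem_slProd hx
  obtain ⟨g', v', hv', rfl⟩ := exists_coe_of_mem_slProd hy
  constructor
  · intro h
    obtain ⟨p, hp, hg, hv⟩ := exists_of_twistInv_eq hd h0 h
    exact ⟨⟨p, hp⟩, by rw [twist, ← hg, ← hv, Matrix.SpecialLinearGroup.coe_mul]⟩
  · rintro ⟨⟨p, hp⟩, h⟩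
    rw [← h, twist, ← Matrix.SpecialLinearGroup.coe_mul, twistInv_twist hd hp]

end Twisted

/-! ## Transfer of quotients -/

section Transfer

variable {V V' W : Type*} [AddCommGroup V] [Module ℂ V] [AddCommGroup V'] [Module ℂ V']
  [AddCommGroup W] [Module ℂ W]

/-- A regular map `φ : X → X'` meeting all orbits and identifying the fibres of `π` with orbits
turns
a quotient of `X` with local sections into a quotient of `X'`. -/
theorem isGeometricQuotient_transfer {G : Type*} [Group G] {act' : G → V' → V'} {X : Set V}
    {X' : Set V'} {π : V → W} {π' : V' → W} {φ : V → V'} (hZ : IsQuasiAffine (π '' X))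
    (hσ : ∀ z ∈ π '' X, ∃ c σ, c z ≠ 0 ∧ IsLocalSection X π c σ) (hX' : IsQuasiAffine X')
    (hmul : ∀ g h : G, ∀ x, act' (g * h) x = act' g (act' h x)) (hone : ∀ x, act' 1 x = x)
    (hstable : ∀ g : G, ∀ x ∈ X', act' g x ∈ X') (hπ' : IsRegularMap π' X')
    (hinv : ∀ g : G, ∀ x ∈ X', π' (act' g x) = π' x) (hφ : IsRegularMap φ X)
    (hmaps : Set.MapsTo φ X X') (hcomp : ∀ u ∈ X, π' (φ u) = π u)
    (hmeet : ∀ x ∈ X', ∃ u ∈ X, ∃ g, act' g (φ u) = x)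
    (hfib : ∀ u ∈ X, ∀ u' ∈ X, π u = π u' → ∃ g, act' g (φ u) = φ u') :
    IsGeometricQuotient act' X' (π '' X) π' := by
  have himg : π' '' X' = π '' X := by
    apply Set.Subset.antisymm
    · rintro _ ⟨x, hx, rfl⟩
      obtain ⟨u, hu, g, rfl⟩ := hmeet x hx
      exact ⟨u, hu, by rw [hinv g _ (hmaps hu), hcomp u hu]⟩
    · rintro _ ⟨u, hu, rfl⟩
      exact ⟨φ u, hmaps hu, hcomp u hu⟩
  rw [← himg] at hZ ⊢
  refine isGeometricQuotient_of_sections hX' hstable hπ' (fun x hx y hy => ⟨fun h => ?_, ?_⟩) hZ ?_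
  · obtain ⟨u, hu, g, rfl⟩ := hmeet x hx
    obtain ⟨u', hu', g', rfl⟩ := hmeet y hy
    rw [hinv g _ (hmaps hu), hinv g' _ (hmaps hu'), hcomp u hu, hcomp u' hu'] at h
    obtain ⟨k, hk⟩ := hfib u hu u' hu' h
    exact ⟨g' * k * g⁻¹, by rw [hmul, hmul, ← hmul g⁻¹, inv_mul_cancel, hone, hk]⟩
  · rintro ⟨g, rfl⟩
    exact (hinv g x hx).symm
  · rw [himg]
    intro z hz
    obtain ⟨c, σ, hc, h⟩ := hσ z hz
    exact ⟨c, _, hc, h.comp_map hφ hmaps hcomp himg⟩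

/-- A matrix of polynomial functions. -/
def IsPolyMat {I J : Type*} (M : V → Matrix I J ℂ) : Prop :=
  ∀ i j, (fun v => M v i j) ∈ polyFun V

theorem IsPolyMat.mul {I J K : Type*} [Fintype K] {M : V → Matrix I K ℂ} {N : V → Matrix K J ℂ}
    (hM : IsPolyMat M) (hN : IsPolyMat N) : IsPolyMat fun v => M v * N v := fun i j => by
  have h : (∑ k, (fun v => M v i k * N v k j)) ∈ polyFun V :=
    sum_mem fun k _ => polyFun_mul (hM i k) (hN k j)
  convert h using 1
  ext v
  simp only [mul_apply, Finset.sum_apply]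

theorem IsPolyMat.add {I J : Type*} {M N : V → Matrix I J ℂ}
    (hM : IsPolyMat M) (hN : IsPolyMat N) : IsPolyMat fun v => M v + N v := fun i j =>
  polyFun_add (hM i j) (hN i j)

theorem IsPolyMat.const {I J : Type*} (M : Matrix I J ℂ) : IsPolyMat fun _ : V => M := fun i j =>
  const_mem_polyFun (M i j)

theorem IsPolyMat.det {N : Type*} [Fintype N] [DecidableEq N] {M : V → Matrix N N ℂ}
    (hM : IsPolyMat M) : (fun v => (M v).det) ∈ polyFun V := by
  have h : (∑ σ : Equiv.Perm N, fun v => ((Equiv.Perm.sign σ : ℤ) : ℂ) * ∏ i, M v (σ i) i) ∈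
      polyFun V :=
    sum_mem fun σ _ => polyFun_mul (const_mem_polyFun _) (polyFun_prod _ fun i _ => hM _ _)
  convert h using 1
  ext v
  rw [det_apply', Finset.sum_apply]

theorem polyFun_sub {a b : V → ℂ} (ha : a ∈ polyFun V) (hb : b ∈ polyFun V) :
    (fun v => a v - b v) ∈ polyFun V := sub_mem ha hb

theorem isPolyMat_id {I J : Type*} : IsPolyMat fun M : Matrix I J ℂ => M := fun i j =>
  dual_mem_polyFun ((LinearMap.proj j : (J → ℂ) →ₗ[ℂ] ℂ) ∘ₗ
    (LinearMap.proj i : (I → J → ℂ) →ₗ[ℂ] J → ℂ))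

theorem isQuasiAffine_slProd {n : ℕ} {F : Set (Mat n)} (hF : IsQuasiAffine F) :
    IsQuasiAffine (slProd F) := by
  rw [isQuasiAffine_iff] at hF ⊢
  rintro z ⟨hz1, hz2⟩
  obtain ⟨c, hc, hcz, hs⟩ := hF _ hz2
  refine ⟨_, polyFun_comp_linear hc (LinearMap.snd ℂ (Mat n) (Mat n)), hcz, fun w hw hcw => ?_⟩
  by_cases h : w.1.det = 1
  · obtain ⟨e, he, hew, he0⟩ := hs w.2 (fun h' => hw ⟨h, h'⟩) hcw
    exact ⟨_, polyFun_comp_linear he (LinearMap.snd ℂ (Mat n) (Mat n)), hew,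
      fun z' hz' => he0 _ hz'.2⟩
  · exact ⟨_, polyFun_comp_linear (polyFun_sub isPolyMat_id.det (const_mem_polyFun 1))
      (LinearMap.fst ℂ (Mat n) (Mat n)), sub_ne_zero.2 h, fun z' hz' => sub_eq_zero.2 hz'.1⟩

end Transfer

/-! ## Surjective matrices -/

section Surjective

/-- If all maximal minors vanish then so does the form `minorForm M`, although it is one on
preimages of the standard basis. Surjectivity thereby becomes a Zariski open condition. -/
theorem exists_minor_ne_zero_iff {a b : ℕ} (M : Matrix (Fin a) (Fin b) ℂ) :
    Function.Surjective M.mulVec ↔ ∃ t : Fin a → Fin b, (M.submatrix id t).det ≠ 0 := by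
  constructor
  · intro h
    by_contra! hcon
    have hzero : minorForm M = 0 := by
      refine Module.Basis.ext_alternating (Pi.basisFun ℂ (Fin b)) fun t _ => ?_
      have := minorForm_frame M 1 t
      rw [Matrix.mul_one, hcon] at this
      simpa only [one_mulVec, Pi.basisFun_apply, AlternatingMap.zero_apply] using this
    choose s hs using h
    have h1 : minorForm M (fun i => s (Pi.single i 1)) = 1 := by
      rw [minorForm_apply]
      refine (congrArg Matrix.det ?_).trans (det_one (R := ℂ) (n := Fin a))
      ext i j
      rw [of_apply, hs, one_apply, Pi.single_apply]
      simp only [eq_comm]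
    rw [hzero, AlternatingMap.zero_apply] at h1
    exact zero_ne_one h1
  · rintro ⟨t, ht⟩ v
    have hu : IsUnit (M.submatrix id t).det := isUnit_iff_ne_zero.2 ht
    have hsub : M.submatrix id t = M * (1 : Mat b).submatrix id t := by
      ext i j
      rw [mul_apply]
      simp [one_apply]
    refine ⟨((1 : Mat b).submatrix id t) *ᵥ ((M.submatrix id t)⁻¹ *ᵥ v), ?_⟩
    rw [mulVec_mulVec, ← hsub, mulVec_mulVec, mul_nonsing_inv _ hu, one_mulVec]

/-- Both maps are split surjections with kernels of equal dimension, so an automorphism of the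
source carries one to the other. Strictness of `a < b` is what allows its determinant to be
normalised. -/
theorem exists_stdMat_mul_eq {a b : ℕ} (hab : a < b) (M : Matrix (Fin a) (Fin b) ℂ)
    (hM : Function.Surjective M.mulVec) :
    ∃ h : SLC b, stdMat a b * (h : Mat b) = M := by
  have hR := stdMat_surjective hab.le
  obtain ⟨s, hs⟩ := LinearMap.exists_rightInverse_of_surjective M.mulVecLin
    (LinearMap.range_eq_top.2 hM)
  obtain ⟨s', hs'⟩ := LinearMap.exists_rightInverse_of_surjective (stdMat a b).mulVecLin
    (LinearMap.range_eq_top.2 hR)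
  have hker : Module.finrank ℂ (LinearMap.ker (stdMat a b).mulVecLin) =
      Module.finrank ℂ (LinearMap.ker M.mulVecLin) := by
    have h1 := LinearMap.finrank_range_add_finrank_ker M.mulVecLin
    have h2 := LinearMap.finrank_range_add_finrank_ker (stdMat a b).mulVecLin
    rw [LinearMap.range_eq_top.2 hM] at h1
    rw [LinearMap.range_eq_top.2 hR] at h2
    omega
  let ψ := LinearEquiv.ofFinrankEq _ _ hker
  let pr : (Fin b → ℂ) →ₗ[ℂ] LinearMap.ker (stdMat a b).mulVecLin :=
    (LinearMap.id - s' ∘ₗ (stdMat a b).mulVecLin).codRestrict _ fun v => by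
      rw [LinearMap.mem_ker, LinearMap.sub_apply, map_sub, LinearMap.comp_apply]
      have := LinearMap.congr_fun hs' ((stdMat a b).mulVecLin v)
      rw [LinearMap.comp_apply] at this
      rw [this]
      simp
  let T : (Fin b → ℂ) →ₗ[ℂ] (Fin b → ℂ) :=
    (LinearMap.ker M.mulVecLin).subtype ∘ₗ ψ.toLinearMap ∘ₗ pr + s ∘ₗ (stdMat a b).mulVecLin
  have hMT : M.mulVecLin ∘ₗ T = (stdMat a b).mulVecLin := by
    refine LinearMap.ext fun v => ?_
    simp only [T, LinearMap.comp_apply, LinearMap.add_apply, map_add, Submodule.subtype_apply]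
    rw [LinearMap.mem_ker.1 (ψ.toLinearMap (pr v)).2, zero_add]
    exact LinearMap.congr_fun hs ((stdMat a b).mulVecLin v)
  have hinj : LinearMap.ker T = ⊥ := by
    rw [LinearMap.ker_eq_bot']
    intro v hv
    have h1 : (stdMat a b).mulVecLin v = 0 := by rw [← hMT, LinearMap.comp_apply, hv, map_zero]
    have h2 : ψ (pr v) = 0 := by
      apply Subtype.ext
      simpa [T, h1] using hv
    have h3 : pr v = 0 := by simpa using h2
    simpa [pr, h1] using congrArg Subtype.val h3
  let N : Mat b := LinearMap.toMatrix' T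
  have hMN : M * N = stdMat a b := by
    have := congrArg LinearMap.toMatrix' hMT
    rwa [LinearMap.toMatrix'_comp, ← Matrix.toLin'_apply', ← Matrix.toLin'_apply',
      LinearMap.toMatrix'_toLin', LinearMap.toMatrix'_toLin'] at this
  have hNu : IsUnit N.det := by
    rw [← isUnit_iff_isUnit_det]
    exact Matrix.mulVec_injective_iff_isUnit.1 (by
      have := LinearMap.ker_eq_bot.1 hinj
      intro v w hvw
      apply this
      simpa only [N, LinearMap.toMatrix'_mulVec] using hvw)
  have hNi : stdMat a b * N⁻¹ = M := by
    rw [← hMN, Matrix.mul_assoc, mul_nonsing_inv _ hNu, Matrix.mul_one]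
  -- Coordinate `0` is not among the last `a`, so rescaling it corrects the determinant without
  -- changing the product with `stdMat a b`.
  let D : Mat b := diagonal (Function.update 1 ⟨0, by omega⟩ N.det)
  refine ⟨⟨D * N⁻¹, ?_⟩, ?_⟩
  · rw [det_mul, det_diagonal, Finset.prod_update_of_mem (Finset.mem_univ _), det_nonsing_inv,
      Ring.inverse_eq_inv']
    simpa using mul_inv_cancel₀ hNu.ne_zero
  · change stdMat a b * (D * N⁻¹) = M
    rw [← hNi]
    ext i j
    rw [stdMat_mul hab.le, stdMat_mul hab.le, submatrix_apply, submatrix_apply, diagonal_mul,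
      Function.update_of_ne]
    · simp
    · intro h
      have := congrArg Fin.val h
      simp only [emb] at this
      omega

end Surjective

/-! ## The quotient of the space of surjective quivers -/

section QuiverQuotient

variable {m : ℕ} {d : Fin (m + 1) → ℕ}

/-- The composition of the maps `β` from the last vertex to the vertex `j`. -/
def betaProd (x : QuiverRep d) : ∀ j : Fin (m + 1), Matrix (Fin (d j)) (Fin (d (Fin.last m))) ℂ :=
  Fin.reverseInduction 1 fun i P => x.2 i * P

theorem betaProd_last (x : QuiverRep d) : betaProd x (Fin.last m) = 1 := by
  simp [betaProd]

theorem betaProd_castSucc (x : QuiverRep d) (i : Fin m) :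
    betaProd x i.castSucc = x.2 i * betaProd x i.succ := by
  simp [betaProd]

theorem betaProd_act (g : ∀ j : Fin (m + 1), SLC (d j)) (x : QuiverRep d) (j : Fin (m + 1)) :
    betaProd (act g x) j = (g j : Mat (d j)) * (betaProd x j *
      (((g (Fin.last m))⁻¹ : SLC (d (Fin.last m))) : Mat (d (Fin.last m)))) := by
  induction j using Fin.reverseInduction with
  | last => rw [betaProd_last, betaProd_last, Matrix.one_mul, coe_mul_coe_inv]
  | cast i ih =>
    rw [betaProd_castSucc, betaProd_castSucc, ih]
    simp only [act, Matrix.mul_assoc, coe_inv_mul_cancel_left]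

theorem betaProd_of_isStandard (hd : StrictMono d) {x : QuiverRep d} (hx : IsStandard x)
    (j : Fin (m + 1)) : betaProd x j = stdMat (d j) (d (Fin.last m)) := by
  induction j using Fin.reverseInduction with
  | last => rw [betaProd_last, stdMat_self]
  | cast i ih =>
    rw [betaProd_castSucc, ih, isStandard_iff.1 hx, stdMat_mul_stdMat (le_succ hd i) (le_last hd _)]

/-- The forms attached to a quiver. -/
def quiverForms (x : QuiverRep d) (j : Fin (m + 1)) :
    (Fin (d (Fin.last m)) → ℂ) [⋀^Fin (d j)]→ₗ[ℂ] ℂ := minorForm (betaProd x j)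

/-- The invariants of a quiver. -/
def quiverInv (x : QuiverRep d) : InvSpace d := (lastY x, quiverForms x)

theorem quiverForms_hAct (h : hGroup d) (x : QuiverRep d) :
    quiverForms (hAct h x) = quiverForms x := by
  have h1 : h.1 (Fin.last m) = 1 := h.2
  ext1 j
  rw [quiverForms, hAct, betaProd_act, minorForm_mul, (h.1 j).det_coe, one_smul, h1, inv_one,
    Matrix.SpecialLinearGroup.coe_one, Matrix.mul_one, quiverForms]

theorem lastY_hAct (h : hGroup d) (x : QuiverRep d) : lastY (hAct h x) = lastY x := by
  have h1 : h.1 (Fin.last m) = 1 := h.2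
  rw [hAct, lastY_act, h1, inv_one, Matrix.SpecialLinearGroup.coe_one, Matrix.mul_one,
    Matrix.one_mul]

theorem quiverForms_slAct (hd : StrictMono d) {x : QuiverRep d} (hx : IsStandard x)
    (g : SLC (d (Fin.last m))) : quiverForms (slAct g x) =
      flagForms d ((g⁻¹ : SLC (d (Fin.last m))) : Mat (d (Fin.last m))) := by
  ext1 j
  rw [quiverForms, slAct, betaProd_act, minorForm_mul, Matrix.SpecialLinearGroup.det_coe, one_smul,
    Pi.mulSingle_eq_same, betaProd_of_isStandard hd hx, flagForms]

theorem lastY_slAct (x : QuiverRep d) (g : SLC (d (Fin.last m))) : lastY (slAct g x) =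
    (g : Mat (d (Fin.last m))) * lastY x *
      ((g⁻¹ : SLC (d (Fin.last m))) : Mat (d (Fin.last m))) := by
  rw [slAct, lastY_act, Pi.mulSingle_eq_same]

theorem exists_hAct_eq {g g' : ∀ j : Fin (m + 1), SLC (d j)}
    (h : g (Fin.last m) = g' (Fin.last m)) (x : QuiverRep d) :
    ∃ k : hGroup d, hAct k (act g x) = act g' x :=
  ⟨⟨g' * g⁻¹, by
    change g' (Fin.last m) * (g (Fin.last m))⁻¹ = 1
    rw [h, mul_inv_cancel]⟩, by rw [hAct, ← act_mul, inv_mul_cancel_right]⟩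

/-- Starting from the identity at vertex `0`, the equation `(0 I) g (i+1) = g i β i` is solved for
`g (i+1)` vertex by vertex. -/
theorem exists_isStandard_act (hd : StrictMono d) {x : QuiverRep d} (hx : AllSurj x) :
    ∃ g : ∀ j : Fin (m + 1), SLC (d j), IsStandard (act g x) := by
  have step : ∀ i : Fin m, ∀ h : SLC (d i.castSucc), ∃ h' : SLC (d i.succ),
      stdMat (d i.castSucc) (d i.succ) * (h' : Mat (d i.succ)) =
        (h : Mat (d i.castSucc)) * x.2 i := fun i h =>
    exists_stdMat_mul_eq (hd i.castSucc_lt_succ) _ fun v => by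
      obtain ⟨w, hw⟩ := hx i (((h⁻¹ : SLC (d i.castSucc)) : Mat (d i.castSucc)) *ᵥ v)
      exact ⟨w, by rw [← mulVec_mulVec, hw, mulVec_mulVec, coe_mul_coe_inv, one_mulVec]⟩
  choose next hnext using step
  let g : ∀ j : Fin (m + 1), SLC (d j) := fun j => Fin.induction 1 (fun i h => next i h) j
  have hg : ∀ i : Fin m, g i.succ = next i (g i.castSucc) := fun i => by
    simp only [g, Fin.induction_succ]
  refine ⟨g, isStandard_iff.2 fun i => ?_⟩
  simp only [act]
  rw [← hnext i (g i.castSucc), ← hg, Matrix.mul_assoc, coe_mul_coe_inv, Matrix.mul_one]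

/-- Every quiver with surjective `β` lies in the orbit of one in standard form. -/
theorem exists_hAct_slAct_eq (hd : StrictMono d) {x : QuiverRep d} (hx : AllSurj x) :
    ∃ (g : ∀ j : Fin (m + 1), SLC (d j)) (k : hGroup d), IsStandard (act g x) ∧
      hAct k (slAct (g (Fin.last m))⁻¹ (act g x)) = x := by
  obtain ⟨g, hg⟩ := exists_isStandard_act hd hx
  obtain ⟨k, hk⟩ := exists_hAct_eq (g := Pi.mulSingle (Fin.last m) (g (Fin.last m))⁻¹) (g' := g⁻¹)
    (by rw [Pi.mulSingle_eq_same, Pi.inv_apply]) (act g x)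
  refine ⟨g, k, hg, ?_⟩
  rw [slAct, hk, ← act_mul, inv_mul_cancel, act_one]

/-- The corners of an element of `unimodularParabolic`. -/
def cornerSL (hd : StrictMono d) (p : unimodularParabolic hd) (j : Fin (m + 1)) : SLC (d j) :=
  ⟨corner d j (p.1 : Mat (d (Fin.last m))), p.2.2 j⟩

theorem cornerSL_last (hd : StrictMono d) (p : unimodularParabolic hd) :
    cornerSL hd p (Fin.last m) = p.1 := Subtype.ext (corner_last _)

theorem isStandard_act_cornerSL (hd : StrictMono d) (p : unimodularParabolic hd) {x : QuiverRep d}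
    (hx : IsStandard x) : IsStandard (act (cornerSL hd p) x) := isStandard_iff.2 fun i => by
  simp only [act]
  have h : (cornerSL hd p i.castSucc : Mat (d i.castSucc)) * stdMat (d i.castSucc) (d i.succ) =
      stdMat (d i.castSucc) (d i.succ) * (cornerSL hd p i.succ : Mat (d i.succ)) :=
    (corner_stdMat hd p.2.1 i).symm
  rw [isStandard_iff.1 hx, h, Matrix.mul_assoc, coe_mul_coe_inv, Matrix.mul_one]

/-- The counterpart for quivers of `(g, v) ∼ (g p⁻¹, p v p⁻¹)`: both sides come from group elements
with the same last component, hence differ by `H_ℂ`. -/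
theorem exists_hAct_slAct_cornerSL (hd : StrictMono d) (p : unimodularParabolic hd)
    (g : SLC (d (Fin.last m))) (x : QuiverRep d) :
    ∃ k : hGroup d, hAct k (slAct g x) = slAct (g * p.1⁻¹) (act (cornerSL hd p) x) := by
  rw [slAct, slAct, ← act_mul]
  refine exists_hAct_eq ?_ x
  rw [Pi.mul_apply, Pi.mulSingle_eq_same, Pi.mulSingle_eq_same, cornerSL_last,
    inv_mul_cancel_right]

/-- No matrix computation is needed: the corners of `p` move the standard quiver of `v` to another
standard solution, whose matrix is the conjugate. -/
theorem conj_mem_scalarBlock (hd : StrictMono d) (h0 : 0 < d 0) :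
    ∀ p ∈ unimodularParabolic hd, ∀ v ∈ scalarBlock d,
      (p : Mat (d (Fin.last m))) * v * ((p⁻¹ : SLC _) : Mat (d (Fin.last m))) ∈ scalarBlock d := by
  intro p hp v hv
  have h := lastY_mem_scalarBlock hd h0
    (act_mem_surjSol (stdQuiver_mem_surjSol hd h0 hv) (cornerSL hd ⟨p, hp⟩))
    (isStandard_act_cornerSL hd ⟨p, hp⟩ (isStandard_stdQuiver hd h0 v))
  rwa [lastY_act, cornerSL_last, lastY_stdQuiver hd h0 hv] at h

theorem act_cornerSL_stdQuiver (hd : StrictMono d) (h0 : 0 < d 0) (p : unimodularParabolic hd)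
    {v : Mat (d (Fin.last m))} (hv : v ∈ scalarBlock d) :
    act (cornerSL hd p) (stdQuiver hd h0 v) = stdQuiver hd h0
      ((p.1 : Mat (d (Fin.last m))) * v * ((p.1⁻¹ : SLC _) : Mat (d (Fin.last m)))) := by
  have h := stdQuiver_lastY hd h0
    (act_mem_surjSol (stdQuiver_mem_surjSol hd h0 hv) (cornerSL hd p))
    (isStandard_act_cornerSL hd p (isStandard_stdQuiver hd h0 v))
  rw [lastY_act, cornerSL_last, lastY_stdQuiver hd h0 hv] at h
  exact h.symm

open Classical in
/-- A matrix of determinant one as an element of `SL`. -/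
def toSL {n : ℕ} (A : Mat n) : SLC n := if h : A.det = 1 then ⟨A, h⟩ else 1

theorem toSL_coe {n : ℕ} (g : SLC n) : toSL (g : Mat n) = g := by
  exact dif_pos g.det_coe

/-- The quiver attached to a pair of matrices. -/
def pairQuiver (hd : StrictMono d) (h0 : 0 < d 0)
    (z : Mat (d (Fin.last m)) × Mat (d (Fin.last m))) : QuiverRep d :=
  slAct (toSL z.1) (stdQuiver hd h0 z.2)

/-! ### Regularity of the maps between quivers, pairs and invariants -/

section Regularity

variable {V : Type*} [AddCommGroup V] [Module ℂ V] {U : Set V}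

theorem isRegularMap_act {g : V → ∀ j : Fin (m + 1), SLC (d j)} {x : V → QuiverRep d}
    (hg : ∀ j, IsRegularMap (fun v => (g v j : Mat (d j))) U) (hx : IsRegularMap x U) :
    IsRegularMap (fun v => act (g v) (x v)) U := by
  have hi : ∀ j, IsRegularMap (fun v => (((g v j)⁻¹ : SLC (d j)) : Mat (d j))) U := fun j =>
    (hg j).adjugate.congr fun v _ => Matrix.SpecialLinearGroup.coe_inv _
  exact (IsRegularMap.pi fun i => ((hg i.succ).matMul (hx.fst.apply_pi i)).matMul
    (hi i.castSucc)).prodMk (IsRegularMap.pi fun i =>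
      ((hg i.castSucc).matMul (hx.snd.apply_pi i)).matMul (hi i.succ))

theorem isRegularMap_stdQuiver (hd : StrictMono d) (h0 : 0 < d 0) {Y : V → Mat (d (Fin.last m))}
    (hY : IsRegularMap Y U) (hne : ∀ v ∈ U, ∀ j, blockScalar hd h0 (Y v) j ≠ 0) :
    IsRegularMap (fun v => stdQuiver hd h0 (Y v)) U := by
  refine (IsRegularMap.pi fun i => ?_).prodMk (IsRegularMap.const _ U)
  exact ((IsRegularMap.smul ((hY.entry _ _).inv fun v hv => hne v hv i.succ)
    (((IsRegularMap.const _ U).matMul hY).matMul (IsRegularMap.const _ U))).sub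
      (IsRegularMap.const 1 U)).matMul (IsRegularMap.const _ U)

theorem isRegularMap_pairQuiver (hd : StrictMono d) (h0 : 0 < d 0)
    {F : Set (Mat (d (Fin.last m)))} (hF : ∀ v ∈ F, ∀ j, blockScalar hd h0 v j ≠ 0) :
    IsRegularMap (pairQuiver hd h0) (slProd F) := by
  refine isRegularMap_act (fun j => ?_) (isRegularMap_stdQuiver hd h0 (IsRegularMap.id _).snd
    fun z hz => hF _ hz.2)
  by_cases hj : j = Fin.last m
  · subst hj
    refine (IsRegularMap.id (slProd F)).fst.congr fun z hz => ?_
    obtain ⟨g, v, -, rfl⟩ := exists_coe_of_mem_slProd hz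
    rw [Pi.mulSingle_eq_same, toSL_coe]
  · refine (IsRegularMap.const 1 (slProd F)).congr fun z hz => ?_
    rw [Pi.mulSingle_eq_of_ne hj, Matrix.SpecialLinearGroup.coe_one]

theorem isRegularMap_incoming {x : V → QuiverRep d} (hx : IsRegularMap x U) (j : Fin (m + 1)) :
    IsRegularMap (fun v => incoming (x v) j) U := by
  cases j using Fin.cases with
  | zero => exact IsRegularMap.const 0 U
  | succ i => exact (hx.fst.apply_pi i).matMul (hx.snd.apply_pi i)

theorem isRegularMap_lastY {x : V → QuiverRep d} (hx : IsRegularMap x U) :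
    IsRegularMap (fun v => lastY (x v)) U :=
  (IsRegularMap.const 1 U).add (isRegularMap_incoming hx _)

theorem isRegularMap_quiverForms {x : V → QuiverRep d} (hx : IsRegularMap x U) :
    IsRegularMap (fun v => quiverForms (x v)) U := by
  have h : ∀ j, IsRegularMap (fun v => betaProd (x v) j) U := fun j => by
    induction j using Fin.reverseInduction with
    | last => exact (IsRegularMap.const 1 U).congr fun v _ => betaProd_last _
    | cast i ih =>
      exact ((hx.snd.apply_pi i).matMul ih).congr fun v _ => betaProd_castSucc _ _
  exact IsRegularMap.pi fun j => isRegularMap_minorForm (h j)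

end Regularity

/-! ### The spaces of solutions are quasi-affine -/

section QuasiAffine

variable {V : Type*} [AddCommGroup V] [Module ℂ V]

theorem isPolyMat_alpha (L : V →ₗ[ℂ] QuiverRep d) (i : Fin m) :
    IsPolyMat fun v => (L v).1 i := fun a b =>
  polyFun_comp_linear (isPolyMat_id a b) (LinearMap.proj i ∘ₗ LinearMap.fst ℂ _ _ ∘ₗ L)

theorem isPolyMat_beta (L : V →ₗ[ℂ] QuiverRep d) (i : Fin m) :
    IsPolyMat fun v => (L v).2 i := fun a b =>
  polyFun_comp_linear (isPolyMat_id a b) (LinearMap.proj i ∘ₗ LinearMap.snd ℂ _ _ ∘ₗ L)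

theorem isPolyMat_one_add_incoming (L : V →ₗ[ℂ] QuiverRep d) (j : Fin (m + 1)) :
    IsPolyMat fun v => 1 + incoming (L v) j := by
  refine (IsPolyMat.const 1).add ?_
  cases j using Fin.cases with
  | zero => exact IsPolyMat.const 0
  | succ i => exact (isPolyMat_alpha L i).mul (isPolyMat_beta L i)

theorem isPolyMat_one_add_beta_mul_alpha (L : V →ₗ[ℂ] QuiverRep d) (i : Fin m) :
    IsPolyMat fun v => 1 + (L v).2 i * (L v).1 i :=
  (IsPolyMat.const 1).add ((isPolyMat_beta L i).mul (isPolyMat_alpha L i))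

theorem isQuasiAffine_quivers (L : V →ₗ[ℂ] QuiverRep d) {E : Set (V → ℂ)} (hE : E ⊆ polyFun V)
    {Z : Set V} (hZ : ∀ v, v ∈ Z ↔ (IsMult (L v) ∧ AllSurj (L v)) ∧ ∀ e ∈ E, e v = 0) :
    IsQuasiAffine Z := by
  refine isQuasiAffine_of_conditions (ι := Fin m ⊕ Fin m ⊕ Fin m)
    (Sum.elim (fun i => {fun v => (1 + (L v).1 i * (L v).2 i).det})
      (Sum.elim (fun i => {fun v => (1 + (L v).2 i * (L v).1 i).det})
        fun i => Set.range fun t v => (((L v).2 i).submatrix id t).det)) E ?_ hE fun v => ?_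
  · rintro (i | i | i)
    · rintro _ rfl
      exact ((IsPolyMat.const 1).add ((isPolyMat_alpha L i).mul (isPolyMat_beta L i))).det
    · rintro _ rfl
      exact (isPolyMat_one_add_beta_mul_alpha L i).det
    · rintro _ ⟨t, rfl⟩
      exact IsPolyMat.det fun a b => isPolyMat_beta L i a (t b)
  · rw [hZ v]
    simp only [Sum.forall, Sum.elim_inl, Sum.elim_inr, Set.mem_singleton_iff, exists_eq_left,
      Set.exists_range_iff, IsMult, AllSurj, exists_minor_ne_zero_iff, isUnit_iff_isUnit_det,
      isUnit_iff_ne_zero, forall_and, and_assoc]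

/-- Being a multiple of a nonzero matrix amounts to the vanishing of all cross products of entries.
The matrix `1 + αβ` is nonzero because it is invertible of positive size. This removes the
quantifier over `q`. -/
theorem exists_multEq_iff (hd : StrictMono d) (h0 : 0 < d 0) {x : QuiverRep d} (hx : IsMult x) :
    (∃ q, MultEq x q) ↔ ∀ i : Fin m, ∀ a b a' b',
      (1 + x.2 i * x.1 i : Mat (d i.castSucc)) a b * (1 + incoming x i.castSucc) a' b' -
        (1 + x.2 i * x.1 i : Mat (d i.castSucc)) a' b' * (1 + incoming x i.castSucc) a b = 0 := by
  constructor
  · rintro ⟨q, hq⟩ i a b a' b'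
    rw [hq i, Matrix.smul_apply, Matrix.smul_apply, smul_eq_mul, smul_eq_mul]
    ring
  · intro h
    have hN : ∀ i : Fin m, ∃ a b, (1 + incoming x i.castSucc) a b ≠ 0 := fun i => by
      by_contra! hcon
      have hu := isUnit_one_add_incoming hx i.castSucc
      have : Nonempty (Fin (d i.castSucc)) := ⟨⟨0, dim_pos hd h0 _⟩⟩
      have hzero : 1 + incoming x i.castSucc = 0 := by ext a b; exact hcon a b
      rw [hzero] at hu
      exact not_isUnit_zero hu
    choose a b hab using hN
    refine ⟨fun i => (1 + x.2 i * x.1 i : Mat (d i.castSucc)) (a i) (b i) /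
      (1 + incoming x i.castSucc) (a i) (b i),
      fun i => ?_⟩
    ext a' b'
    rw [Matrix.smul_apply, smul_eq_mul, div_mul_eq_mul_div, eq_div_iff (hab i)]
    linear_combination h i a' b' (a i) (b i)

theorem isQuasiAffine_surjSol (hd : StrictMono d) (h0 : 0 < d 0) : IsQuasiAffine (surjSol d) := by
  refine isQuasiAffine_quivers LinearMap.id
    (E := {e | ∃ (i : Fin m) (a b a' b' : _), e = fun x : QuiverRep d =>
      (1 + x.2 i * x.1 i : Mat (d i.castSucc)) a b * (1 + incoming x i.castSucc) a' b' -
        (1 + x.2 i * x.1 i : Mat (d i.castSucc)) a' b' *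
          (1 + incoming x i.castSucc) a b}) ?_ fun x => ?_
  · rintro _ ⟨i, a, b, a', b', rfl⟩
    have h1 := isPolyMat_one_add_beta_mul_alpha (d := d) LinearMap.id i
    have h2 := isPolyMat_one_add_incoming (d := d) LinearMap.id i.castSucc
    exact polyFun_sub (polyFun_mul (h1 a b) (h2 a' b')) (polyFun_mul (h1 a' b') (h2 a b))
  · constructor
    · rintro ⟨h1, h2, h3⟩
      refine ⟨⟨h1, h3⟩, ?_⟩
      rintro _ ⟨i, a, b, a', b', rfl⟩
      exact (exists_multEq_iff hd h0 h1).1 h2 i a b a' b'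
    · rintro ⟨⟨h1, h3⟩, h⟩
      exact ⟨h1, (exists_multEq_iff hd h0 h1).2 fun i a b a' b' => h _ ⟨i, a, b, a', b', rfl⟩, h3⟩

theorem isQuasiAffine_modSurjSol : IsQuasiAffine (modSurjSol d) := by
  refine isQuasiAffine_quivers (LinearMap.fst ℂ (QuiverRep d) (Fin (m + 1) → ℂ))
    (E := insert (fun s => ∏ j, s.2 j - 1) {e | ∃ (i : Fin m) (a b : _),
      e = fun s : QuiverRep d × (Fin (m + 1) → ℂ) =>
        s.2 i.castSucc * (1 + s.1.2 i * s.1.1 i : Mat (d i.castSucc)) a b -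
          s.2 i.succ * (1 + incoming s.1 i.castSucc) a b}) ?_ fun s => ?_
  · have ht : ∀ j, (fun s : QuiverRep d × (Fin (m + 1) → ℂ) => s.2 j) ∈ polyFun _ := fun j =>
      dual_mem_polyFun ((LinearMap.proj j : (Fin (m + 1) → ℂ) →ₗ[ℂ] ℂ) ∘ₗ
        LinearMap.snd ℂ (QuiverRep d) (Fin (m + 1) → ℂ))
    rintro _ (rfl | ⟨i, a, b, rfl⟩)
    · exact polyFun_sub (polyFun_prod _ fun j _ => ht j) (const_mem_polyFun 1)
    · have h1 := isPolyMat_one_add_beta_mul_alpha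
        (LinearMap.fst ℂ (QuiverRep d) (Fin (m + 1) → ℂ)) i
      have h2 := isPolyMat_one_add_incoming
        (LinearMap.fst ℂ (QuiverRep d) (Fin (m + 1) → ℂ)) i.castSucc
      exact polyFun_sub (polyFun_mul (ht i.castSucc) (h1 a b)) (polyFun_mul (ht i.succ) (h2 a b))
  · simp only [LinearMap.fst_apply, Set.forall_mem_insert, sub_eq_zero]
    constructor
    · rintro ⟨h1, ⟨h2, h2'⟩, h3⟩
      refine ⟨⟨h1, h3⟩, h2, ?_⟩
      rintro _ ⟨i, a, b, rfl⟩
      exact sub_eq_zero.2 (congrFun (congrFun (h2' i) a) b)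
    · rintro ⟨⟨h1, h3⟩, h2, h⟩
      refine ⟨h1, ⟨h2, fun i => ?_⟩, h3⟩
      ext a b
      exact sub_eq_zero.1 (h _ ⟨i, a, b, rfl⟩)

theorem isQuasiAffine_scalarBlock (hd : StrictMono d) (h0 : 0 < d 0) :
    IsQuasiAffine (scalarBlock d) := by
  classical
  refine isQuasiAffine_of_conditions (ι := Fin (m + 1)) (fun j => {fun Y => blockScalar hd h0 Y j})
    (insert (fun Y => blockScalar hd h0 Y (Fin.last m) - 1)
      {e | ∃ r s : Fin (d (Fin.last m)), level r ≤ level s ∧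
        e = fun Y => Y r s - if r = s then blockScalar hd h0 Y (level s) else 0}) ?_ ?_ fun Y => ?_
  · rintro j _ rfl
    exact isPolyMat_id _ _
  · rintro _ (rfl | ⟨r, s, -, rfl⟩)
    · exact polyFun_sub (isPolyMat_id _ _) (const_mem_polyFun 1)
    · refine polyFun_sub (isPolyMat_id _ _) ?_
      split_ifs
      · exact isPolyMat_id _ _
      · exact const_mem_polyFun 0
  · rw [mem_scalarBlock_iff hd h0]
    simp only [Set.mem_singleton_iff, exists_eq_left, Set.forall_mem_insert, sub_eq_zero]
    constructor
    · rintro ⟨h1, h2, h3⟩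
      refine ⟨h2, h1, ?_⟩
      rintro _ ⟨r, s, hrs, rfl⟩
      exact sub_eq_zero.2 (h3 r s hrs)
    · rintro ⟨h2, h1, h3⟩
      exact ⟨h1, h2, fun r s hrs => sub_eq_zero.1 (h3 _ ⟨r, s, hrs, rfl⟩)⟩

end QuasiAffine

end QuiverQuotient

/-! ## The quotients for general dimension vectors -/

section GeneralQuotient

variable {m : ℕ} {d : Fin (m + 1) → ℕ} {F : Set (Mat (d (Fin.last m)))} {W : Type*}
  [AddCommGroup W] [Module ℂ W]

theorem exists_section_equiv_twistInv (hd : StrictMono d) (h0 : 0 < d 0)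
    (hF : ∀ p ∈ unimodularParabolic hd, ∀ v ∈ F,
      (p : Mat (d (Fin.last m))) * v * ((p⁻¹ : SLC _) : Mat (d (Fin.last m))) ∈ F)
    (e : InvSpace d ≃ₗ[ℂ] W) :
    ∀ z ∈ (fun u => e (twistInv d u)) '' slProd F, ∃ c σ, c z ≠ 0 ∧
      IsLocalSection (slProd F) (fun u => e (twistInv d u)) c σ ∧
        IsRegularMap σ {w | c w ≠ 0} := by
  rintro _ ⟨u, hu, rfl⟩
  obtain ⟨c, σ, hc, hs, hr⟩ := exists_section_twistInv hd h0 hF _ ⟨u, hu, rfl⟩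
  exact ⟨_, _, by simpa using hc, hs.linearEquiv_comp e,
    hr.comp (IsRegularMap.linear e.symm.toLinearMap _) fun _ hw => hw⟩

theorem isRegularMap_equiv_twistInv (e : InvSpace d ≃ₗ[ℂ] W)
    (U : Set (Mat (d (Fin.last m)) × Mat (d (Fin.last m)))) :
    IsRegularMap (fun u => e (twistInv d u)) U :=
  (isRegularMap_twistInv U).linear_comp e.toLinearMap

theorem isQuasiAffine_image_twistInv (hd : StrictMono d) (h0 : 0 < d 0) (hFq : IsQuasiAffine F)
    (hF : ∀ p ∈ unimodularParabolic hd, ∀ v ∈ F,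
      (p : Mat (d (Fin.last m))) * v * ((p⁻¹ : SLC _) : Mat (d (Fin.last m))) ∈ F)
    (e : InvSpace d ≃ₗ[ℂ] W) : IsQuasiAffine ((fun u => e (twistInv d u)) '' slProd F) :=
  isQuasiAffine_image (isQuasiAffine_slProd hFq) (isRegularMap_equiv_twistInv e _)
    (exists_section_equiv_twistInv hd h0 hF e)

/-- The geometric quotient `SL ×_S F`. -/
theorem isGeometricQuotient_twist (hd : StrictMono d) (h0 : 0 < d 0)
    {S : Subgroup (SLC (d (Fin.last m)))} (hS : S = unimodularParabolic hd)
    (hFq : IsQuasiAffine F)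
    (hF : ∀ p ∈ unimodularParabolic hd, ∀ v ∈ F,
      (p : Mat (d (Fin.last m))) * v * ((p⁻¹ : SLC _) : Mat (d (Fin.last m))) ∈ F)
    (e : InvSpace d ≃ₗ[ℂ] W) :
    IsGeometricQuotient (twist S) (slProd F) ((fun u => e (twistInv d u)) '' slProd F)
      fun u => e (twistInv d u) := by
  refine isGeometricQuotient_of_sections (isQuasiAffine_slProd hFq) (fun p u hu => ⟨?_, ?_⟩)
    (isRegularMap_equiv_twistInv e _) (fun x hx y hy => ?_)
    (isQuasiAffine_image_twistInv hd h0 hFq hF e) fun z hz => ?_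
  · rw [twist, det_mul, hu.1, Matrix.SpecialLinearGroup.det_coe, one_mul]
  · exact hF _ (hS ▸ p.2) _ hu.2
  · rw [e.injective.eq_iff]
    exact twistInv_eq_iff hd h0 hS x hx y hy
  · obtain ⟨c, σ, hc, hs, -⟩ := exists_section_equiv_twistInv hd h0 hF e z hz
    exact ⟨c, σ, hc, hs⟩

theorem quiverInv_slAct (hd : StrictMono d) {x : QuiverRep d} (hx : IsStandard x)
    (g : SLC (d (Fin.last m))) :
    quiverInv (slAct g x) = twistInv d ((g : Mat (d (Fin.last m))), lastY x) := by
  rw [quiverInv, lastY_slAct, quiverForms_slAct hd hx, twistInv_coe]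

theorem pairQuiver_coe (hd : StrictMono d) (h0 : 0 < d 0) (g : SLC (d (Fin.last m)))
    (v : Mat (d (Fin.last m))) :
    pairQuiver hd h0 ((g : Mat (d (Fin.last m))), v) = slAct g (stdQuiver hd h0 v) := by
  rw [pairQuiver, toSL_coe]

theorem isRegularMap_quiverInv (U : Set (QuiverRep d)) : IsRegularMap quiverInv U :=
  (isRegularMap_lastY (IsRegularMap.id U)).prodMk (isRegularMap_quiverForms (IsRegularMap.id U))

/-- The geometric quotient of the space of surjective quivers. -/
theorem isGeometricQuotient_quiver (hd : StrictMono d) (h0 : 0 < d 0) (e : InvSpace d ≃ₗ[ℂ] W) :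
    IsGeometricQuotient hAct (surjSol d)
      ((fun u => e (twistInv d u)) '' slProd (scalarBlock d)) fun x => e (quiverInv x) := by
  have hF := conj_mem_scalarBlock hd h0
  refine isGeometricQuotient_transfer (φ := pairQuiver hd h0)
    (isQuasiAffine_image_twistInv hd h0 (isQuasiAffine_scalarBlock hd h0) hF e)
    (fun z hz => ?_) (isQuasiAffine_surjSol hd h0) (fun g h x => act_mul g.1 h.1 x)
    (fun x => act_one x) (fun g x hx => act_mem_surjSol hx g.1)
    ((isRegularMap_quiverInv _).linear_comp e.toLinearMap) (fun g x _ => ?_)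
    (isRegularMap_pairQuiver hd h0 fun v hv => ((mem_scalarBlock_iff hd h0).1 hv).2.1)
    (fun u hu => act_mem_surjSol (stdQuiver_mem_surjSol hd h0 hu.2) _) (fun u hu => ?_)
    (fun x hx => ?_) fun u hu u' hu' h => ?_
  · obtain ⟨c, σ, hc, hs, -⟩ := exists_section_equiv_twistInv hd h0 hF e z hz
    exact ⟨c, σ, hc, hs⟩
  · rw [quiverInv, lastY_hAct, quiverForms_hAct, quiverInv]
  · obtain ⟨g, v, hv, rfl⟩ := exists_coe_of_mem_slProd hu
    rw [pairQuiver_coe, quiverInv_slAct hd (isStandard_stdQuiver hd h0 v),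
      lastY_stdQuiver hd h0 hv]
  · obtain ⟨g, k, hst, hk⟩ := exists_hAct_slAct_eq hd hx.2.2
    have hmem := act_mem_surjSol hx g
    refine ⟨_, coe_mem_slProd (g (Fin.last m))⁻¹ (lastY_mem_scalarBlock hd h0 hmem hst), k, ?_⟩
    rw [pairQuiver_coe, stdQuiver_lastY hd h0 hmem hst, hk]
  · obtain ⟨g, v, hv, rfl⟩ := exists_coe_of_mem_slProd hu
    obtain ⟨g', v', hv', rfl⟩ := exists_coe_of_mem_slProd hu'
    obtain ⟨p, hp, rfl, rfl⟩ := exists_of_twistInv_eq hd h0 (e.injective h)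
    obtain ⟨k, hk⟩ := exists_hAct_slAct_cornerSL hd ⟨p, hp⟩ g (stdQuiver hd h0 v)
    refine ⟨k, ?_⟩
    rw [pairQuiver_coe, pairQuiver_coe, hk, act_cornerSL_stdQuiver hd h0 ⟨p, hp⟩ hv]

end GeneralQuotient

/-! ## The full flag -/

section FullFlag

variable {m : ℕ}

theorem fullFlag_zero_pos (m : ℕ) : 0 < fullFlag m 0 := Nat.succ_pos _

theorem topRow_fullFlag (j : Fin (m + 1)) :
    topRow (strictMono_fullFlag m) (fullFlag_zero_pos m) j = (Fin.rev j : Fin (m + 1)) := by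
  have h := emb_rev (le_last (strictMono_fullFlag m) j) ⟨0, dim_pos (strictMono_fullFlag m)
    (fullFlag_zero_pos m) j⟩
  have h2 := (topRow (strictMono_fullFlag m) (fullFlag_zero_pos m) j).2
  apply Fin.ext
  change ((topRow (strictMono_fullFlag m) (fullFlag_zero_pos m) j).rev : ℕ) = _ at h
  simp only [Fin.val_rev, fullFlag, Fin.val_last] at h h2 ⊢
  omega

theorem blockScalar_fullFlag (Y : Mat (m + 1)) (j : Fin (m + 1)) :
    blockScalar (strictMono_fullFlag m) (fullFlag_zero_pos m) Y j = Y j.rev j.rev := by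
  rw [blockScalar, topRow_fullFlag]

theorem level_fullFlag (a : Fin (m + 1)) : level (d := fullFlag m) a = a.rev := by
  apply Fin.ext
  simp only [level, blockIdx_fullFlag, Fin.val_rev]
  omega

theorem level_condition_iff {Y : Mat (m + 1)} :
    (∀ r s, level (d := fullFlag m) r ≤ level (d := fullFlag m) s →
    Y r s = if r = s then blockScalar (strictMono_fullFlag m) (fullFlag_zero_pos m) Y
      (level (d := fullFlag m) s) else 0) ↔ Y.BlockTriangular id := by
  constructor
  · intro h r s hrs
    have hrs : s < r := hrs
    rw [h r s (by rw [level_fullFlag, level_fullFlag, Fin.rev_le_rev]; exact hrs.le),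
      if_neg hrs.ne']
  · intro h (r : Fin (m + 1)) (s : Fin (m + 1)) hrs
    rw [level_fullFlag, level_fullFlag, Fin.rev_le_rev] at hrs
    by_cases hr : r = s
    · subst hr
      rw [if_pos rfl, blockScalar_fullFlag, level_fullFlag, Fin.rev_rev]
    · rw [if_neg hr]
      exact h (lt_of_le_of_ne hrs (Ne.symm hr))

theorem mem_borelOneSet_iff {Y : Mat (m + 1)} : Y ∈ borelOneSet m ↔
    Y.BlockTriangular id ∧ Y 0 0 = 1 ∧ ∀ a, Y a a ≠ 0 := by
  have hdet : Y.BlockTriangular id → (Y.det ≠ 0 ↔ ∀ a, Y a a ≠ 0) := fun h => by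
    rw [det_of_isUpperTriangular h, Finset.prod_ne_zero_iff]
    simp
  constructor
  · rintro ⟨b, rfl⟩
    exact ⟨b.2.1, b.2.2, (hdet b.2.1).1 (isUnit_iff_ne_zero.1
      ((isUnit_iff_isUnit_det _).1 b.1.isUnit))⟩
  · rintro ⟨h, h1, hne⟩
    exact ⟨⟨GeneralLinearGroup.mkOfDetNeZero Y ((hdet h).2 hne), h, h1⟩, rfl⟩

theorem borelOneSet_eq_scalarBlock (m : ℕ) : borelOneSet m = scalarBlock (fullFlag m) := by
  ext Y
  rw [mem_borelOneSet_iff, mem_scalarBlock_iff (strictMono_fullFlag m) (fullFlag_zero_pos m),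
    level_condition_iff]
  simp only [blockScalar_fullFlag, Fin.rev_last]
  constructor
  · rintro ⟨h, h1, h2⟩
    exact ⟨h1, fun j => h2 _, h⟩
  · rintro ⟨h1, h2, h⟩
    exact ⟨h, h1, fun a => by simpa using h2 a.rev⟩

theorem mem_borelSet_iff {n : ℕ} {b : Mat n} :
    b ∈ borelSet n ↔ b.BlockTriangular id ∧ b.det = 1 := by
  constructor
  · rintro ⟨b, rfl⟩
    exact ⟨b.2, b.1.det_coe⟩
  · rintro ⟨h, h1⟩
    exact ⟨⟨⟨b, h1⟩, h⟩, rfl⟩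

theorem diag_ne_zero_of_mem_borelSet {n : ℕ} {b : Mat n} (hb : b ∈ borelSet n) (a : Fin n) :
    b a a ≠ 0 := by
  obtain ⟨b, rfl⟩ := hb
  exact borelSL_diag_ne_zero b a

theorem inv_smul_mem_borelOneSet {b : Mat (m + 1)} (hb : b ∈ borelSet (m + 1)) :
    (b 0 0)⁻¹ • b ∈ borelOneSet m := by
  obtain ⟨b, rfl⟩ := hb
  exact ⟨rho m b, rfl⟩

theorem isQuasiAffine_borelSet (n : ℕ) : IsQuasiAffine (borelSet n) := by
  refine isQuasiAffine_of_conditions (ι := Empty) Empty.elim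
    (insert (fun b => b.det - 1) {e | ∃ i j : Fin n, j < i ∧ e = fun b => b i j})
    (fun i => i.elim) ?_ fun b => ?_
  · rintro _ (rfl | ⟨i, j, -, rfl⟩)
    · exact polyFun_sub isPolyMat_id.det (const_mem_polyFun 1)
    · exact isPolyMat_id i j
  · rw [mem_borelSet_iff]
    simp only [IsEmpty.forall_iff, true_and, Set.forall_mem_insert, sub_eq_zero]
    constructor
    · rintro ⟨h, h1⟩
      refine ⟨h1, ?_⟩
      rintro _ ⟨i, j, hij, rfl⟩
      exact h hij
    · rintro ⟨h1, h⟩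
      exact ⟨fun i j hij => h _ ⟨i, j, hij, rfl⟩, h1⟩

theorem conj_mem_borelSet {n : ℕ} {p : SLC n} (hp : p ∈ borelSL n) {b : Mat n}
    (hb : b ∈ borelSet n) : (p : Mat n) * b * ((p⁻¹ : SLC n) : Mat n) ∈ borelSet n := by
  obtain ⟨b, rfl⟩ := hb
  exact ⟨⟨p * b.1 * p⁻¹, mul_mem (mul_mem hp b.2) (inv_mem hp)⟩, by
    simp only [Matrix.SpecialLinearGroup.coe_mul]⟩

theorem conj_diag_of_mem_borelSet {n : ℕ} {p : SLC n} (hp : p ∈ unip n) {b : Mat n}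
    (hb : b ∈ borelSet n) (a : Fin n) :
    ((p : Mat n) * b * ((p⁻¹ : SLC n) : Mat n)) a a = b a a := by
  have hb' := (mem_borelSet_iff.1 hb).1
  rw [upper_mul_diag (BlockTriangular.mul hp.1 hb') (inv_mem hp).1, upper_mul_diag hp.1 hb', hp.2,
    (inv_mem hp).2, one_mul, mul_one]

end FullFlag

/-! ## The modified equations -/

section Modified

variable {m : ℕ} {d : Fin (m + 1) → ℕ}

theorem modMultEq_ne_zero {x : QuiverRep d} {t : Fin (m + 1) → ℂ} (h : ModMultEq x t)
    (j : Fin (m + 1)) : t j ≠ 0 := fun h0 =>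
  zero_ne_one ((Finset.prod_eq_zero (Finset.mem_univ j) h0).symm.trans h.1)

theorem ModMultEq.multEq {x : QuiverRep d} {t : Fin (m + 1) → ℂ} (h : ModMultEq x t) :
    MultEq x fun i => t i.succ / t i.castSucc := fun i => by
  have := congrArg (fun M => (t i.castSucc)⁻¹ • M) (h.2 i)
  simp only [inv_smul_smul₀ (modMultEq_ne_zero h i.castSucc), smul_smul] at this
  beta_reduce
  rw [this, div_eq_inv_mul]

theorem mem_surjSol_of_mem_modSurjSol {s : QuiverRep d × (Fin (m + 1) → ℂ)}
    (hs : s ∈ modSurjSol d) : s.1 ∈ surjSol d := ⟨hs.1, ⟨_, hs.2.1.multEq⟩, hs.2.2⟩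

theorem blockScalar_lastY_of_mem_modSurjSol (hd : StrictMono d) (h0 : 0 < d 0)
    {s : QuiverRep d × (Fin (m + 1) → ℂ)} (hs : s ∈ modSurjSol d) (hst : IsStandard s.1)
    (j : Fin (m + 1)) :
    blockScalar hd h0 (lastY s.1) j = s.2 (Fin.last m) / s.2 j := by
  have hne := modMultEq_ne_zero hs.2.1
  rw [blockScalar_lastY hd h0 hst hs.2.1.multEq]
  -- The scalar `t (i+1) / t i` is the ratio of the inverses in the opposite order, which fits the
  -- telescoping product.
  have h := prod_div_telescope (fun j => (s.2 j)⁻¹) (fun j => inv_ne_zero (hne j)) j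
  simp only [inv_div_inv] at h
  exact h

theorem stdQuiver_mem_modSurjSol (hd : StrictMono d) (h0 : 0 < d 0) {Y : Mat (d (Fin.last m))}
    (hY : Y ∈ scalarBlock d) {t : Fin (m + 1) → ℂ} (ht : ∏ j, t j = 1)
    (h : ∀ j, t j * blockScalar hd h0 Y j = t (Fin.last m)) :
    (stdQuiver hd h0 Y, t) ∈ modSurjSol d := by
  obtain ⟨h1, -, h3⟩ := stdQuiver_mem_surjSol hd h0 hY
  obtain ⟨-, hne, hY⟩ := (mem_scalarBlock_iff hd h0).1 hY
  refine ⟨h1, ⟨ht, fun i => ?_⟩, h3⟩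
  have key : t i.castSucc * (blockScalar hd h0 Y i.succ)⁻¹ =
      t i.succ * (blockScalar hd h0 Y i.castSucc)⁻¹ := by
    rw [← div_eq_mul_inv, ← div_eq_mul_inv, div_eq_div_iff (hne _) (hne _), h, h]
  rw [beta_mul_alpha_stdQuiver, one_add_incoming_stdQuiver hd h0 hY hne, smul_smul, smul_smul, key]

theorem blockScalar_smul (hd : StrictMono d) (h0 : 0 < d 0) (c : ℂ) (Y : Mat (d (Fin.last m)))
    (j : Fin (m + 1)) : blockScalar hd h0 (c • Y) j = c * blockScalar hd h0 Y j := rfl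

/-- Each corner is divided by a diagonal entry of the same matrix, so the construction is
homogeneous of degree zero and can be applied to elements of `B` without normalising them. -/
theorem stdQuiver_smul (hd : StrictMono d) (h0 : 0 < d 0) {c : ℂ} (hc : c ≠ 0)
    (Y : Mat (d (Fin.last m))) : stdQuiver hd h0 (c • Y) = stdQuiver hd h0 Y := by
  have h : ∀ j, corner d j (c • Y) = c • corner d j Y := fun j => by
    rw [corner, corner, Matrix.mul_smul, Matrix.smul_mul]
  simp only [stdQuiver, h, blockScalar_smul, smul_smul, _root_.mul_inv_rev, mul_assoc,
    inv_mul_cancel₀ hc, mul_one]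

/-- The matrix attached to a solution of the modified equations. -/
def modY (s : QuiverRep d × (Fin (m + 1) → ℂ)) : Mat (d (Fin.last m)) :=
  (s.2 (Fin.last m))⁻¹ • lastY s.1

/-- The invariants of a solution of the modified equations. -/
def modInv (s : QuiverRep d × (Fin (m + 1) → ℂ)) : InvSpace d := (modY s, quiverForms s.1)

theorem modInv_slAct (hd : StrictMono d) {s : QuiverRep d × (Fin (m + 1) → ℂ)}
    (hs : IsStandard s.1) (g : SLC (d (Fin.last m))) :
    modInv (slAct g s.1, s.2) = twistInv d ((g : Mat (d (Fin.last m))), modY s) := by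
  simp only [modInv, modY]
  rw [lastY_slAct, quiverForms_slAct hd hs, twistInv_coe, Matrix.mul_smul, Matrix.smul_mul]

theorem modInv_hActMod (h : hGroup d) (s : QuiverRep d × (Fin (m + 1) → ℂ)) :
    modInv (hActMod h s) = modInv s := by
  have h1 := lastY_hAct h s.1
  have h2 := quiverForms_hAct h s.1
  rw [hAct] at h1 h2
  simp only [modInv, modY, hActMod, h1, h2]

theorem isRegularMap_modInv : IsRegularMap (modInv (d := d)) (modSurjSol d) := by
  have h1 := (IsRegularMap.id (modSurjSol d)).fst
  have h2 := ((IsRegularMap.id (modSurjSol d)).snd.apply_pi (Fin.last m)).regularOn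
  exact (IsRegularMap.smul (h2.inv fun s hs => modMultEq_ne_zero hs.2.1 _)
    (isRegularMap_lastY h1)).prodMk (isRegularMap_quiverForms h1)

end Modified

/-! ### The modified equations for the full flag -/

section ModifiedFullFlag

variable {m : ℕ}

/-- The solution of the modified equations in standard form attached to `b`. -/
def modStd (b : Mat (m + 1)) : QuiverRep (fullFlag m) × (Fin (m + 1) → ℂ) :=
  (stdQuiver (strictMono_fullFlag m) (fullFlag_zero_pos m) b, fun j => (b j.rev j.rev)⁻¹)

theorem isStandard_modStd (b : Mat (m + 1)) : IsStandard (modStd b).1 :=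
  isStandard_stdQuiver (d := fullFlag m) (strictMono_fullFlag m) (fullFlag_zero_pos m) b

theorem modStd_fst {b : Mat (m + 1)} (hb : b ∈ borelSet (m + 1)) :
    (modStd b).1 = stdQuiver (strictMono_fullFlag m) (fullFlag_zero_pos m) ((b 0 0)⁻¹ • b) :=
  (stdQuiver_smul (d := fullFlag m) (strictMono_fullFlag m) (fullFlag_zero_pos m)
    (inv_ne_zero (diag_ne_zero_of_mem_borelSet hb 0)) b).symm

theorem inv_smul_mem_scalarBlock {b : Mat (m + 1)} (hb : b ∈ borelSet (m + 1)) :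
    (b 0 0)⁻¹ • b ∈ scalarBlock (fullFlag m) :=
  borelOneSet_eq_scalarBlock m ▸ inv_smul_mem_borelOneSet hb

theorem prod_rev_diag {b : Mat (m + 1)} (hb : b.BlockTriangular id) :
    ∏ j : Fin (m + 1), b j.rev j.rev = b.det := by
  rw [det_of_isUpperTriangular hb]
  exact Equiv.prod_comp Fin.revPerm fun a => b a a

theorem modStd_mem {b : Mat (m + 1)} (hb : b ∈ borelSet (m + 1)) :
    modStd b ∈ modSurjSol (fullFlag m) := by
  obtain ⟨htri, hdet⟩ := mem_borelSet_iff.1 hb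
  have h : ((modStd b).1, (modStd b).2) ∈ modSurjSol (fullFlag m) := by
    rw [modStd_fst hb]
    refine stdQuiver_mem_modSurjSol _ _ (inv_smul_mem_scalarBlock hb) ?_ fun j => ?_
    · simp only [modStd, Finset.prod_inv_distrib]
      rw [prod_rev_diag htri, hdet, inv_one]
    · have := diag_ne_zero_of_mem_borelSet hb j.rev
      rw [blockScalar_fullFlag]
      simp only [modStd, Fin.rev_last]
      change _ * ((b 0 0)⁻¹ * b j.rev j.rev) = _
      field_simp
  exact h

theorem lastY_modStd {b : Mat (m + 1)} (hb : b ∈ borelSet (m + 1)) :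
    lastY (modStd b).1 = (b 0 0)⁻¹ • b := by
  rw [modStd_fst hb, lastY_stdQuiver _ _ (inv_smul_mem_scalarBlock hb)]

theorem modY_modStd {b : Mat (m + 1)} (hb : b ∈ borelSet (m + 1)) : modY (modStd b) = b := by
  have := diag_ne_zero_of_mem_borelSet hb 0
  rw [modY, lastY_modStd hb]
  simp only [modStd, Fin.rev_last, inv_inv]
  exact smul_inv_smul₀ this b

/-- The diagonal of `Y` consists of the ratios of the last scalar to the others, so dividing by the
last scalar leaves their inverses. Thus the scalars are recovered from the matrix, and product one
becomes determinant one. -/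
theorem modY_diag {s : QuiverRep (fullFlag m) × (Fin (m + 1) → ℂ)}
    (hs : s ∈ modSurjSol (fullFlag m)) (hst : IsStandard s.1) (j : Fin (m + 1)) :
    modY s j.rev j.rev = (s.2 j)⁻¹ := by
  have h := blockScalar_lastY_of_mem_modSurjSol (strictMono_fullFlag m)
    (fullFlag_zero_pos m) hs hst j
  have hne := modMultEq_ne_zero hs.2.1
  rw [blockScalar_fullFlag] at h
  change (s.2 (Fin.last m))⁻¹ * lastY s.1 j.rev j.rev = _
  rw [h, div_eq_mul_inv, inv_mul_cancel_left₀ (hne _)]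

theorem modY_mem_borelSet {s : QuiverRep (fullFlag m) × (Fin (m + 1) → ℂ)}
    (hs : s ∈ modSurjSol (fullFlag m)) (hst : IsStandard s.1) : modY s ∈ borelSet (m + 1) := by
  have hY : lastY s.1 ∈ borelOneSet m := by
    rw [borelOneSet_eq_scalarBlock]
    exact lastY_mem_scalarBlock (strictMono_fullFlag m) (fullFlag_zero_pos m)
      (mem_surjSol_of_mem_modSurjSol hs) hst
  have htri : (modY s : Mat (m + 1)).BlockTriangular id := fun i j hij => by
    change (s.2 (Fin.last m))⁻¹ * lastY s.1 i j = 0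
    rw [(mem_borelOneSet_iff.1 hY).1 hij, mul_zero]
  refine mem_borelSet_iff.2 ⟨htri, ?_⟩
  rw [← prod_rev_diag htri]
  simp only [modY_diag hs hst, Finset.prod_inv_distrib]
  exact inv_eq_one.2 hs.2.1.1

theorem modStd_modY {s : QuiverRep (fullFlag m) × (Fin (m + 1) → ℂ)}
    (hs : s ∈ modSurjSol (fullFlag m)) (hst : IsStandard s.1) : modStd (modY s) = s := by
  refine Prod.ext ?_ (funext fun j => ?_)
  · change stdQuiver _ _ ((s.2 (Fin.last m))⁻¹ • lastY s.1) = _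
    rw [stdQuiver_smul _ _ (inv_ne_zero (modMultEq_ne_zero hs.2.1 _)),
      stdQuiver_lastY _ _ (mem_surjSol_of_mem_modSurjSol hs) hst]
  · change (modY s j.rev j.rev)⁻¹ = _
    rw [modY_diag hs hst, inv_inv]

theorem bijOn_modY (m : ℕ) : Set.BijOn modY
    {s | s ∈ modSurjSol (fullFlag m) ∧ IsStandard s.1} (borelSet (m + 1)) :=
  Set.InvOn.bijOn (f' := modStd) ⟨fun _ hs => modStd_modY hs.1 hs.2, fun _ hb => modY_modStd hb⟩
    (fun _ hs => modY_mem_borelSet hs.1 hs.2) fun b hb => ⟨modStd_mem hb, isStandard_modStd b⟩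

theorem act_cornerSL_modStd {p : SLC (m + 1)}
    (hp : p ∈ unimodularParabolic (strictMono_fullFlag m)) {b : Mat (m + 1)}
    (hb : b ∈ borelSet (m + 1)) :
    (act (cornerSL (strictMono_fullFlag m) ⟨p, hp⟩) (modStd b).1, (modStd b).2) =
      modStd ((p : Mat (m + 1)) * b * ((p⁻¹ : SLC (m + 1)) : Mat (m + 1))) := by
  have hp' : p ∈ unip (m + 1) := unimodularParabolic_fullFlag m ▸ hp
  refine Prod.ext ?_ (funext fun j => ?_)
  · change act _ (modStd b).1 = (modStd _).1
    rw [modStd_fst hb, modStd_fst (conj_mem_borelSet hp'.1 hb), conj_diag_of_mem_borelSet hp' hb,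
      act_cornerSL_stdQuiver _ _ ⟨p, hp⟩ (inv_smul_mem_scalarBlock hb), Matrix.mul_smul,
        Matrix.smul_mul]
  · change (b j.rev j.rev)⁻¹ = (((p : Mat (m + 1)) * b * ((p⁻¹ : SLC (m + 1)) : Mat (m + 1)))
      j.rev j.rev)⁻¹
    rw [conj_diag_of_mem_borelSet hp' hb]

/-- The solution of the modified equations attached to a pair of matrices. -/
def pairMod (z : Mat (m + 1) × Mat (m + 1)) : QuiverRep (fullFlag m) × (Fin (m + 1) → ℂ) :=
  (pairQuiver (strictMono_fullFlag m) (fullFlag_zero_pos m) z, (modStd z.2).2)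

theorem pairMod_coe (g : SLC (m + 1)) (b : Mat (m + 1)) :
    pairMod ((g : Mat (m + 1)), b) = (slAct (d := fullFlag m) g (modStd b).1, (modStd b).2) := by
  rw [pairMod, pairQuiver_coe (d := fullFlag m)]
  rfl

theorem conj_mem_borelSet_of_unimodular : ∀ p : SLC (m + 1),
    p ∈ unimodularParabolic (strictMono_fullFlag m) → ∀ v ∈ borelSet (m + 1),
      (p : Mat (m + 1)) * v * ((p⁻¹ : SLC (m + 1)) : Mat (m + 1)) ∈ borelSet (m + 1) :=
        fun p hp v hv => by
  rw [unimodularParabolic_fullFlag] at hp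
  exact conj_mem_borelSet hp.1 hv

theorem isRegularMap_pairMod : IsRegularMap (pairMod (m := m)) (slProd (borelSet (m + 1))) := by
  refine IsRegularMap.prodMk (isRegularMap_pairQuiver _ _ fun v hv j => ?_)
    (IsRegularMap.pi fun j => IsRegularMap.of_regularOn ?_)
  · rw [blockScalar_fullFlag]
    exact diag_ne_zero_of_mem_borelSet hv _
  · exact ((IsRegularMap.id _).snd.entry _ _).inv fun z hz => diag_ne_zero_of_mem_borelSet hz.2 _

/-- The geometric quotient of the space of solutions of the modified equations. -/
theorem isGeometricQuotient_modQuiver {W : Type*} [AddCommGroup W] [Module ℂ W]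
    (e : InvSpace (fullFlag m) ≃ₗ[ℂ] W) :
    IsGeometricQuotient hActMod (modSurjSol (fullFlag m))
      ((fun u => e (twistInv (fullFlag m) u)) '' slProd (borelSet (m + 1)))
      fun s => e (modInv s) := by
  have hd := strictMono_fullFlag m
  have h0 := fullFlag_zero_pos m
  have hF := conj_mem_borelSet_of_unimodular (m := m)
  refine isGeometricQuotient_transfer (φ := pairMod)
    (isQuasiAffine_image_twistInv hd h0 (isQuasiAffine_borelSet (m + 1)) hF e)
    (fun z hz => ?_) isQuasiAffine_modSurjSol
    (fun g h s => Prod.ext (act_mul g.1 h.1 s.1) rfl)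
    (fun s => Prod.ext (act_one s.1) rfl) (fun g s hs => act_mem_modSurjSol hs g.1)
    (isRegularMap_modInv.linear_comp e.toLinearMap) (fun g s _ => ?_)
    isRegularMap_pairMod (fun u hu => act_mem_modSurjSol (modStd_mem hu.2) _) (fun u hu => ?_)
    (fun s hs => ?_) fun u hu u' hu' h => ?_
  · obtain ⟨c, σ, hc, hs, -⟩ := exists_section_equiv_twistInv hd h0 hF e z hz
    exact ⟨c, σ, hc, hs⟩
  · rw [modInv_hActMod]
  · obtain ⟨g, v, hv, rfl⟩ := exists_coe_of_mem_slProd hu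
    rw [pairMod_coe, modInv_slAct hd (isStandard_modStd v), modY_modStd hv]
  · obtain ⟨g, k, hst, hk⟩ := exists_hAct_slAct_eq hd hs.2.2
    have hmem := act_mem_modSurjSol hs g
    refine ⟨_, coe_mem_slProd (g (Fin.last m))⁻¹ (modY_mem_borelSet hmem hst), k, ?_⟩
    rw [pairMod_coe, modStd_modY hmem hst]
    exact Prod.ext hk rfl
  · obtain ⟨g, v, hv, rfl⟩ := exists_coe_of_mem_slProd hu
    obtain ⟨g', v', hv', rfl⟩ := exists_coe_of_mem_slProd hu'
    obtain ⟨p, hp, rfl, rfl⟩ := exists_of_twistInv_eq (d := fullFlag m) hd h0 (e.injective h)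
    obtain ⟨k, hk⟩ := exists_hAct_slAct_cornerSL hd ⟨p, hp⟩ g (modStd v).1
    refine ⟨k, ?_⟩
    rw [pairMod_coe, pairMod_coe, ← act_cornerSL_modStd hp hv]
    exact Prod.ext hk rfl

theorem twistInv_injective_right {m : ℕ} {d : Fin (m + 1) → ℕ} (g : SLC (d (Fin.last m)))
    {v v' : Mat (d (Fin.last m))} (h : twistInv d ((g : Mat (d (Fin.last m))), v) =
      twistInv d ((g : Mat (d (Fin.last m))), v')) : v = v' := by
  rw [twistInv_coe, twistInv_coe, Prod.mk.injEq] at h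
  have := congrArg (fun M => ((g⁻¹ : SLC _) : Mat (d (Fin.last m))) * M *
    (g : Mat (d (Fin.last m)))) h.1
  simpa only [Matrix.mul_assoc, coe_inv_mul_cancel_left, coe_inv_mul_coe, Matrix.mul_one] using this

/-- The morphism of quotients induced by `ρ`. -/
theorem exists_quotient_rho {k : ℕ} (e : InvSpace (fullFlag m) ≃ₗ[ℂ] (Fin k → ℂ)) :
    ∃ κ : (Fin k → ℂ) → Fin k → ℂ,
      IsMorphism κ ((fun u => e (twistInv (fullFlag m) u)) '' slProd (borelSet (m + 1)))
        ((fun u => e (twistInv (fullFlag m) u)) '' slProd (borelOneSet m)) ∧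
      ∀ (g : SLC (m + 1)), ∀ b ∈ borelSet (m + 1),
        κ (e (twistInv (fullFlag m) ((g : Mat (m + 1)), b))) =
          e (twistInv (fullFlag m) ((g : Mat (m + 1)), (b 0 0)⁻¹ • b)) := by
  have hS := unimodularParabolic_fullFlag m
  have hq := isGeometricQuotient_twist (strictMono_fullFlag m) (fullFlag_zero_pos m)
    hS.symm (isQuasiAffine_borelSet (m + 1)) conj_mem_borelSet_of_unimodular e
  -- The map is built upstairs on pairs and descends, since conjugation by `N` fixes the leading
  -- entry.
  have hmor : IsMorphism (fun z => e (twistInv (fullFlag m) (z.1, (z.2 0 0)⁻¹ • z.2)))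
      (slProd (borelSet (m + 1)))
      ((fun u => e (twistInv (fullFlag m) u)) '' slProd (borelOneSet m)) := by
    refine ⟨fun z hz => ⟨(z.1, (z.2 0 0)⁻¹ • z.2), ⟨hz.1, inv_smul_mem_borelOneSet hz.2⟩, rfl⟩, ?_⟩
    have h1 := IsRegularMap.id (slProd (borelSet (m + 1)))
    exact ((isRegularMap_twistInv (d := fullFlag m) Set.univ).comp (h1.fst.prodMk
      (IsRegularMap.smul ((h1.snd.entry 0 0).inv fun z hz => diag_ne_zero_of_mem_borelSet hz.2 0)
        h1.snd)) fun _ _ => trivial).linear_comp e.toLinearMap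
  obtain ⟨κ, hκ, h⟩ := hq.exists_descent hmor fun p z hz => by
    obtain ⟨g, b, hb, rfl⟩ := exists_coe_of_mem_slProd hz
    have hp : p.1 ∈ unip (m + 1) := p.2
    have hp' : p.1 ∈ unimodularParabolic (strictMono_fullFlag m) := by rw [hS]; exact p.2
    have h2 := twistInv_twist (strictMono_fullFlag m) hp' g ((b 0 0)⁻¹ • b)
    simp only [twist]
    rw [conj_diag_of_mem_borelSet hp hb]
    rw [Matrix.mul_smul, Matrix.smul_mul, Matrix.SpecialLinearGroup.coe_mul] at h2
    rw [← h2]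
  exact ⟨κ, hκ, fun g b hb => h _ (coe_mem_slProd g hb)⟩

end ModifiedFullFlag

/-! ## The covering `ρ` -/

section Rho

variable {m : ℕ}

theorem coe_rho (b : borelSL (m + 1)) : ((rho m b).1 : Mat (m + 1)) =
    ((b.1 : Mat (m + 1)) 0 0)⁻¹ • (b.1 : Mat (m + 1)) := rfl

theorem smul_coe_rho (b : borelSL (m + 1)) : (b.1 : Mat (m + 1)) 0 0 • ((rho m b).1 : Mat (m + 1)) =
    (b.1 : Mat (m + 1)) := smul_inv_smul₀ (borelSL_diag_ne_zero b 0) _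

theorem det_borelOne_ne_zero (y : borelOne m) : (y.1 : Mat (m + 1)).det ≠ 0 :=
  isUnit_iff_ne_zero.1 ((isUnit_iff_isUnit_det _).1 y.1.isUnit)

theorem leading_pow_mul_det_rho (b : borelSL (m + 1)) :
    (b.1 : Mat (m + 1)) 0 0 ^ (m + 1) * ((rho m b).1 : Mat (m + 1)).det = 1 := by
  have h := congrArg Matrix.det (smul_coe_rho b)
  rwa [det_smul, Fintype.card_fin, b.1.det_coe] at h

/-- The element of `B` with leading entry `c` over `y`. -/
def rhoLift (y : borelOne m) (c : ℂ) (hc : c ^ (m + 1) * (y.1 : Mat (m + 1)).det = 1) :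
    borelSL (m + 1) :=
  ⟨⟨c • (y.1 : Mat (m + 1)), by rw [det_smul, Fintype.card_fin, hc]⟩, fun i j hij => by
    change c * (y.1 : Mat (m + 1)) i j = 0
    rw [y.2.1 hij, mul_zero]⟩

theorem coe_rhoLift_leading (y : borelOne m) (c : ℂ)
    (hc : c ^ (m + 1) * (y.1 : Mat (m + 1)).det = 1) :
    ((rhoLift y c hc).1 : Mat (m + 1)) 0 0 = c := by
  change c * (y.1 : Mat (m + 1)) 0 0 = c
  rw [y.2.2, mul_one]

theorem rho_rhoLift (y : borelOne m) (c : ℂ) (hc : c ^ (m + 1) * (y.1 : Mat (m + 1)).det = 1) :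
    rho m (rhoLift y c hc) = y := by
  refine Subtype.ext (Units.ext ?_)
  have hne : c ≠ 0 := by
    rintro rfl
    simp at hc
  rw [coe_rho, coe_rhoLift_leading]
  exact inv_smul_smul₀ hne _

theorem ncard_pow_eq {n : ℕ} (hn : n ≠ 0) {a : ℂ} (ha : a ≠ 0) : {c : ℂ | c ^ n = a}.ncard = n := by
  classical
  have hζ := Complex.isPrimitiveRoot_exp n hn
  have h : {c : ℂ | c ^ n = a} = ((Polynomial.nthRoots n a).toFinset : Set ℂ) := by
    ext c
    simp [Polynomial.mem_nthRoots (Nat.pos_of_ne_zero hn)]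
  rw [h, Set.ncard_coe_finset, Multiset.toFinset_card_of_nodup (hζ.nthRoots_nodup ha),
    hζ.card_nthRoots, if_pos (IsAlgClosed.exists_pow_nat_eq a (Nat.pos_of_ne_zero hn))]

/-- A point over `y` is `c • y` with `c` its leading entry, and determinant one says `c ^ (m + 1) =
(det y)⁻¹`. -/
theorem ncard_rho_fibre (y : borelOne m) : (rho m ⁻¹' {y}).ncard = m + 1 := by
  have hinj : Set.InjOn (fun b : borelSL (m + 1) => (b.1 : Mat (m + 1)) 0 0) (rho m ⁻¹' {y}) := by
    intro b hb b' hb' h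
    refine Subtype.ext (Subtype.ext ?_)
    rw [← smul_coe_rho b, ← smul_coe_rho b', hb, hb']
    exact congrArg (· • (y.1 : Mat (m + 1))) h
  have hdet := det_borelOne_ne_zero y
  rw [← hinj.ncard_image]
  refine Eq.trans (congrArg Set.ncard ?_) (ncard_pow_eq m.succ_ne_zero (inv_ne_zero hdet))
  ext c
  simp only [Set.mem_image, Set.mem_preimage, Set.mem_singleton_iff, Set.mem_ofPred_eq]
  constructor
  · rintro ⟨b, rfl, rfl⟩
    exact eq_inv_of_mul_eq_one_left (leading_pow_mul_det_rho b)
  · intro hc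
    have hc' : c ^ (m + 1) * (y.1 : Mat (m + 1)).det = 1 := by
      rw [hc, inv_mul_cancel₀ hdet]
    exact ⟨rhoLift y c hc', rho_rhoLift y c hc', coe_rhoLift_leading y c hc'⟩

/-- `ρ` as a homomorphism of groups. -/
def rhoHom (m : ℕ) : borelSL (m + 1) →* borelOne m :=
  MonoidHom.mk' (rho m) fun b b' => by
    refine Subtype.ext (Units.ext ?_)
    change _ = ((rho m b).1 : Mat (m + 1)) * ((rho m b').1 : Mat (m + 1))
    rw [coe_rho, coe_rho, coe_rho]
    change (((b.1 * b'.1 : SLC (m + 1)) : Mat (m + 1)) 0 0)⁻¹ •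
      ((b.1 * b'.1 : SLC (m + 1)) : Mat (m + 1)) = _
    rw [Matrix.SpecialLinearGroup.coe_mul, upper_mul_diag b.2 b'.2, Matrix.smul_mul,
      Matrix.mul_smul, smul_smul, mul_inv]

theorem continuous_rho : Continuous (rho m) := by
  have hval : Continuous fun b : borelSL (m + 1) => ((rho m b).1 : Mat (m + 1)) := by
    have hb : Continuous fun b : borelSL (m + 1) => (b.1 : Mat (m + 1)) :=
      continuous_subtype_val.comp continuous_subtype_val
    exact ((hb.matrix_elem 0 0).inv₀ fun b => borelSL_diag_ne_zero b 0).smul hb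
  refine Continuous.subtype_mk (Units.continuous_iff.2 ⟨hval, ?_⟩) _
  have h : (fun b : borelSL (m + 1) => (((rho m b).1⁻¹ : GL (Fin (m + 1)) ℂ) : Mat (m + 1))) =
      fun b => ((rho m b⁻¹).1 : Mat (m + 1)) := by
    ext1 b
    exact congrArg (fun y : borelOne m => (y.1 : Mat (m + 1))) (map_inv (rhoHom m) b).symm
  exact h ▸ hval.comp continuous_inv

theorem isOpenMap_rho : IsOpenMap (rho m) := by
  refine IsOpenMap.of_sections fun b => ?_
  set y₀ := rho m b
  -- A section through `b`, using the principal root of a ratio that equals one at the base point.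
  -- It may be discontinuous elsewhere; continuity at `y₀` suffices for openness.
  let c : borelOne m → ℂ := fun y => (b.1 : Mat (m + 1)) 0 0 *
    ((y₀.1 : Mat (m + 1)).det / (y.1 : Mat (m + 1)).det) ^ (((m + 1 : ℕ) : ℂ)⁻¹)
  have hc : ∀ y, c y ^ (m + 1) * (y.1 : Mat (m + 1)).det = 1 := fun y => by
    have hy := det_borelOne_ne_zero y
    have h1 := leading_pow_mul_det_rho b
    simp only [c]
    rw [mul_pow, Complex.cpow_nat_inv_pow _ m.succ_ne_zero, mul_assoc, div_mul_cancel₀ _ hy, h1]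
  have hc₀ : c y₀ = (b.1 : Mat (m + 1)) 0 0 := by
    simp only [c]
    rw [div_self (det_borelOne_ne_zero y₀), Complex.one_cpow, mul_one]
  have hval : Continuous fun y : borelOne m => (y.1 : Mat (m + 1)) :=
    Units.continuous_val.comp continuous_subtype_val
  refine ⟨fun y => rhoLift y (c y) (hc y), ?_, Subtype.ext (Subtype.ext ?_),
    fun y => rho_rhoLift y (c y) (hc y)⟩
  · refine Topology.IsInducing.subtypeVal.continuousAt_iff.2
      (Matrix.SpecialLinearGroup.isClosedEmbedding_val.isInducing.continuousAt_iff.2 ?_)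
    refine ContinuousAt.smul (f := c) ?_ hval.continuousAt
    refine continuousAt_const.mul (ContinuousAt.comp (g := fun w : ℂ => w ^ (((m + 1 : ℕ) : ℂ)⁻¹))
      (continuousAt_cpow_const ?_) (continuousAt_const.div hval.matrix_det.continuousAt
        (det_borelOne_ne_zero y₀)))
    rw [div_self (det_borelOne_ne_zero y₀)]
    exact Complex.one_mem_slitPlane
  · change c y₀ • (y₀.1 : Mat (m + 1)) = _
    rw [hc₀, smul_coe_rho]

theorem rho_surjective (m : ℕ) : Function.Surjective (rho m) := fun y => by
  have h : (rho m ⁻¹' {y}).Nonempty := Set.nonempty_of_ncard_ne_zero (by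
    rw [ncard_rho_fibre]; exact m.succ_ne_zero)
  exact h

theorem isCoveringMap_rho (m : ℕ) : IsCoveringMap (rho m) := by
  have hq : Topology.IsQuotientMap (rhoHom m) :=
    isOpenMap_rho.isQuotientMap continuous_rho (rho_surjective m)
  refine (hq.isQuotientCoveringMap_of_isDiscrete_ker_monoidHom
    (Set.Finite.isDiscrete ?_)).isCoveringMap
  refine Set.finite_of_ncard_ne_zero (s := rho m ⁻¹' {1}) ?_
  rw [ncard_rho_fibre]
  exact m.succ_ne_zero

/-! ## The map of quotients induced by `ρ` -/

theorem quotient_rho_modInv {W : Type*} [AddCommGroup W] [Module ℂ W]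
    (e : InvSpace (fullFlag m) ≃ₗ[ℂ] W) {κ : W → W}
    (hκ : ∀ (g : SLC (m + 1)), ∀ b ∈ borelSet (m + 1),
      κ (e (twistInv (fullFlag m) ((g : Mat (m + 1)), b))) =
        e (twistInv (fullFlag m) ((g : Mat (m + 1)), (b 0 0)⁻¹ • b)))
    {s : QuiverRep (fullFlag m) × (Fin (m + 1) → ℂ)} (hs : s ∈ modSurjSol (fullFlag m)) :
    κ (e (modInv s)) = e (quiverInv s.1) := by
  have hd := strictMono_fullFlag m
  obtain ⟨g, k, hst, hk⟩ := exists_hAct_slAct_eq hd hs.2.2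
  have hmem := act_mem_modSurjSol hs g
  have hb := modY_mem_borelSet hmem hst
  have h1 : modInv s = modInv (slAct (g (Fin.last m))⁻¹ (act g s.1), s.2) := by
    rw [← modInv_hActMod k (slAct (g (Fin.last m))⁻¹ (act g s.1), s.2)]
    exact congrArg modInv (Prod.ext hk.symm rfl)
  have h2 : quiverInv s.1 = quiverInv (slAct (g (Fin.last m))⁻¹ (act g s.1)) := by
    conv_lhs => rw [← hk]
    rw [quiverInv, lastY_hAct, quiverForms_hAct, quiverInv]
  have h3 := lastY_modStd hb
  rw [modStd_modY hmem hst] at h3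
  rw [h1, h2, quiverInv_slAct hd hst, modInv_slAct hd (s := (act g s.1, s.2)) hst, h3]
  exact hκ _ _ hb

/-- Every class over that of `(g, y)` has exactly one representative with first component `g`: an
element of `N` moves it there, and the second component then lies over `y`. The fibre is thus a copy
of that of `ρ`. -/
theorem ncard_quotient_rho_fibre {W : Type*} [AddCommGroup W] [Module ℂ W]
    (e : InvSpace (fullFlag m) ≃ₗ[ℂ] W) {κ : W → W}
    (hκ : ∀ (g : SLC (m + 1)), ∀ b ∈ borelSet (m + 1),
      κ (e (twistInv (fullFlag m) ((g : Mat (m + 1)), b))) =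
        e (twistInv (fullFlag m) ((g : Mat (m + 1)), (b 0 0)⁻¹ • b)))
    (g : SLC (m + 1)) (y : borelOne m) :
    ((fun u => e (twistInv (fullFlag m) u)) '' slProd (borelSet (m + 1)) ∩
      κ ⁻¹' {e (twistInv (fullFlag m) ((g : Mat (m + 1)), (y.1 : Mat (m + 1))))}).ncard =
        m + 1 := by
  have hd := strictMono_fullFlag m
  have hinj : Function.Injective fun b : borelSL (m + 1) =>
      e (twistInv (fullFlag m) ((g : Mat (m + 1)), (b.1 : Mat (m + 1)))) := fun b b' h =>
    Subtype.ext (Subtype.ext (twistInv_injective_right (d := fullFlag m) g (e.injective h)))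
  refine Eq.trans (congrArg Set.ncard ?_)
    ((Set.ncard_image_of_injective (rho m ⁻¹' {y}) hinj).trans (ncard_rho_fibre y))
  ext w
  constructor
  · rintro ⟨⟨u, hu, rfl⟩, h⟩
    obtain ⟨g', _, ⟨b, rfl⟩, rfl⟩ := exists_coe_of_mem_slProd hu
    have h := (hκ g' _ ⟨b, rfl⟩).symm.trans h
    obtain ⟨(p : SLC (m + 1)), hp, rfl, hy⟩ := exists_of_twistInv_eq hd (fullFlag_zero_pos m)
      (e.injective h)
    have hp' : p ∈ unip (m + 1) := by rw [← unimodularParabolic_fullFlag]; exact hp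
    refine ⟨⟨p * b.1 * p⁻¹, mul_mem (mul_mem hp'.1 b.2) (inv_mem hp'.1)⟩,
      Subtype.ext (Units.ext ?_), ?_⟩
    · have hdiag := conj_diag_of_mem_borelSet hp' ⟨b, rfl⟩ 0
      rw [coe_rho, Matrix.SpecialLinearGroup.coe_mul, Matrix.SpecialLinearGroup.coe_mul, hdiag]
      rw [Matrix.mul_smul, Matrix.smul_mul] at hy
      exact hy
    · have := twistInv_twist hd hp g' (b.1 : Mat (m + 1))
      simp only [Matrix.SpecialLinearGroup.coe_mul] at this ⊢
      exact congrArg e this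
  · rintro ⟨b, rfl, rfl⟩
    exact ⟨⟨_, coe_mem_slProd g ⟨b, rfl⟩, rfl⟩, hκ g _ ⟨b, rfl⟩⟩

end Rho

end

end MultQuiver

/-! ### The main theorem -/

open MultQuiver

theorem mainTheorem2 :
    -- the full flag case, `n = m + 1`
    (∀ m : ℕ,
      -- quivers in standard form correspond to `B_1`, resp. `B` for the modified equations
      Set.BijOn lastY {x | x ∈ surjSol (fullFlag m) ∧ IsStandard x} (borelOneSet m) ∧
      Set.BijOn (fun s : QuiverRep (fullFlag m) × (Fin (m + 1) → ℂ) =>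
          (s.2 (Fin.last m))⁻¹ • lastY s.1)
        {s | s ∈ modSurjSol (fullFlag m) ∧ IsStandard s.1} (borelSet (m + 1)) ∧
      -- `ρ : B → B_1` is an `n`-fold cover
      IsCoveringMap (rho m) ∧
      (∀ y : borelOne m, (rho m ⁻¹' {y}).ncard = m + 1) ∧
      ∃ (k l : ℕ) (Z : Set (Fin k → ℂ)) (Z' : Set (Fin l → ℂ))
        (π₁ : Mat (m + 1) × Mat (m + 1) →
          Fin k → ℂ)
        (π₂ : QuiverRep (fullFlag m) → Fin k → ℂ)
        (π₁' : Mat (m + 1) × Mat (m + 1) →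
          Fin l → ℂ)
        (π₂' : QuiverRep (fullFlag m) × (Fin (m + 1) → ℂ) → Fin l → ℂ)
        (κ : (Fin l → ℂ) → Fin k → ℂ),
        -- `Z` is both `SL(n, ℂ) ×_N B_1` and the space of surjective quivers modulo `H_ℂ`
        IsGeometricQuotient (twist (unip (m + 1))) (slProd (borelOneSet m)) Z π₁ ∧
        IsGeometricQuotient hAct (surjSol (fullFlag m)) Z π₂ ∧
        (∀ (g : SLC (m + 1)), ∀ x ∈ surjSol (fullFlag m),
          IsStandard x → π₂ (slAct g x) = π₁ ((g : Mat (m + 1)), lastY x)) ∧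
        -- `Z'` is both `SL(n, ℂ) ×_N B` and the space of surjective solutions of the modified
        -- equations modulo `H_ℂ`
        IsGeometricQuotient (twist (unip (m + 1))) (slProd (borelSet (m + 1))) Z' π₁' ∧
        IsGeometricQuotient hActMod (modSurjSol (fullFlag m)) Z' π₂' ∧
        (∀ (g : SLC (m + 1)), ∀ s ∈ modSurjSol (fullFlag m),
          IsStandard s.1 →
            π₂' (slAct g s.1, s.2) = π₁' ((g : Mat (m + 1)), (s.2 (Fin.last m))⁻¹ • lastY s.1)) ∧
        -- forgetting the scalars corresponds to `ρ`, and is `n`-to-one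
        IsMorphism κ Z' Z ∧
        (∀ s ∈ modSurjSol (fullFlag m), s.1 ∈ surjSol (fullFlag m) ∧ κ (π₂' s) = π₂ s.1) ∧
        (∀ (g : SLC (m + 1)) (b : borelSL (m + 1)),
          κ (π₁' ((g : Mat (m + 1)), (b.1 : Mat (m + 1)))) = π₁ ((g : Mat (m + 1)), ((rho m b).1 : Mat (m + 1)))) ∧
        ∀ z ∈ Z, (Z' ∩ κ ⁻¹' {z}).ncard = m + 1) ∧
    -- the case of a general dimension vector `d 0 < d 1 < … < d m = n`
    (∀ (m : ℕ) (d : Fin (m + 1) → ℕ), StrictMono d → 0 < d 0 →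
      Set.BijOn lastY {x | x ∈ surjSol d ∧ IsStandard x} (scalarBlock d) ∧
      ∃ (k : ℕ) (Z : Set (Fin k → ℂ))
        (π₁ : Mat (d (Fin.last m)) ×
          Mat (d (Fin.last m)) → Fin k → ℂ)
        (π₂ : QuiverRep d → Fin k → ℂ),
        -- `Z` is both `SL(n, ℂ) ×_{[P,P]} 𝒫` and the space of surjective quivers modulo `H_ℂ`
        IsGeometricQuotient (twist ⁅parabolic d, parabolic d⁆) (slProd (scalarBlock d)) Z π₁ ∧
        IsGeometricQuotient hAct (surjSol d) Z π₂ ∧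
        ∀ (g : SLC (d (Fin.last m))), ∀ x ∈ surjSol d,
          IsStandard x → π₂ (slAct g x) = π₁ ((g : Mat (d (Fin.last m))), lastY x)) := by
  refine ⟨fun m => ?_, fun m d hd h0 => ⟨bijOn_lastY hd h0, ?_⟩⟩
  · have hd := strictMono_fullFlag m
    have h0 := fullFlag_zero_pos m
    let e := (Module.finBasis ℂ (InvSpace (fullFlag m))).equivFun
    obtain ⟨κ, hκ, hκe⟩ := exists_quotient_rho e
    have hS := (unimodularParabolic_fullFlag m).symm
    have hB := borelOneSet_eq_scalarBlock m
    have hQ₁ := isGeometricQuotient_twist hd h0 hS (isQuasiAffine_scalarBlock hd h0)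
      (conj_mem_scalarBlock hd h0) e
    have hQ₂ := isGeometricQuotient_quiver hd h0 e
    rw [← hB] at hQ₁ hQ₂
    have hQ₂' := isGeometricQuotient_modQuiver e
    refine ⟨hB ▸ bijOn_lastY hd h0, bijOn_modY m, isCoveringMap_rho m, ncard_rho_fibre, _, _, _, _,
      fun u => e (twistInv (fullFlag m) u), fun x => e (quiverInv x),
      fun u => e (twistInv (fullFlag m) u), fun s => e (modInv s), κ, hQ₁, hQ₂,
      fun g x _ hx => congrArg e (quiverInv_slAct hd hx g),
      isGeometricQuotient_twist hd h0 hS (isQuasiAffine_borelSet (m + 1))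
        conj_mem_borelSet_of_unimodular e, hQ₂',
      fun g s _ hs => congrArg e (modInv_slAct hd hs g), hκ,
      fun s hs => ⟨mem_surjSol_of_mem_modSurjSol hs, quotient_rho_modInv e hκe hs⟩,
      fun g b => hκe g _ ⟨b, rfl⟩, ?_⟩
    rintro _ ⟨u, hu, rfl⟩
    obtain ⟨g, _, ⟨y, rfl⟩, rfl⟩ := exists_coe_of_mem_slProd hu
    exact ncard_quotient_rho_fibre e hκe g y
  · let e := (Module.finBasis ℂ (InvSpace d)).equivFun
    exact ⟨_, _, fun u => e (twistInv d u), fun x => e (quiverInv x),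
      isGeometricQuotient_twist hd h0 (commutator_parabolic hd) (isQuasiAffine_scalarBlock hd h0)
        (conj_mem_scalarBlock hd h0) e,
      isGeometricQuotient_quiver hd h0 e,
      fun g x _ hx => congrArg e (quiverInv_slAct hd hx g)⟩
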